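/- Let $G$ be a (Hausdorff, real) Lie group whose Lie algebra $\mathfrak g$ is semisimple and carries a $|k|$-grading $\mathfrak g=\mathfrak g_{-k}\oplus\dots\oplus\mathfrak g_k$, $k\ge 1$, i.e. $[\mathfrak g_i,\mathfrak g_j]\subset\mathfrak g_{i+j}$, no simple ideal of $\mathfrak g$ is contained in $\mathfrak g_0$, and $\mathfrak g_-:=\bigoplus_{i<0}\mathfrak g_i$ is generated by $\mathfrak g_{-1}$. (Complex Lie algebras and groups are regarded as real ones.) Put $\mathfrak p:=\bigoplus_{i\ge 0}\mathfrak g_i$ and let $P\subset G$ be a parabolic subgroup, i.e. a subgroup lying between the normaliser $N_G(\mathfrak p)$ and the identity component of $N_G(\mathfrak p)$. Let $\pi:G\to G/P$ be the projection, where $G/P$ carries its smooth structure as a homogeneous space (the one for which $\pi$ is a submersion), and let $L_Y$ denote the left invariant vector field generated by $Y\in\mathfrak g$. Identify $T(G/P)$ with $G\times_P(\mathfrak g/\mathfrak p)$, the class $[u,Y+\mathfrak p]$ corresponding to the tangent vector $T_u\pi(L_Y(u))$ at $\pi(u)$. For $X\in\mathfrak g_-$ put $\Phi(X):=\exp_G(X)$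 and $\phi(X):=\pi(\Phi(X))$. The normal section determined by $e\in G$ is the map $\sigma:U\to G$ on $U:=\phi(\mathfrak g_-)$ with $\sigma(\phi(X))=\Phi(X)$. A normal frame of $T(G/P)$ determined by $e$ is a frame $(s_i)$ over $U$ of the form $s_i(x)=[\sigma(x),w_i]$ for a basis $(w_i)$ of $\mathfrak g/\mathfrak p$. Let $G_-$ be the connected and simply connected Lie group with Lie algebra $\mathfrak g_-$ (the Carnot group). Then: (1) $\phi$ is a diffeomorphism from $\mathfrak g_-$ onto the open subset $U\subset G/P$ (its inverse is the normal chart determined by $e$), and $\exp_{G_-}:\mathfrak g_-\to G_-$ is a diffeomorphism. (2) In the normal chart determined by $e$, the normal frames of $T(G/P)$ determined by $e$ are exactly the pullbacks along $\exp_{G_-}:\mathfrak g_-\to G_-$ of the left invariant frames of $TG_-$. That is, a family $(\xi_i)$ of vector fields on $\mathfrak g_-$ is of the form $(\phi^*s_i)$ for a normal frame $(s_i)$ if and only if it is of the form $(\exp_{G_-}^*\eta_i)$ for a left invariant frame $(\eta_i)$ of $TG_-$. (3) If $\mathfrak g_-$ is abelian, then the families $(\phi^*s_i)$, for $(s_i)$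 a normal frame, are exactly the frames of coordinate vector fields on $\mathfrak g_-$ determined by a choice of a basis of $\mathfrak g_-$. -/

import Mathlib

open scoped Manifold ContDiff
open Set Module

noncomputable section

namespace ParabolicGeometry

instance instLEInftyMinSmoothness : ENat.LEInfty (minSmoothness ℝ 3) :=
  ⟨by rw [minSmoothness_of_isRCLikeNormedField]; exact ENat.LEInfty.out⟩

section LieGroups

variable {E : Type*} [NormedAddCommGroup E] [NormedSpace ℝ E]
  {G : Type*} [TopologicalSpace G] [ChartedSpace E G] [Group G]

/-- The exponential map of a Lie group: the flow at time `1` through the identity of the left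
invariant vector field generated by `X` (equivalently: of the constant vector field generated by
`X` for the left Maurer-Cartan form). On a Hausdorff Lie group the integral curve exists
and is unique, so that the default value is never used. -/
def lieExp (X : GroupLieAlgebra 𝓘(ℝ, E) G) : G :=
  open scoped Classical in
  if h : ∃ γ : ℝ → G, γ 0 = 1 ∧
      IsMIntegralCurve (I := 𝓘(ℝ, E)) γ (mulInvariantVectorField X) then
    h.choose 1
  else 1

/-- The adjoint action `Ad g`, the derivative at the identity of `h ↦ g * h * g⁻¹`. -/
def Ad (g : G) : GroupLieAlgebra 𝓘(ℝ, E) G →L[ℝ] GroupLieAlgebra 𝓘(ℝ, E) G :=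
  mfderiv 𝓘(ℝ, E) 𝓘(ℝ, E) (fun h : G => g * h * g⁻¹) 1

/-- The normaliser in `G` of a linear subspace of the Lie algebra, for the adjoint action. -/
def adNormalizer (V : Submodule ℝ (GroupLieAlgebra 𝓘(ℝ, E) G)) : Set G :=
  {g | V.map (Ad (E := E) g).toLinearMap = V}

/-- A left invariant frame of `TG`: a smooth global frame consisting of left invariant vector
fields. -/
structure IsLeftInvariantFrame [LieGroup 𝓘(ℝ, E) ∞ G] {ι : Type*}
    (η : ι → Π g : G, TangentSpace 𝓘(ℝ, E) g) : Prop where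
  isLocalFrameOn : IsLocalFrameOn 𝓘(ℝ, E) E ∞ η univ
  leftInvariant (i : ι) (g h : G) :
    mfderiv 𝓘(ℝ, E) 𝓘(ℝ, E) (fun x : G => g * x) h (η i h) = η i (g * h)

end LieGroups

section Pairs

variable (E : Type*) [NormedAddCommGroup E] [NormedSpace ℝ E] [CompleteSpace E]
  (G : Type*) [TopologicalSpace G] [ChartedSpace E G] [Group G] [LieGroup 𝓘(ℝ, E) ∞ G]

/-- The data `(G, P)` of a type of parabolic geometries: a `|k|`-grading on the semisimple
Lie algebra of `G`, and a parabolic subgroup `P` for it. -/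
structure ParabolicType where
  /-- the length of the grading -/
  k : ℕ
  /-- the grading components -/
  gr : ℤ → Submodule ℝ (GroupLieAlgebra 𝓘(ℝ, E) G)
  one_le_k : 1 ≤ k
  semisimple : LieAlgebra.IsSemisimple ℝ (GroupLieAlgebra 𝓘(ℝ, E) G)
  isInternal : DirectSum.IsInternal gr
  gr_eq_bot : ∀ i : ℤ, (k : ℤ) < |i| → gr i = ⊥
  lie_mem : ∀ (i j : ℤ) (X Y : GroupLieAlgebra 𝓘(ℝ, E) G),
    X ∈ gr i → Y ∈ gr j → ⁅X, Y⁆ ∈ gr (i + j)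
  /-- no simple ideal is contained in the component of degree zero -/
  not_le_gr_zero : ∀ J : LieIdeal ℝ (GroupLieAlgebra 𝓘(ℝ, E) G),
    LieAlgebra.IsSimple ℝ J → ¬ J.toSubmodule ≤ gr 0
  /-- the negative part is generated by the component of degree `-1` -/
  generated : (⨆ i : {i : ℤ // i < 0}, gr i) ≤
    (LieSubalgebra.lieSpan ℝ (GroupLieAlgebra 𝓘(ℝ, E) G) (gr (-1) : Set _)).toSubmodule
  /-- the parabolic subgroup -/
  P : Subgroup G
  /-- `P` lies between the normaliser of the nonnegative part and its identity component -/
  P_subset : (P : Set G) ⊆ adNormalizer (⨆ i : {i : ℤ // 0 ≤ i}, gr i)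
  subset_P : connectedComponentIn (adNormalizer (⨆ i : {i : ℤ // 0 ≤ i}, gr i)) (1 : G) ⊆ P

variable {E G}

namespace ParabolicType

variable (T : ParabolicType E G)

/-- The subalgebra `𝔤₋`, the sum of the components of negative degree. -/
def gNeg : LieSubalgebra ℝ (GroupLieAlgebra 𝓘(ℝ, E) G) where
  __ := ⨆ i : {i : ℤ // i < 0}, T.gr i
  lie_mem' := by
    intro X Y hX hY
    replace hX : X ∈ ⨆ i : {i : ℤ // i < 0}, T.gr i := hX
    replace hY : Y ∈ ⨆ i : {i : ℤ // i < 0}, T.gr i := hY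
    change ⁅X, Y⁆ ∈ ⨆ i : {i : ℤ // i < 0}, T.gr i
    induction hX using Submodule.iSup_induction' with
    | zero => simp
    | add X X' _ _ h h' => rw [add_lie]; exact add_mem h h'
    | mem i X hX =>
      induction hY using Submodule.iSup_induction' with
      | zero => simp
      | add Y Y' _ _ h h' => rw [lie_add]; exact add_mem h h'
      | mem j Y hY =>
        exact Submodule.mem_iSup_of_mem
          (p := fun i : {i : ℤ // i < 0} => T.gr i)
          (⟨i.1 + j.1, add_neg i.2 j.2⟩ : {i : ℤ // i < 0}) (T.lie_mem _ _ _ _ hX hY)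

/-- The subalgebra `𝔭`, the sum of the components of nonnegative degree, as a subspace. -/
def p : Submodule ℝ (GroupLieAlgebra 𝓘(ℝ, E) G) := ⨆ i : {i : ℤ // 0 ≤ i}, T.gr i

/-- The space `𝔤₋`, seen as a subspace of the normed model space `E` of `G` (the tangent space at
the identity being `E` by definition). -/
abbrev gNegModel : Submodule ℝ E := T.gNeg.toSubmodule

/-- `𝔤₋` carries the norm of the model space of `G`, which serves to do calculus on it. -/
instance : NormedAddCommGroup T.gNeg := inferInstanceAs (NormedAddCommGroup T.gNegModel)

instance : NormedSpace ℝ T.gNeg := inferInstanceAs (NormedSpace ℝ T.gNegModel)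

/-- The map `Φ : 𝔤₋ → G`, sending `X` to the flow at time `1` through `e` of the constant vector
field generated by `X`. -/
def flowMap (X : T.gNeg) : G := lieExp (X : GroupLieAlgebra 𝓘(ℝ, E) G)

/-- The map `φ : 𝔤₋ → G/P`, the composition of `Φ` with the projection. It is the inverse of the
normal chart determined by `e`. -/
def normalMap (X : T.gNeg) : G ⧸ T.P := (T.flowMap X : G)

/-- A normal section determined by `e`: a map `σ` on `U = φ(𝔤₋)` with values in `G` such that
`σ(φ(X)) = Φ(X)`. The values outside of `U` play no role. -/
def IsNormalSection (σ : G ⧸ T.P → G) : Prop := ∀ X : T.gNeg, σ (T.normalMap X) = T.flowMap X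

/-- The representation of `P` on `𝔤/𝔭` induced by the adjoint action. -/
def isotropyRep (b : T.P) :
    (GroupLieAlgebra 𝓘(ℝ, E) G ⧸ T.p) →ₗ[ℝ] (GroupLieAlgebra 𝓘(ℝ, E) G ⧸ T.p) :=
  T.p.mapQ T.p (Ad (E := E) (b : G)).toLinearMap
    (Submodule.map_le_iff_le_comap.mp (le_of_eq (T.P_subset b.2)))

/-- The associated bundle `G ×_P (𝔤/𝔭)`, the quotient of `G × 𝔤/𝔭` by the action
`(u, w) · b = (u b, b⁻¹ · w)` of `P`. -/
def AssocBundle : Type _ :=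
  Quot fun a a' : G × (GroupLieAlgebra 𝓘(ℝ, E) G ⧸ T.p) =>
    ∃ b : T.P, a' = (a.1 * b, T.isotropyRep b⁻¹ a.2)

/-- The class `[u, w]` in `G ×_P (𝔤/𝔭)`. -/
def assocMk (u : G) (w : GroupLieAlgebra 𝓘(ℝ, E) G ⧸ T.p) : T.AssocBundle := Quot.mk _ (u, w)

variable {F : Type*} [NormedAddCommGroup F] [NormedSpace ℝ F] [ChartedSpace F (G ⧸ T.P)]

/-- The (graph of the) identification of `G ×_P (𝔤/𝔭)` with `T(G/P)`: the class `[u, Y + 𝔭]`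
corresponds to the tangent vector `T_u π (Ỹ(u))` at `π(u) = uP`, where `Ỹ` is the constant vector
field for the Maurer-Cartan form (that is, the left invariant field) generated by `Y`. -/
def Corresponds (a : T.AssocBundle) (v : TangentBundle 𝓘(ℝ, F) (G ⧸ T.P)) : Prop :=
  ∃ (u : G) (Y : GroupLieAlgebra 𝓘(ℝ, E) G),
    a = T.assocMk u (Submodule.Quotient.mk Y) ∧
    v = ⟨(u : G ⧸ T.P),
      mfderiv 𝓘(ℝ, E) 𝓘(ℝ, F) (fun g : G => (g : G ⧸ T.P)) u (mulInvariantVectorField Y u)⟩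

/-- A normal frame of `T(G/P) = G ×_P (𝔤/𝔭)` determined by `e`: the frame over `U = φ(𝔤₋)` obtained
from a basis `w` of `𝔤/𝔭` via the trivialisation `(x, w) ↦ [σ(x), w]` given by the normal section.
The values of `s` outside of `U` play no role. -/
def IsNormalFrame {ι : Type*} (s : ι → Π x : G ⧸ T.P, TangentSpace 𝓘(ℝ, F) x) : Prop :=
  ∃ (σ : G ⧸ T.P → G) (w : Basis ι ℝ (GroupLieAlgebra 𝓘(ℝ, E) G ⧸ T.p)),
    T.IsNormalSection σ ∧
    ∀ i, ∀ x ∈ range T.normalMap, T.Corresponds (T.assocMk (σ x) (w i)) ⟨x, s i x⟩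

variable {T} in
/-- The coordinate vector field `∂/∂xᵢ` on `𝔤₋`, for the linear coordinates `x` determined by a
basis `b` of `𝔤₋`: the velocity of the coordinate line in the `i`-th direction. -/
def coordField {ι : Type*} (b : Basis ι ℝ T.gNeg) (i : ι) (X : T.gNeg) :
    TangentSpace 𝓘(ℝ, T.gNeg) X :=
  deriv (fun t : ℝ => X + t • b i) 0

end ParabolicType

end Pairs

section Model

variable {E : Type*} [NormedAddCommGroup E] [NormedSpace ℝ E] [CompleteSpace E]
  {G : Type*} [TopologicalSpace G] [ChartedSpace E G] [Group G] [LieGroup 𝓘(ℝ, E) ∞ G]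
  (T : ParabolicType E G)
  {E' : Type*} [NormedAddCommGroup E'] [NormedSpace ℝ E'] [CompleteSpace E']
  {N : Type*} [TopologicalSpace N] [ChartedSpace E' N] [Group N] [LieGroup 𝓘(ℝ, E') ∞ N]

/-- The exponential map `𝔤₋ → N` of a Lie group `N` whose Lie algebra is identified with `𝔤₋`. -/
def ParabolicType.carnotExp (θ : T.gNeg ≃ₗ⁅ℝ⁆ GroupLieAlgebra 𝓘(ℝ, E') N) (X : T.gNeg) : N :=
  lieExp (θ X)

end Model

end ParabolicGeometry

end

/-! Write ψ(a) = (1 - e^{-a})/a for a bounded operator a (`opPhi`). In every Lie group the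
left-trivialised differential of exp at X is ψ(ad X) (`dexp_eq_opPhi`). For X in 𝔤₋ the operator ad
X preserves 𝔤₋, so exp of G₋ and φ have the differentials V ↦ L_{ψ(ad X)V} and V ↦ Tπ(L_{ψ(ad X)V}),
with one and the same operator ψ(ad X) on 𝔤₋. Since 𝔤/𝔭 ≅ 𝔤₋, a family (ξ_i) is the pullback of a
normal frame exactly when ψ(ad X) ξ_i(X) = b_i for all X, with (b_i) a basis of 𝔤₋
(`exists_normalFrame_iff`), and the pullbacks of left invariant frames obey the same criterion
(`exists_leftInvariantFrame_iff`). This is (2). If 𝔤₋ is abelian then ψ(ad X) = 1, and the criterion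
says that ξ_i is the constant field b_i, which is (3).

The engine behind (1) is the family of dilations of 𝔤₋, with weight s^{-i} in degree i: they are
automorphisms and contract 𝔤₋ as s → 0. Whatever is natural and holds near 0 therefore holds
everywhere. Thus ψ(ad X) is invertible for every X in 𝔤₋, since ψ(ad X) is conjugate to ψ(ad δX)
with δX small. Together with ker(Tπ) = 𝔭 (`projDeriv_eq_zero_iff`, which uses that 𝔭 is its own
normaliser and that exp 𝔭 ⊂ P), this makes φ and exp local diffeomorphisms by the inverse function
theorem.

For the injectivity of φ take the grading element E₀, with ad E₀ = i on 𝔤_i; it exists because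
derivations of a semisimple algebra are inner. If exp(-X')exp(X) lies in P, it moves E₀ by an
element of 𝔭 ∩ 𝔤₋ = 0, so Ad(exp X)E₀ = Ad(exp X')E₀. The map X ↦ e^{ad X}E₀ is injective near 0,
hence everywhere, as dilations fix E₀ (`opExp_ad_injective`). For G₋, contractions yield local
sections of exp over translates of one fixed neighbourhood (`HasContractions.exists_section`), so
paths lift; connectedness gives surjectivity, and simple connectedness with monodromy gives
injectivity. -/

noncomputable section

namespace ParabolicGeometry

/-! ### Left-trivialised velocities of curves in a Lie group. -/

section Velocity

variable {E : Type*} [NormedAddCommGroup E] [NormedSpace ℝ E]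
  {G : Type*} [TopologicalSpace G] [ChartedSpace E G] [Group G]

/-- The left invariant vector field generated by `W`, with values in the model space. -/
def invField (W : E) (g : G) : E := mulInvariantVectorField (I := 𝓘(ℝ, E)) (G := G) W g

theorem invField_add (W V : E) (g : G) : invField (W + V) g = invField W g + invField V g :=
  congrFun (mulInvariantVectorField_add (I := 𝓘(ℝ, E)) (G := G) W V) g

theorem invField_smul (c : ℝ) (W : E) (g : G) : invField (c • W) g = c • invField W g :=
  congrFun (mulInvariantVectorField_smul (I := 𝓘(ℝ, E)) (G := G) c W) g

/-- The curve `a` in a Lie group has left-trivialised velocity `W` at time `t`. -/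
def HasVelocity (a : ℝ → G) (W : E) (t : ℝ) : Prop :=
  HasMFDerivAt 𝓘(ℝ, ℝ) 𝓘(ℝ, E) a t
    ((1 : ℝ →L[ℝ] ℝ).smulRight (invField (E := E) W (a t)))

variable [LieGroup 𝓘(ℝ, E) ∞ G]

theorem mdifferentiableAt_mul_left (g h : G) :
    MDifferentiableAt 𝓘(ℝ, E) 𝓘(ℝ, E) (fun x : G => g * x) h :=
  (contMDiff_mul_left (I := 𝓘(ℝ, E)) (n := ∞)).mdifferentiable (by simp) h

theorem mdifferentiableAt_mul_right (g h : G) :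
    MDifferentiableAt 𝓘(ℝ, E) 𝓘(ℝ, E) (fun x : G => x * g) h :=
  (contMDiff_mul_right (I := 𝓘(ℝ, E)) (n := ∞)).mdifferentiable (by simp) h

/-- The chain rule at a point, with an explicit name for the intermediate point. -/
theorem mfderiv_comp_eq_apply {E₁ E₂ E₃ M₁ M₂ M₃ : Type*} [NormedAddCommGroup E₁] [NormedSpace ℝ E₁]
    [NormedAddCommGroup E₂] [NormedSpace ℝ E₂] [NormedAddCommGroup E₃] [NormedSpace ℝ E₃]
    [TopologicalSpace M₁] [ChartedSpace E₁ M₁] [TopologicalSpace M₂] [ChartedSpace E₂ M₂]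
    [TopologicalSpace M₃] [ChartedSpace E₃ M₃] {g : M₂ → M₃} {f : M₁ → M₂} {x : M₁} {y : M₂}
    (hg : MDifferentiableAt 𝓘(ℝ, E₂) 𝓘(ℝ, E₃) g y) (hf : MDifferentiableAt 𝓘(ℝ, E₁) 𝓘(ℝ, E₂) f x)
    (hy : f x = y) (v : E₁) :
    (mfderiv 𝓘(ℝ, E₁) 𝓘(ℝ, E₃) (g ∘ f) x v : E₃) =
      mfderiv 𝓘(ℝ, E₂) 𝓘(ℝ, E₃) g y (mfderiv 𝓘(ℝ, E₁) 𝓘(ℝ, E₂) f x v : E₂) := by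
  subst hy
  rw [mfderiv_comp _ hg hf]
  rfl

/-- The adjoint action, as a map on the model space. -/
abbrev adjointAction (g : G) : E →L[ℝ] E := Ad (E := E) g

theorem mfderiv_mul_left_invField (g h : G) (W : E) :
    mfderiv 𝓘(ℝ, E) 𝓘(ℝ, E) (fun x : G => g * x) h (invField (E := E) W h) =
      invField W (g * h) := by
  have D : (fun x : G => g * h * x) = (fun x => g * x) ∘ (fun x => h * x) := by
    ext x; simp [mul_assoc]
  unfold invField mulInvariantVectorField
  rw [D]
  exact (mfderiv_comp_eq_apply (mdifferentiableAt_mul_left g h)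
    (mdifferentiableAt_mul_left h 1) (mul_one h) _).symm

omit [LieGroup 𝓘(ℝ, E) ∞ G] in
@[simp] theorem invField_one (W : E) : invField W (1 : G) = W := by
  unfold invField mulInvariantVectorField
  have : (fun x : G => 1 * x) = id := by ext x; simp
  rw [this, mfderiv_id]
  rfl

theorem mdifferentiableAt_conj (g h : G) :
    MDifferentiableAt 𝓘(ℝ, E) 𝓘(ℝ, E) (fun x : G => g * x * g⁻¹) h :=
  (((contMDiff_mul_right (I := 𝓘(ℝ, E)) (n := ∞) (a := g⁻¹)).comp
    (contMDiff_mul_left (I := 𝓘(ℝ, E)) (n := ∞) (a := g))).mdifferentiable (by simp) h)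

theorem Ad_mul (g h : G) (W : E) :
    adjointAction (g * h) W = adjointAction g (adjointAction h W) := by
  have D : (fun x : G => (g * h) * x * (g * h)⁻¹) =
      (fun x => g * x * g⁻¹) ∘ (fun x => h * x * h⁻¹) := by
    ext x; simp [mul_assoc]
  unfold adjointAction Ad
  rw [D]
  exact mfderiv_comp_eq_apply (mdifferentiableAt_conj g 1) (mdifferentiableAt_conj h 1) (by simp) _

omit [LieGroup 𝓘(ℝ, E) ∞ G] in
theorem Ad_one (W : E) : adjointAction (1 : G) W = W := by
  have D : (fun x : G => (1 : G) * x * (1 : G)⁻¹) = id := by ext x; simp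
  unfold adjointAction Ad
  rw [D, mfderiv_id]
  rfl

/-- Differentiate (g x) h = (g h)(h⁻¹ x h) in x at the identity. -/
theorem mfderiv_mul_right_invField (g h : G) (W : E) :
    mfderiv 𝓘(ℝ, E) 𝓘(ℝ, E) (fun x : G => x * h) g (invField (E := E) W g) =
      invField (adjointAction h⁻¹ W) (g * h) := by
  have D : (fun x : G => x * h) ∘ (fun x : G => g * x)
      = (fun x => (g * h) * x) ∘ (fun x => h⁻¹ * x * h⁻¹⁻¹) := by
    ext x; simp [mul_assoc]
  have e1 := mfderiv_comp_eq_apply (mdifferentiableAt_mul_right h g)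
    (mdifferentiableAt_mul_left g 1) (mul_one g) W
  have e2 := mfderiv_comp_eq_apply (mdifferentiableAt_mul_left (g * h) 1)
    (mdifferentiableAt_conj h⁻¹ 1) (by simp) W
  rw [D] at e1
  exact e1.symm.trans e2

/-- The Leibniz rule. Moving the velocity of the left factor past b costs Ad(b⁻¹); this twist is the
source of e^{-ad X} in the differential of exp. -/
theorem HasVelocity.mul {a b : ℝ → G} {W V : E} {t : ℝ} (ha : HasVelocity a W t)
    (hb : HasVelocity b V t) :
    HasVelocity (fun s => a s * b s) (adjointAction (b t)⁻¹ W + V) t := by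
  have hmul : MDifferentiableAt (𝓘(ℝ, E).prod 𝓘(ℝ, E)) 𝓘(ℝ, E) (fun p : G × G => p.1 * p.2)
      (a t, b t) := (contMDiff_mul 𝓘(ℝ, E) ∞).mdifferentiable (by simp) _
  have h := HasMFDerivAt.comp t hmul.hasMFDerivAt (HasMFDerivAt.prodMk ha hb)
  refine h.congr_mfderiv ?_
  ext
  have key := mfderiv_prod_eq_add_apply (I := 𝓘(ℝ, E)) (I' := 𝓘(ℝ, E)) (I'' := 𝓘(ℝ, E)) hmul
    (v := ((1 : ℝ) • invField W (a t), (1 : ℝ) • invField V (b t)))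
  refine Eq.trans key ?_
  change (_ : E) = (1 : ℝ) • (_ : E)
  rw [one_smul, one_smul, one_smul, invField_add]
  exact congrArg₂ (· + ·) (mfderiv_mul_right_invField (a t) (b t) W)
    (mfderiv_mul_left_invField (a t) (b t) V)

end Velocity


/-! ### One-parameter subgroups and the exponential map. -/

section Exponential

variable {E : Type*} [NormedAddCommGroup E] [NormedSpace ℝ E]
  {G : Type*} [TopologicalSpace G] [ChartedSpace E G] [Group G] [LieGroup 𝓘(ℝ, E) ∞ G]

/-- The field is the tangent map of multiplication applied to the smooth map g ↦ (0_g, W_1). -/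
theorem contMDiff_mulInvariantVectorField_infty (W : GroupLieAlgebra 𝓘(ℝ, E) G) :
    ContMDiff 𝓘(ℝ, E) 𝓘(ℝ, E).tangent ∞
      (fun g : G => (mulInvariantVectorField W g : TangentBundle 𝓘(ℝ, E) G)) := by
  let fg : G → TangentBundle 𝓘(ℝ, E) G := fun g ↦ Bundle.TotalSpace.mk' E g 0
  have sfg : ContMDiff 𝓘(ℝ, E) 𝓘(ℝ, E).tangent ∞ fg := Bundle.contMDiff_zeroSection _ _
  let fv : G → TangentBundle 𝓘(ℝ, E) G := fun _ ↦ Bundle.TotalSpace.mk' E 1 W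
  have sfv : ContMDiff 𝓘(ℝ, E) 𝓘(ℝ, E).tangent ∞ fv := contMDiff_const
  let F₁ : G → (TangentBundle 𝓘(ℝ, E) G × TangentBundle 𝓘(ℝ, E) G) := fun g ↦ (fg g, fv g)
  have S₁ : ContMDiff 𝓘(ℝ, E) (𝓘(ℝ, E).tangent.prod 𝓘(ℝ, E).tangent) ∞ F₁ := sfg.prodMk sfv
  let F₂ : (TangentBundle 𝓘(ℝ, E) G × TangentBundle 𝓘(ℝ, E) G) →
      TangentBundle (𝓘(ℝ, E).prod 𝓘(ℝ, E)) (G × G) :=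
    (equivTangentBundleProd 𝓘(ℝ, E) G 𝓘(ℝ, E) G).symm
  have S₂ : ContMDiff (𝓘(ℝ, E).tangent.prod 𝓘(ℝ, E).tangent)
      (𝓘(ℝ, E).prod 𝓘(ℝ, E)).tangent ∞ F₂ := contMDiff_equivTangentBundleProd_symm
  let F₃ : TangentBundle (𝓘(ℝ, E).prod 𝓘(ℝ, E)) (G × G) → TangentBundle 𝓘(ℝ, E) G :=
    tangentMap (𝓘(ℝ, E).prod 𝓘(ℝ, E)) 𝓘(ℝ, E) (fun (p : G × G) ↦ p.1 * p.2)
  have S₃ : ContMDiff (𝓘(ℝ, E).prod 𝓘(ℝ, E)).tangent 𝓘(ℝ, E).tangent ∞ F₃ :=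
    ContMDiff.contMDiff_tangentMap (contMDiff_mul 𝓘(ℝ, E) ∞) (m := ∞) le_rfl
  convert! (S₃.comp S₂).comp S₁ with g
  · simp [F₁, F₂, F₃, fg, fv]
  · simp only [Function.comp_apply, tangentMap, F₃, F₂, F₁, fg, fv]
    rw [mfderiv_prod_eq_add_apply ((contMDiff_mul 𝓘(ℝ, E) ∞).mdifferentiable (by simp) _)]
    unfold mulInvariantVectorField
    exact Eq.trans (zero_add (_ : E)).symm
      (congrArg₂ (fun x y : E => x + y) (ContinuousLinearMap.map_zero _).symm rfl)

theorem contMDiff_invField (W : E) :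
    ContMDiff 𝓘(ℝ, E) 𝓘(ℝ, E).tangent ∞
      (fun g : G => (⟨g, invField (E := E) W g⟩ : TangentBundle 𝓘(ℝ, E) G)) :=
  contMDiff_mulInvariantVectorField_infty W

theorem HasVelocity.const_mul {a : ℝ → G} {W : E} {t : ℝ} (ha : HasVelocity a W t) (g : G) :
    HasVelocity (fun s => g * a s) W t := by
  have h := HasMFDerivAt.comp t (mdifferentiableAt_mul_left g (a t)).hasMFDerivAt ha
  refine h.congr_mfderiv ?_
  ext
  change (mfderiv 𝓘(ℝ, E) 𝓘(ℝ, E) (fun x : G => g * x) (a t)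
    ((1 : ℝ) • invField W (a t) : E) : E) = (1 : ℝ) • (_ : E)
  rw [one_smul, one_smul]
  exact mfderiv_mul_left_invField g (a t) W

omit [LieGroup 𝓘(ℝ, E) ∞ G] in
theorem HasVelocity.comp_affine {a : ℝ → G} {W : E} {c d t : ℝ} (ha : HasVelocity a W (c * t + d)) :
    HasVelocity (fun s => a (c * s + d)) (c • W) t := by
  have hd : HasDerivAt (fun s : ℝ => c * s + d) c t := by
    simpa using ((hasDerivAt_id t).const_mul c).add_const d
  have h := HasMFDerivAt.comp t (f := fun s : ℝ => c * s + d) ha hd.hasFDerivAt.hasMFDerivAt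
  refine h.congr_mfderiv ?_
  ext
  change (((1 : ℝ) • c : ℝ)) • (invField W (a (c * t + d)) : E) = (1 : ℝ) • (_ : E)
  rw [invField_smul]
  simp

omit [LieGroup 𝓘(ℝ, E) ∞ G] in
theorem HasVelocity.congr_of_eventuallyEq {a b : ℝ → G} {W : E} {t : ℝ} (ha : HasVelocity a W t)
    (h : b =ᶠ[nhds t] a) : HasVelocity b W t := by
  have := HasMFDerivAt.congr_of_eventuallyEq ha h
  refine this.congr_mfderiv ?_
  rw [h.eq_of_nhds]

theorem invField_injective (g : G) : Function.Injective fun W : E => invField W g := by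
  intro W V h
  have h' := congrArg (mfderiv 𝓘(ℝ, E) 𝓘(ℝ, E) (fun x : G => g⁻¹ * x) g) h
  have e (W : E) := mfderiv_mul_left_invField g⁻¹ g W
  have h1 : g⁻¹ * g = 1 := inv_mul_cancel g
  have h'' := ((e W).symm.trans h').trans (e V)
  rw [h1, invField_one, invField_one] at h''
  exact h''

omit [LieGroup 𝓘(ℝ, E) ∞ G] in
theorem HasVelocity.continuousAt {a : ℝ → G} {W : E} {t : ℝ} (ha : HasVelocity a W t) :
    ContinuousAt a t := HasMFDerivAt.continuousAt ha

theorem HasVelocity.unique {a : ℝ → G} {W V : E} {t : ℝ} (ha : HasVelocity a W t)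
    (hb : HasVelocity a V t) : W = V := by
  have h := hasMFDerivAt_unique ha hb
  have h' : (1 : ℝ) • (invField W (a t) : E) = (1 : ℝ) • (invField V (a t)) :=
    congrArg (fun L : ℝ →L[ℝ] E => L 1) h
  rw [one_smul, one_smul] at h'
  exact invField_injective (a t) h'

variable [T2Space G]

theorem HasVelocity.eqOn_Ioo {a b : ℝ → G} {W : E} {l r t₀ : ℝ} (ht₀ : t₀ ∈ Ioo l r)
    (ha : ∀ t ∈ Ioo l r, HasVelocity a W t) (hb : ∀ t ∈ Ioo l r, HasVelocity b W t)
    (h : a t₀ = b t₀) : EqOn a b (Ioo l r) := by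
  have : IsManifold 𝓘(ℝ, E) 1 G := IsManifold.of_le (n := ∞) (by simp)
  refine isMIntegralCurveOn_Ioo_eqOn_of_contMDiff_boundaryless (I := 𝓘(ℝ, E))
    (v := fun g : G => invField (E := E) W g)
    ht₀ ((contMDiff_invField W).of_le (n := ∞) (by simp)) ?_ ?_ h
  · exact fun t ht => HasMFDerivAt.hasMFDerivWithinAt (ha t ht)
  · exact fun t ht => HasMFDerivAt.hasMFDerivWithinAt (hb t ht)

theorem HasVelocity.eq_of_forall {a b : ℝ → G} {W : E} {t₀ : ℝ} (ha : ∀ t, HasVelocity a W t)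
    (hb : ∀ t, HasVelocity b W t) (h : a t₀ = b t₀) : a = b := by
  ext t
  have hl : min t t₀ - 1 < max t t₀ + 1 := by
    have := min_le_max (a := t) (b := t₀); linarith
  refine HasVelocity.eqOn_Ioo (l := min t t₀ - 1) (r := max t t₀ + 1) (t₀ := t₀) ?_
    (fun t _ => ha t) (fun t _ => hb t) h ?_
  · constructor
    · have := min_le_right t t₀; linarith
    · have := le_max_right t t₀; linarith
  · constructor
    · have := min_le_left t t₀; linarith
    · have := le_max_left t t₀; linarith

variable [CompleteSpace E]

/-- Left translates of one short integral curve through 1 give the same existence time ε at every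
point, so the field is complete. -/
theorem exists_forall_hasVelocity (W : E) :
    ∃ a : ℝ → G, a 0 = 1 ∧ ∀ t, HasVelocity a W t := by
  have : IsManifold 𝓘(ℝ, E) 1 G := IsManifold.of_le (n := ∞) (by simp)
  have hv : ContMDiff 𝓘(ℝ, E) 𝓘(ℝ, E).tangent 1
      (fun g : G => (⟨g, invField (E := E) W g⟩ : TangentBundle 𝓘(ℝ, E) G)) :=
    (contMDiff_invField W).of_le (n := ∞) (by simp)
  obtain ⟨γ, hγ0, hγ⟩ := exists_isMIntegralCurveAt_of_contMDiffAt_boundaryless (I := 𝓘(ℝ, E))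
    (x₀ := (1 : G)) (t₀ := 0) hv.contMDiffAt
  obtain ⟨ε, hε, h⟩ := Metric.eventually_nhds_iff_ball.mp hγ
  refine exists_isMIntegralCurve_of_isMIntegralCurveOn (I := 𝓘(ℝ, E)) hv hε (fun x => ?_) 1
  refine ⟨fun s => x * γ s, by simp [hγ0], fun t ht => HasMFDerivAt.hasMFDerivWithinAt ?_⟩
  have ht' : t ∈ Metric.ball (0 : ℝ) ε := by rwa [Real.ball_eq_Ioo, zero_sub, zero_add]
  exact HasVelocity.const_mul (h t ht') x

/-- The exponential map of a Lie group, as a map on the model space. -/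
abbrev expMap (W : E) : G := lieExp (E := E) (G := G) W

theorem exists_expMap (W : E) : ∃ a : ℝ → G, a 0 = 1 ∧ (∀ t, HasVelocity a W t) ∧
    a 1 = expMap W := by
  have h := exists_forall_hasVelocity (G := G) W
  have h' : ∃ γ : ℝ → G, γ 0 = 1 ∧ IsMIntegralCurve (I := 𝓘(ℝ, E)) γ
    (mulInvariantVectorField (I := 𝓘(ℝ, E)) (G := G) W) := h
  refine ⟨h'.choose, h'.choose_spec.1, h'.choose_spec.2, ?_⟩
  delta expMap lieExp
  rw [dif_pos h']

theorem hasVelocity_eq_expMap {a : ℝ → G} {W : E} (h0 : a 0 = 1) (ha : ∀ t, HasVelocity a W t)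
    (t : ℝ) : a t = expMap (t • W) := by
  obtain ⟨b, hb0, hb, hb1⟩ := exists_expMap (G := G) (t • W)
  rw [← hb1]
  have := HasVelocity.eq_of_forall (t₀ := 0) (a := fun s => a (t * s + 0)) (b := b) (W := t • W)
    (fun s => (ha _).comp_affine) hb (by simp [h0, hb0])
  simpa using congrFun this 1

theorem expMap_zero : expMap (0 : E) = (1 : G) := by
  obtain ⟨b, hb0, hb, hb1⟩ := exists_expMap (G := G) (0 : E)
  rw [← hb0, hasVelocity_eq_expMap hb0 hb, smul_zero]

theorem hasVelocity_expMap (W : E) (t : ℝ) :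
    HasVelocity (fun s : ℝ => (expMap (s • W) : G)) W t := by
  obtain ⟨b, hb0, hb, hb1⟩ := exists_expMap (G := G) W
  have : (fun s : ℝ => (expMap (s • W) : G)) = b := by
    ext s; exact (hasVelocity_eq_expMap hb0 hb s).symm
  rw [this]; exact hb t

theorem expMap_add_smul (s t : ℝ) (W : E) :
    (expMap ((s + t) • W) : G) = expMap (s • W) * expMap (t • W) := by
  have h := HasVelocity.eq_of_forall (t₀ := 0) (a := fun t : ℝ => (expMap ((1 * t + s) • W) : G))
    (b := fun t : ℝ => expMap (s • W) * expMap (t • W)) (W := (1 : ℝ) • W)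
    (fun t => HasVelocity.comp_affine (a := fun s : ℝ => (expMap (s • W) : G)) (c := 1) (d := s)
      (hasVelocity_expMap W _))
    (fun t => by rw [one_smul]; exact (hasVelocity_expMap W t).const_mul _)
    (by simp [expMap_zero])
  have := congrFun h t
  simpa [add_comm] using this

theorem expMap_neg (W : E) : (expMap (-W) : G) = (expMap W)⁻¹ := by
  have h := expMap_add_smul (G := G) (-1) 1 W
  rw [neg_add_cancel, zero_smul, expMap_zero, neg_smul, one_smul] at h
  exact eq_inv_of_mul_eq_one_left h.symm

theorem expMap_nsmul (n : ℕ) (W : E) : (expMap ((n : ℝ) • W) : G) = expMap W ^ n := by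
  induction n with
  | zero => simp [expMap_zero]
  | succ n ih =>
    rw [Nat.cast_succ, expMap_add_smul, ih, one_smul, pow_succ]

end Exponential


/-! ### Smoothness of γ ↦ f ∘ γ on spaces of continuous maps. -/

section Superposition

variable {K : Type*} [TopologicalSpace K] [CompactSpace K]

/-- The pointwise application of a continuous family of continuous linear maps. -/
def pointwiseApply (K : Type*) [TopologicalSpace K] [CompactSpace K] (E F : Type*)
    [NormedAddCommGroup E] [NormedSpace ℝ E] [NormedAddCommGroup F] [NormedSpace ℝ F] :
    C(K, E →L[ℝ] F) →L[ℝ] C(K, E) →L[ℝ] C(K, F) :=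
  LinearMap.mkContinuous₂
    (LinearMap.mk₂ ℝ (fun (A : C(K, E →L[ℝ] F)) (h : C(K, E)) =>
      (⟨fun t => A t (h t), A.continuous.clm_apply h.continuous⟩ : C(K, F)))
      (fun _ _ _ => by ext; simp) (fun _ _ _ => by ext; simp)
      (fun _ _ _ => by ext; simp) (fun _ _ _ => by ext; simp)) 1
    (fun A h => by
      refine (ContinuousMap.norm_le _ (by positivity)).mpr fun t => ?_
      rw [one_mul]
      refine ((A t).le_opNorm _).trans ?_
      gcongr
      · exact A.norm_coe_le_norm t
      · exact h.norm_coe_le_norm t)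

/-- Mean value inequality at each t, with a radius independent of t supplied by the continuity of γ
↦ f' ∘ γ in the sup norm. -/
theorem hasFDerivAt_comp_continuousMap {E F : Type*}
    [NormedAddCommGroup E] [NormedSpace ℝ E] [NormedAddCommGroup F] [NormedSpace ℝ F]
    (f : C(E, F)) (f' : C(E, E →L[ℝ] F)) (hf : ∀ x, HasFDerivAt f (f' x) x) (γ : C(K, E)) :
    HasFDerivAt (fun γ : C(K, E) => f.comp γ) (pointwiseApply K E F (f'.comp γ)) γ := by
  rw [hasFDerivAt_iff_isLittleO_nhds_zero, Asymptotics.isLittleO_iff]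
  intro ε hε
  have hc : Continuous fun γ : C(K, E) => f'.comp γ := ContinuousMap.continuous_postcomp f'
  obtain ⟨δ, hδ, h⟩ := (Metric.continuousAt_iff (f := fun γ : C(K, E) => f'.comp γ) (a := γ)).mp
    (by exact hc.continuousAt) ε hε
  filter_upwards [Metric.ball_mem_nhds (0 : C(K, E)) hδ] with η hη
  rw [mem_ball_zero_iff] at hη
  refine (ContinuousMap.norm_le _ (by positivity)).mpr fun t => ?_
  -- Continuity at γ is tested on γ plus the constant y - γ t, which takes the value y at t and has
  -- sup distance at most ‖y - γ t‖ from γ.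
  have hb : ∀ y ∈ Metric.ball (γ t) δ, ‖f' y - f' (γ t)‖ ≤ ε := by
    intro y hy
    have h1 : dist (γ + ContinuousMap.const K (y - γ t)) γ < δ := by
      rw [dist_eq_norm, add_sub_cancel_left]
      refine lt_of_le_of_lt ((ContinuousMap.norm_le _ (norm_nonneg (y - γ t))).mpr
        fun s => by simp) ?_
      rwa [← dist_eq_norm]
    have h2 := (ContinuousMap.dist_apply_le_dist t).trans (h h1).le
    simpa [dist_eq_norm] using h2
  have hs : γ t + η t ∈ Metric.ball (γ t) δ := by
    rw [mem_ball_iff_norm, add_sub_cancel_left]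
    exact (η.norm_coe_le_norm t).trans_lt hη
  have := (convex_ball (γ t) δ).norm_image_sub_le_of_norm_hasFDerivWithin_le'
    (f := f) (f' := f') (φ := f' (γ t)) (C := ε) (x := γ t) (y := γ t + η t)
    (fun x _ => (hf x).hasFDerivWithinAt) hb (Metric.mem_ball_self hδ) hs
  simp only [add_sub_cancel_left] at this
  exact this.trans (by gcongr; exact η.norm_coe_le_norm t)

universe u

/-- The derivative is again a superposition operator, that of f', followed by a continuous linear
map. The induction varies the spaces because f' has values in E →L[ℝ] F; the common universe keeps
that space in range. -/
theorem contDiff_comp_continuousMap_nat (n : ℕ) : ∀ {E F : Type u}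
    [NormedAddCommGroup E] [NormedSpace ℝ E] [NormedAddCommGroup F] [NormedSpace ℝ F]
    (f : C(E, F)), ContDiff ℝ n f → ContDiff ℝ n (fun γ : C(K, E) => f.comp γ) := by
  induction n with
  | zero =>
    intro E F _ _ _ _ f _
    exact contDiff_zero.mpr (ContinuousMap.continuous_postcomp f)
  | succ n ih =>
    intro E F _ _ _ _ f hf
    obtain ⟨f', hf', hd⟩ := contDiff_succ_iff_hasFDerivAt.mp hf
    refine contDiff_succ_iff_hasFDerivAt.mpr
      ⟨fun γ => pointwiseApply K E F ((⟨f', hf'.continuous⟩ : C(E, E →L[ℝ] F)).comp γ), ?_, ?_⟩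
    · exact (pointwiseApply K E F).contDiff.comp (ih (⟨f', hf'.continuous⟩ : C(E, E →L[ℝ] F)) hf')
    · exact fun γ => hasFDerivAt_comp_continuousMap f ⟨f', hf'.continuous⟩ hd γ

/-- The superposition operator of a smooth map is smooth. -/
theorem contDiff_comp_continuousMap {E F : Type u}
    [NormedAddCommGroup E] [NormedSpace ℝ E] [NormedAddCommGroup F] [NormedSpace ℝ F]
    (f : C(E, F)) (hf : ContDiff ℝ ∞ f) : ContDiff ℝ ∞ (fun γ : C(K, E) => f.comp γ) :=
  contDiff_infty.mpr fun n => contDiff_comp_continuousMap_nat n f (contDiff_infty.mp hf n)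

end Superposition

/-! ### Smooth dependence of flows on parameters, by the implicit function theorem. -/

section ParametricFlow

variable {E : Type*} [NormedAddCommGroup E] [NormedSpace ℝ E]

/-- The primitive vanishing at `0`, for continuous functions on `[-1, 1]`. -/
def primitiveCLM (E : Type*) [NormedAddCommGroup E] [NormedSpace ℝ E] :
    C(Icc (-1 : ℝ) 1, E) →L[ℝ] C(Icc (-1 : ℝ) 1, E) :=
  LinearMap.mkContinuous
    { toFun := fun γ => ⟨fun t => ∫ s in (0 : ℝ)..t, γ (projIcc (-1) 1 (by norm_num) s), by
        have hc : Continuous fun s => γ (projIcc (-1 : ℝ) 1 (by norm_num) s) :=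
          γ.continuous.comp continuous_projIcc
        exact (intervalIntegral.continuous_primitive (fun a b => hc.intervalIntegrable a b) 0).comp
          continuous_subtype_val⟩
      map_add' := fun γ η => by
        ext t
        simp only [ContinuousMap.coe_mk, ContinuousMap.add_apply]
        exact intervalIntegral.integral_add
          ((γ.continuous.comp continuous_projIcc).intervalIntegrable _ _)
          ((η.continuous.comp continuous_projIcc).intervalIntegrable _ _)
      map_smul' := fun c γ => by
        ext t
        simp only [ContinuousMap.coe_mk, ContinuousMap.smul_apply]
        exact intervalIntegral.integral_smul c _ } 1
    (fun γ => by
      refine (ContinuousMap.norm_le _ (by positivity)).mpr fun t => ?_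
      have h := intervalIntegral.norm_integral_le_of_norm_le_const (a := 0) (b := (t : ℝ))
        (f := fun s => γ (projIcc (-1 : ℝ) 1 (by norm_num) s)) (C := ‖γ‖)
        (fun s _ => γ.norm_coe_le_norm _)
      refine h.trans ?_
      rw [one_mul, sub_zero]
      exact mul_le_of_le_one_right (norm_nonneg _) (abs_le.mpr t.2))

/-- Solutions of an autonomous equation depending smoothly on a parameter, near a parameter value
for which the equation is trivial. -/
theorem exists_contDiffAt_flow [CompleteSpace E] (f : E × E → E) (hf : ContDiff ℝ ∞ f)
    (hf0 : ∀ x, f (x, 0) = 0) (e : E) :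
    ∃ Γ : E → C(Icc (-1 : ℝ) 1, E), ContDiffAt ℝ ∞ Γ 0 ∧ Γ 0 = ContinuousMap.const _ e ∧
      ∀ᶠ W in nhds (0 : E), Γ W (projIcc (-1) 1 (by norm_num) 0) = e ∧ ∀ t ∈ Ioo (-1 : ℝ) 1,
        HasDerivAt (fun s => Γ W (projIcc (-1) 1 (by norm_num) s))
          (f (Γ W (projIcc (-1) 1 (by norm_num) t), W)) t := by
  let K := Icc (-1 : ℝ) 1
  let fc : C(E × E, E) := ⟨f, hf.continuous⟩
  let ι₁ : C(K, E) →L[ℝ] C(K, E × E) :=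
    (ContinuousLinearMap.inl ℝ E E).compLeftContinuous ℝ K
  let ι₂ : E →L[ℝ] C(K, E × E) :=
    ((ContinuousLinearMap.inr ℝ E E).compLeftContinuous ℝ K).comp
      (LinearMap.mkContinuous
        ({ toFun := ContinuousMap.const K, map_add' := fun _ _ => rfl,
           map_smul' := fun _ _ => rfl } : E →ₗ[ℝ] C(K, E)) 1
        (fun x => by rw [one_mul]; exact (ContinuousMap.norm_le _ (norm_nonneg x)).mpr fun _ =>
            le_rfl))
  let A : E × C(K, E) → C(K, E × E) := fun p => ι₁ p.2 + ι₂ p.1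
  have hA (p : E × C(K, E)) (t : K) : A p t = (p.2 t, p.1) := by
    change ((p.2 t, (0 : E)) + ((0 : E), p.1) : E × E) = _
    simp
  have hAs : ContDiff ℝ ∞ A :=
    (ι₁.contDiff.comp contDiff_snd).add (ι₂.contDiff.comp contDiff_fst)
  -- The integral equation with initial value e reads H(W, γ) = const e. As f(·, 0) = 0, H(0, ·) is
  -- the identity, so the partial derivative in γ is invertible at W = 0, and the level of H through
  -- (0, const e) consists of solutions on all of [-1, 1].
  let H : E × C(K, E) → C(K, E) := fun p => p.2 - primitiveCLM E (fc.comp (A p))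
  have hH : ContDiff ℝ ∞ H := contDiff_snd.sub
    ((primitiveCLM E).contDiff.comp ((contDiff_comp_continuousMap fc hf).comp hAs))
  let u : E × C(K, E) := (0, ContinuousMap.const K e)
  have hH0 (γ : C(K, E)) : H (0, γ) = γ := by
    have : fc.comp (A (0, γ)) = 0 := by
      ext t
      rw [ContinuousMap.comp_apply, hA]
      exact hf0 _
    simp only [H, this, map_zero, sub_zero]
  have hd : fderiv ℝ H u ∘L .inr ℝ E (C(K, E)) = ContinuousLinearMap.id ℝ _ := by
    have h1 : HasFDerivAt (fun γ : C(K, E) => H (0, γ)) (fderiv ℝ H u ∘L .inr ℝ E (C(K, E)))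
        (ContinuousMap.const K e) :=
      HasFDerivAt.comp (g := H) _ ((hH.differentiable (by simp)) u).hasFDerivAt
        (hasFDerivAt_prodMk_right (0 : E) (ContinuousMap.const K e))
    have h2 : (fun γ : C(K, E) => H (0, γ)) = id := funext hH0
    rw [h2] at h1
    exact h1.unique (hasFDerivAt_id _)
  have hinv : (fderiv ℝ H u ∘L .inr ℝ E (C(K, E))).IsInvertible := by
    rw [hd]; exact ⟨ContinuousLinearEquiv.refl ℝ _, rfl⟩
  have cdf : ContDiffAt ℝ ∞ H u := hH.contDiffAt
  refine ⟨cdf.implicitFunction (by simp) hinv, cdf.contDiffAt_implicitFunction (by simp) hinv,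
    cdf.implicitFunction_apply_self (by simp) hinv, ?_⟩
  filter_upwards [cdf.eventually_apply_implicitFunction (by simp) hinv] with W hW
  set γ := cdf.implicitFunction (by simp) hinv W
  have hγ (t : K) : γ t = e + ∫ s in (0 : ℝ)..t, f (γ (projIcc (-1) 1 (by norm_num) s), W) := by
    have h1 : H (W, γ) t = e := by
      rw [hW, hH0]; rfl
    have h2 : γ t - ∫ s in (0 : ℝ)..t, fc (A (W, γ) (projIcc (-1) 1 (by norm_num) s)) = e := h1
    simp only [hA] at h2
    exact sub_eq_iff_eq_add.mp h2
  refine ⟨?_, fun t ht => ?_⟩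
  · rw [hγ, projIcc_of_mem (by norm_num) (by norm_num : (0 : ℝ) ∈ Icc (-1 : ℝ) 1)]
    simp
  · have hc : Continuous fun s => f (γ (projIcc (-1 : ℝ) 1 (by norm_num) s), W) :=
      hf.continuous.comp ((γ.continuous.comp continuous_projIcc).prodMk continuous_const)
    have h1 := ((hc.integral_hasStrictDerivAt 0 t).hasDerivAt).const_add e
    refine h1.congr_of_eventuallyEq ?_
    filter_upwards [Ioo_mem_nhds ht.1 ht.2] with s hs
    rw [hγ, projIcc_of_mem (by norm_num) (Ioo_subset_Icc_self hs)]

end ParametricFlow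


/-! ### The group law and left invariant fields in the chart at the identity. -/

section Coordinates

variable {E : Type*} [NormedAddCommGroup E] [NormedSpace ℝ E]
  {G : Type*} [TopologicalSpace G] [ChartedSpace E G] [Group G]

/-- The preferred chart of a Lie group at the identity. -/
abbrev idChart (E : Type*) [NormedAddCommGroup E] [NormedSpace ℝ E] (G : Type*) [TopologicalSpace G]
    [ChartedSpace E G] [Group G] : PartialEquiv G E := extChartAt 𝓘(ℝ, E) (1 : G)

theorem mfderiv_eq_fderiv_idChart {V : Type*} [NormedAddCommGroup V] [NormedSpace ℝ V] {f : V → G}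
    {v₀ : V} (hf : MDifferentiableAt 𝓘(ℝ, V) 𝓘(ℝ, E) f v₀) (h1 : f v₀ = 1) (v : V) :
    (mfderiv 𝓘(ℝ, V) 𝓘(ℝ, E) f v₀ v : E) = fderiv ℝ (idChart E G ∘ f) v₀ v := by
  have h : (mfderiv 𝓘(ℝ, V) 𝓘(ℝ, E) f v₀ : V →L[ℝ] E) = fderivWithin ℝ
      (writtenInExtChartAt 𝓘(ℝ, V) 𝓘(ℝ, E) v₀ f) (range 𝓘(ℝ, V)) (extChartAt 𝓘(ℝ, V) v₀ v₀) :=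
    hf.mfderiv
  have h' := congrArg (fun L : V →L[ℝ] E => L v) h
  simp only [writtenInExtChartAt, h1, mfld_simps, fderivWithin_univ] at h'
  simpa [idChart, mfld_simps] using! h'

variable [LieGroup 𝓘(ℝ, E) ∞ G]

theorem contDiffAt_idChart_comp {V : Type*} [NormedAddCommGroup V] [NormedSpace ℝ V] {f : V → G}
    {v₀ : V} (hf : ContMDiffAt 𝓘(ℝ, V) 𝓘(ℝ, E) ∞ f v₀) (h1 : f v₀ ∈ (idChart E G).source) :
    ContDiffAt ℝ ∞ (idChart E G ∘ f) v₀ :=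
  contMDiffAt_iff_contDiffAt.mp (ContMDiffAt.comp v₀ (contMDiffAt_extChartAt'
    (by rwa [extChartAt_source] at h1)) hf)

theorem contMDiffAt_idChart_symm {x : E} (hx : x ∈ (idChart E G).target) :
    ContMDiffAt 𝓘(ℝ, E) 𝓘(ℝ, E) ∞ (idChart E G).symm x :=
  (contMDiffOn_extChartAt_symm (1 : G)).contMDiffAt ((isOpen_extChartAt_target (1 : G)).mem_nhds hx)

/-- The multiplication in the preferred chart at the identity. -/
def chartMul (G : Type*) [TopologicalSpace G] [ChartedSpace E G] [Group G] (p : E × E) : E :=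
  idChart E G ((idChart E G).symm p.1 * (idChart E G).symm p.2)

omit [LieGroup 𝓘(ℝ, E) ∞ G] in
@[simp] theorem idChart_symm_idChart_one : (idChart E G).symm (idChart E G 1) = 1 :=
  extChartAt_to_inv (I := 𝓘(ℝ, E)) (1 : G)

omit [LieGroup 𝓘(ℝ, E) ∞ G] in
theorem idChart_one_mem_target : idChart E G 1 ∈ (idChart E G).target :=
  mem_extChartAt_target (I := 𝓘(ℝ, E)) (1 : G)

omit [LieGroup 𝓘(ℝ, E) ∞ G] in
theorem one_mem_idChart_source : (1 : G) ∈ (idChart E G).source :=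
  mem_extChartAt_source (I := 𝓘(ℝ, E)) (1 : G)

theorem contDiffAt_chartMul {x y : E} (hx : x ∈ (idChart E G).target)
    (hy : y ∈ (idChart E G).target)
    (hxy : (idChart E G).symm x * (idChart E G).symm y ∈ (idChart E G).source) :
    ContDiffAt ℝ ∞ (chartMul (E := E) G) (x, y) := by
  refine contDiffAt_idChart_comp (f := fun p : E × E => (idChart E G).symm p.1 *
    (idChart E G).symm p.2) ?_ hxy
  exact ContMDiffAt.mul
    (ContMDiffAt.comp (x, y) (contMDiffAt_idChart_symm hx) contDiff_fst.contMDiff.contMDiffAt)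
    (ContMDiffAt.comp (x, y) (contMDiffAt_idChart_symm hy) contDiff_snd.contMDiff.contMDiffAt)

theorem contDiffAt_chartMul_left {x : E} (hx : x ∈ (idChart E G).target) :
    ContDiffAt ℝ ∞ (chartMul (E := E) G) (x, idChart E G 1) :=
  contDiffAt_chartMul hx idChart_one_mem_target (by
    rw [idChart_symm_idChart_one, mul_one]; exact (idChart E G).map_target hx)

/-- The left invariant vector fields in the preferred chart at the identity. -/
def chartField (G : Type*) [TopologicalSpace G] [ChartedSpace E G] [Group G] (p : E × E) : E :=
  fderiv ℝ (chartMul (E := E) G) (p.1, idChart E G 1) (0, p.2)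

theorem contDiffAt_chartField {p : E × E} (hx : p.1 ∈ (idChart E G).target) :
    ContDiffAt ℝ ∞ (chartField (E := E) G) p := by
  have h1 : ContDiffAt ℝ ∞ (fderiv ℝ (chartMul (E := E) G)) (p.1, idChart E G 1) :=
    (contDiffAt_chartMul_left hx).fderiv_right (m := ∞) (by simp)
  have h2 :
      ContDiffAt ℝ ∞ (fun q : E × E => fderiv ℝ (chartMul (E := E) G) (q.1, idChart E G 1)) p :=
    ContDiffAt.comp p h1 (contDiffAt_fst.prodMk contDiffAt_const)
  exact h2.clm_apply (contDiffAt_const.prodMk contDiffAt_snd)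

theorem mfderiv_idChart_symm_one (v : E) :
    (mfderiv 𝓘(ℝ, E) 𝓘(ℝ, E) (idChart E G).symm (idChart E G 1) v : E) = v := by
  have : IsManifold 𝓘(ℝ, E) 1 G := IsManifold.of_le (n := ∞) (by simp)
  have h := mfderivWithin_range_extChartAt_symm (I := 𝓘(ℝ, E)) (x := (1 : G))
  rw [modelWithCornersSelf_coe, range_id, mfderivWithin_univ] at h
  rw [h]; rfl

/-- Differentiate φ⁻¹(m(x, y)) = φ⁻¹(x) φ⁻¹(y) in y at φ(1), where the chart φ has differential the
identity. -/
theorem mfderiv_idChart_symm_chartField {x : E} (hx : x ∈ (idChart E G).target) (W : E) :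
    (mfderiv 𝓘(ℝ, E) 𝓘(ℝ, E) (idChart E G).symm x (chartField (E := E) G (x, W)) : E) =
      invField W ((idChart E G).symm x) := by
  set φ := idChart E G
  have hs {y : E} (hy : y ∈ φ.target) : MDifferentiableAt 𝓘(ℝ, E) 𝓘(ℝ, E) φ.symm y :=
    (contMDiffAt_idChart_symm hy).mdifferentiableAt (by simp)
  have e1 := mfderiv_comp_eq_apply (f := φ.symm) (x := φ 1) (y := (1 : G))
    (mdifferentiableAt_mul_left (E := E) (φ.symm x) 1) (hs idChart_one_mem_target) (by simp [φ]) W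
  have hm : DifferentiableAt ℝ (fun y => chartMul (E := E) G (x, y)) (φ 1) :=
    ((contDiffAt_chartMul_left hx).differentiableAt (by simp)).comp (φ 1)
      ((hasFDerivAt_prodMk_right x (φ 1)).differentiableAt)
  have hx1 : chartMul (E := E) G (x, φ 1) = x := by
    simp only [chartMul, φ, idChart_symm_idChart_one, mul_one]
    exact φ.right_inv hx
  have e2 := mfderiv_comp_eq_apply (g := φ.symm) (f := fun y => chartMul (E := E) G (x, y))
    (x := φ 1) (hs hx) hm.mdifferentiableAt hx1 W
  have hev : φ.symm ∘ (fun y => chartMul (E := E) G (x, y)) =ᶠ[nhds (φ 1)]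
      (fun g => φ.symm x * g) ∘ φ.symm := by
    have hc : ContinuousAt ((fun g => φ.symm x * g) ∘ φ.symm) (φ 1) := by
      refine ContinuousAt.comp ?_ (hs idChart_one_mem_target).continuousAt
      exact (mdifferentiableAt_mul_left (E := E) _ _).continuousAt
    have : φ.source ∈ nhds (((fun g => φ.symm x * g) ∘ φ.symm) (φ 1)) := by
      refine (isOpen_extChartAt_source (1 : G)).mem_nhds ?_
      simp only [Function.comp_apply, φ, idChart_symm_idChart_one, mul_one]
      exact φ.map_target hx
    filter_upwards [hc this] with y hy
    exact φ.left_inv hy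
  have e4 := ((congrArg (fun L : E →L[ℝ] E => L W) hev.mfderiv_eq).symm.trans e2).symm.trans
    (e1.trans (congrArg _ (mfderiv_idChart_symm_one W)))
  rw [mfderiv_eq_fderiv] at e4
  have e3 : fderiv ℝ (fun y => chartMul (E := E) G (x, y)) (φ 1) W =
      chartField (E := E) G (x, W) := by
    have := HasFDerivAt.comp (g := chartMul (E := E) G) (φ 1)
      ((contDiffAt_chartMul_left hx).differentiableAt (by simp)).hasFDerivAt
      (hasFDerivAt_prodMk_right x (φ 1))
    exact congrArg (fun L : E →L[ℝ] E => L W) this.fderiv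
  rw [← e3]
  exact e4

omit [LieGroup 𝓘(ℝ, E) ∞ G] in
theorem chartField_zero (x : E) : chartField (E := E) G (x, 0) = 0 :=
  ContinuousLinearMap.map_zero _

end Coordinates

/-! ### Smoothness of the exponential map. -/

section Smoothness

variable {E : Type*} [NormedAddCommGroup E] [NormedSpace ℝ E] [FiniteDimensional ℝ E]
  {G : Type*} [TopologicalSpace G] [ChartedSpace E G] [Group G] [LieGroup 𝓘(ℝ, E) ∞ G]
  [T2Space G] [CompleteSpace E]

/-- Near 0, exp is the chart image of a flow with parameter W. The field is cut off to become
globally smooth; for small W the solutions never leave the ball where the cut-off equals 1. -/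
theorem contMDiffAt_expMap_zero : ContMDiffAt 𝓘(ℝ, E) 𝓘(ℝ, E) ∞ (expMap : E → G) 0 := by
  set φ := idChart E G
  obtain ⟨R, hR, hRt⟩ := Metric.isOpen_iff.mp (isOpen_extChartAt_target (I := 𝓘(ℝ, E)) (1 : G))
    (φ 1) idChart_one_mem_target
  let χ : ContDiffBump (φ 1) := ⟨R / 4, R / 2, by positivity, by linarith⟩
  have hsub : tsupport χ ⊆ φ.target := by
    rw [χ.tsupport_eq]
    exact (Metric.closedBall_subset_ball (by change R / 2 < R; linarith)).trans hRt
  have hball {x : E} (hx : x ∈ Metric.ball (φ 1) (R / 4)) : x ∈ φ.target :=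
    hRt (Metric.ball_subset_ball (by linarith) hx)
  let f : E × E → E := fun p => χ p.1 • chartField (E := E) G p
  have hf : ContDiff ℝ ∞ f := by
    rw [contDiff_iff_contDiffAt]
    intro p
    by_cases hp : p.1 ∈ tsupport χ
    · exact (χ.contDiff.contDiffAt.comp p contDiffAt_fst).smul (contDiffAt_chartField (hsub hp))
    · have h1 : ∀ᶠ q : E × E in nhds p, f q = 0 := by
        have := continuous_fst.continuousAt.preimage_mem_nhds (x := p)
          ((isClosed_tsupport χ).isOpen_compl.mem_nhds hp)
        filter_upwards [this] with q hq
        simp only [f, image_eq_zero_of_notMem_tsupport hq, zero_smul]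
      exact contDiffAt_const.congr_of_eventuallyEq h1
  obtain ⟨Γ, hΓ, hΓ0, hev⟩ := exists_contDiffAt_flow f hf
    (fun x => by simp only [f, chartField_zero, smul_zero]) (φ 1)
  have hnear : ∀ᶠ W in nhds (0 : E), ∀ t, Γ W t ∈ Metric.ball (φ 1) (R / 4) := by
    have := hΓ.continuousAt.preimage_mem_nhds (Metric.ball_mem_nhds _ (ε := R / 4) (by positivity))
    filter_upwards [this] with W hW t
    rw [hΓ0] at hW
    exact (ContinuousMap.dist_apply_le_dist t).trans_lt hW
  have hexp : ∀ᶠ W in nhds (0 : E), ∀ t ∈ Ioo (-1 : ℝ) 1,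
      (expMap (t • W) : G) = φ.symm (Γ W (projIcc (-1) 1 (by norm_num) t)) := by
    filter_upwards [hnear, hev] with W hW ⟨h0, hd⟩
    refine HasVelocity.eqOn_Ioo (t₀ := 0) (W := W) (by norm_num)
      (fun t _ => hasVelocity_expMap W t) (fun t ht => ?_) ?_
    · set x := Γ W (projIcc (-1) 1 (by norm_num) t) with hx
      have hxt : x ∈ φ.target := hball (hW _)
      have h1 := HasMFDerivAt.comp t (g := φ.symm)
        ((contMDiffAt_idChart_symm hxt).mdifferentiableAt (by simp)).hasMFDerivAt
        (hd t ht).hasFDerivAt.hasMFDerivAt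
      refine h1.congr_mfderiv ?_
      have hχ : f (x, W) = chartField (E := E) G (x, W) := by
        have : χ x = 1 := χ.one_of_mem_closedBall (Metric.ball_subset_closedBall (hW _))
        simp only [f, this, one_smul]
      ext
      change (mfderiv 𝓘(ℝ, E) 𝓘(ℝ, E) φ.symm x ((1 : ℝ) • f (x, W) : E) : E) = (1 : ℝ) • (_ : E)
      rw [one_smul, one_smul, hχ]
      exact mfderiv_idChart_symm_chartField hxt W
    · rw [h0, zero_smul, expMap_zero]
      exact (idChart_symm_idChart_one).symm
  have h2 : Filter.Tendsto (fun X : E => (2 : ℝ) • X) (nhds 0) (nhds 0) := by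
    have : Continuous fun X : E => (2 : ℝ) • X := continuous_const_smul 2
    simpa using this.tendsto 0
  -- The flow is identified with exp only for times in the open interval (-1, 1), so exp X is read
  -- off at time 1/2 for the generator 2X.
  have heq : (expMap : E → G) =ᶠ[nhds 0] fun X => φ.symm (Γ ((2 : ℝ) • X)
      (projIcc (-1) 1 (by norm_num) (1 / 2))) := by
    filter_upwards [h2.eventually hexp] with X hX
    rw [← hX (1 / 2) (by norm_num), smul_smul]; norm_num
  refine ContMDiffAt.congr_of_eventuallyEq ?_ heq
  have hs :
      ContDiffAt ℝ ∞ (fun X : E => Γ ((2 : ℝ) • X) (projIcc (-1) 1 (by norm_num) (1 / 2))) 0 := by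
    have h3 : ContDiffAt ℝ ∞ Γ ((2 : ℝ) • (0 : E)) := by rwa [smul_zero]
    have h4 := ContDiffAt.comp (0 : E) h3 (contDiff_const_smul (2 : ℝ)).contDiffAt
    exact (ContinuousMap.evalCLM ℝ
        (projIcc (-1 : ℝ) 1 (by norm_num) (1 / 2))).contDiff.contDiffAt.comp
      (0 : E) h4
  refine ContMDiffAt.comp (0 : E) (contMDiffAt_idChart_symm ?_) hs.contMDiffAt
  rw [smul_zero, hΓ0]
  exact idChart_one_mem_target

/-- The exponential map of a Lie group is smooth. -/
theorem contMDiff_expMap : ContMDiff 𝓘(ℝ, E) 𝓘(ℝ, E) ∞ (expMap : E → G) := by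
  intro X
  -- At a finite order, regularity at 0 extends to a neighbourhood of 0, which may shrink with the
  -- order.
  rw [contMDiffAt_infty]
  intro n
  have : IsManifold 𝓘(ℝ, E) n G := IsManifold.of_le (n := ∞) (by exact_mod_cast le_top)
  have h := (contMDiffAt_iff_contMDiffAt_nhds (n := n) (by simp)).mp
    ((contMDiffAt_expMap_zero (E := E) (G := G)).of_le (by exact_mod_cast le_top))
  have ht : Filter.Tendsto (fun k : ℕ => ((k : ℝ) + 1)⁻¹ • X) Filter.atTop (nhds 0) := by
    have := (tendsto_one_div_add_atTop_nhds_zero_nat (𝕜 := ℝ)).smul_const X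
    simpa using this
  obtain ⟨k, hk⟩ := (ht.eventually h).exists
  -- For large k the point X/(k+1) lies in that neighbourhood, and powers in the group carry the
  -- regularity to X.
  have heq : (expMap : E → G) = fun Y => (expMap (((k : ℝ) + 1)⁻¹ • Y)) ^ (k + 1) := by
    ext Y
    rw [← expMap_nsmul, smul_smul]
    push_cast
    rw [mul_inv_cancel₀ (by positivity), one_smul]
  rw [heq]
  have hpow (f : E → G) (hf : ContMDiffAt 𝓘(ℝ, E) 𝓘(ℝ, E) n f X) (j : ℕ) :
      ContMDiffAt 𝓘(ℝ, E) 𝓘(ℝ, E) n (fun Y => f Y ^ j) X := by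
    have : LieGroup 𝓘(ℝ, E) n G := LieGroup.of_le (n := ∞) (by exact_mod_cast le_top)
    induction j with
    | zero => simpa using! contMDiffAt_const
    | succ j ih => simpa only [pow_succ] using! ih.mul hf
  exact hpow _ (ContMDiffAt.comp X (g := (expMap : E → G)) hk
    (contDiff_const_smul _).contMDiff.contMDiffAt) (k + 1)

end Smoothness


/-! ### The differential of the adjoint action is the Lie bracket. -/

section Bracket

variable {E : Type*} [NormedAddCommGroup E] [NormedSpace ℝ E]
  {G : Type*} [TopologicalSpace G] [ChartedSpace E G] [Group G] [LieGroup 𝓘(ℝ, E) ∞ G]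

theorem chartField_one (X : E) : chartField (E := E) G (idChart E G 1, X) = X := by
  have h := mfderiv_idChart_symm_chartField (G := G) idChart_one_mem_target X
  rw [mfderiv_idChart_symm_one] at h
  rw [h]
  simp

/-- The Lie bracket of the Lie algebra of a Lie group, as an operation on the model space. -/
def bracket (G : Type*) [TopologicalSpace G] [ChartedSpace E G] [Group G] (X Y : E) : E :=
  Bracket.bracket (L := GroupLieAlgebra 𝓘(ℝ, E) G) (M := GroupLieAlgebra 𝓘(ℝ, E) G) X Y

theorem mpullbackWithin_idChart_symm_eq [CompleteSpace E] {x : E} (hx : x ∈ (idChart E G).target)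
    (X : E) :
    VectorField.mpullbackWithin 𝓘(ℝ, E) 𝓘(ℝ, E) (idChart E G).symm
      (mulInvariantVectorField (I := 𝓘(ℝ, E)) (G := G) X) (range 𝓘(ℝ, E)) x =
      chartField (E := E) G (x, X) := by
  have : IsManifold 𝓘(ℝ, E) 1 G := IsManifold.of_le (n := ∞) (by simp)
  have hi := isInvertible_mfderivWithin_extChartAt_symm (I := 𝓘(ℝ, E)) (x := (1 : G)) hx
  have h := mfderiv_idChart_symm_chartField (G := G) hx X
  rw [VectorField.mpullbackWithin_apply]
  have h' : mfderivWithin 𝓘(ℝ, E) 𝓘(ℝ, E) (idChart E G).symm (range 𝓘(ℝ, E)) x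
      (chartField (E := E) G (x, X)) = mulInvariantVectorField (I := 𝓘(ℝ, E)) (G := G) X
        ((idChart E G).symm x) := by
    rw [modelWithCornersSelf_coe, range_id, mfderivWithin_univ]
    exact h
  rw [← h']
  exact hi.inverse_apply_self _

/-- The chart at 1 has differential the identity there, so the bracket of the left invariant fields
at 1 is that of their chart expressions. -/
theorem bracket_eq_fderiv [CompleteSpace E] (X Y : E) : bracket G X Y =
    fderiv ℝ (fun x => chartField (E := E) G (x, Y)) (idChart E G 1) X -
      fderiv ℝ (fun x => chartField (E := E) G (x, X)) (idChart E G 1) Y := by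
  have : IsManifold 𝓘(ℝ, E) 1 G := IsManifold.of_le (n := ∞) (by simp)
  have hev (Z : E) : (VectorField.mpullbackWithin 𝓘(ℝ, E) 𝓘(ℝ, E) (idChart E G).symm
      (mulInvariantVectorField (I := 𝓘(ℝ, E)) (G := G) Z) (range 𝓘(ℝ, E)) : E → E) =ᶠ[nhds
        (idChart E G 1)] fun x => chartField (E := E) G (x, Z) := by
    filter_upwards [(isOpen_extChartAt_target (I := 𝓘(ℝ, E)) (1 : G)).mem_nhds
      idChart_one_mem_target] with x hx
    exact mpullbackWithin_idChart_symm_eq hx Z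
  have h0 : bracket G X Y = VectorField.lieBracket ℝ (fun x => chartField (E := E) G (x, X))
      (fun x => chartField (E := E) G (x, Y)) (idChart E G 1) := by
    rw [← (hev X).lieBracket_vectorField_eq (hev Y)]
    have h1 : bracket G X Y = VectorField.mlieBracketWithin 𝓘(ℝ, E)
      (mulInvariantVectorField (I := 𝓘(ℝ, E)) (G := G) X)
      (mulInvariantVectorField (I := 𝓘(ℝ, E)) (G := G) Y) univ (1 : G) := rfl
    have hid : (mfderiv 𝓘(ℝ, E) 𝓘(ℝ, E) (idChart E G) (1 : G) : E →L[ℝ] E) =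
      ContinuousLinearMap.id ℝ E := mfderiv_extChartAt_self
    have h2 (v : E) : (ContinuousLinearMap.id ℝ E).inverse v = v := by
      rw [ContinuousLinearMap.inverse_id]; rfl
    rw [h1, VectorField.mlieBracketWithin_apply]
    refine (congrArg (fun L : E →L[ℝ] E => L.inverse _) hid).trans ((h2 _).trans ?_)
    simp only [modelWithCornersSelf_coe, range_id, preimage_univ, univ_inter]
    exact congrFun VectorField.lieBracketWithin_univ _
  rw [h0, VectorField.lieBracket_eq]
  simp only [chartField_one]

theorem adjointAction_eq_mfderiv (g : G) (Y : E) : adjointAction g Y =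
    fderiv ℝ (fun y => idChart E G (g * (idChart E G).symm y * g⁻¹)) (idChart E G 1) Y := by
  have hs : MDifferentiableAt 𝓘(ℝ, E) 𝓘(ℝ, E) (idChart E G).symm (idChart E G 1) :=
    (contMDiffAt_idChart_symm idChart_one_mem_target).mdifferentiableAt (by simp)
  have hc := mdifferentiableAt_conj (E := E) g 1
  have e1 := mfderiv_comp_eq_apply hc hs idChart_symm_idChart_one Y
  rw [mfderiv_idChart_symm_one] at e1
  have hd : MDifferentiableAt 𝓘(ℝ, E) 𝓘(ℝ, E)
      ((fun x => g * x * g⁻¹) ∘ (idChart E G).symm) (idChart E G 1) :=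
    MDifferentiableAt.comp _ (by rw [idChart_symm_idChart_one]; exact hc) hs
  have e2 := mfderiv_eq_fderiv_idChart hd (by simp) Y
  exact e1.symm.trans e2

/-- The conjugation in the preferred chart at the identity. -/
def chartConj (G : Type*) [TopologicalSpace G] [ChartedSpace E G] [Group G] (p : E × E) : E :=
  idChart E G ((idChart E G).symm p.1 * (idChart E G).symm p.2 * ((idChart E G).symm p.1)⁻¹)

theorem contDiffAt_chartConj {x : E} (hx : x ∈ (idChart E G).target) :
    ContDiffAt ℝ ∞ (chartConj (E := E) G) (x, idChart E G 1) := by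
  refine contDiffAt_idChart_comp (f := fun p : E × E => (idChart E G).symm p.1 *
    (idChart E G).symm p.2 * ((idChart E G).symm p.1)⁻¹) ?_ ?_
  · have h1 : ContMDiffAt 𝓘(ℝ, E × E) 𝓘(ℝ, E) ∞ (fun p : E × E => (idChart E G).symm p.1)
      (x, idChart E G 1) :=
      ContMDiffAt.comp (x, idChart E G 1) (contMDiffAt_idChart_symm hx)
        contDiff_fst.contMDiff.contMDiffAt
    exact (h1.mul (ContMDiffAt.comp (x, idChart E G 1)
      (contMDiffAt_idChart_symm idChart_one_mem_target) contDiff_snd.contMDiff.contMDiffAt)).mul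
      h1.inv
  · simp only [idChart_symm_idChart_one, mul_one, mul_inv_cancel]
    exact one_mem_idChart_source

theorem hasFDerivAt_chartMul_right {x : E} (hx : x ∈ (idChart E G).target) :
    HasFDerivAt (chartMul (E := E) G) (fderiv ℝ (chartMul (E := E) G) (idChart E G 1, x))
      (idChart E G 1, x) :=
  ((contDiffAt_chartMul idChart_one_mem_target hx (by
    rw [idChart_symm_idChart_one, one_mul]; exact (idChart E G).map_target hx)).differentiableAt
      (by simp)).hasFDerivAt

/-- Differentiate (x y x⁻¹) x = x y in y at the identity. -/
theorem fderiv_chartMul_adjointAction {x : E} (hx : x ∈ (idChart E G).target) (Y : E) :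
    fderiv ℝ (chartMul (E := E) G) (idChart E G 1, x)
      (fderiv ℝ (chartConj (E := E) G) (x, idChart E G 1) (0, Y), 0) =
      fderiv ℝ (chartMul (E := E) G) (x, idChart E G 1) (0, Y) := by
  set φ := idChart E G
  have hκ : chartConj (E := E) G (x, φ 1) = φ 1 := by simp [chartConj, φ]
  have h1 : HasFDerivAt (fun y => chartMul (E := E) G (x, y))
      (fderiv ℝ (chartMul (E := E) G) (x, φ 1) ∘L .inr ℝ E E) (φ 1) :=
    HasFDerivAt.comp (g := chartMul (E := E) G) (φ 1)
      ((contDiffAt_chartMul_left hx).differentiableAt (by simp)).hasFDerivAt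
      (hasFDerivAt_prodMk_right x (φ 1))
  have h2 : HasFDerivAt (fun y => chartConj (E := E) G (x, y))
      (fderiv ℝ (chartConj (E := E) G) (x, φ 1) ∘L .inr ℝ E E) (φ 1) :=
    HasFDerivAt.comp (g := chartConj (E := E) G) (φ 1)
      ((contDiffAt_chartConj hx).differentiableAt (by simp)).hasFDerivAt
      (hasFDerivAt_prodMk_right x (φ 1))
  have h3 : HasFDerivAt (fun y => chartMul (E := E) G (chartConj (E := E) G (x, y), x))
      (fderiv ℝ (chartMul (E := E) G) (φ 1, x) ∘L
        ((fderiv ℝ (chartConj (E := E) G) (x, φ 1) ∘L .inr ℝ E E).prod 0)) (φ 1) := by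
    refine HasFDerivAt.comp (g := chartMul (E := E) G)
        (f := fun y => (chartConj (E := E) G (x, y), x))
      (φ 1) ?_ (h2.prodMk (hasFDerivAt_const x (φ 1)))
    rw [hκ]
    exact hasFDerivAt_chartMul_right hx
  have hev : (fun y => chartMul (E := E) G (chartConj (E := E) G (x, y), x)) =ᶠ[nhds (φ 1)]
      fun y => chartMul (E := E) G (x, y) := by
    have hc : ContinuousAt (fun y => φ.symm x * φ.symm y * (φ.symm x)⁻¹) (φ 1) := by
      have hs : ContinuousAt φ.symm (φ 1) :=
        (contMDiffAt_idChart_symm idChart_one_mem_target).continuousAt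
      refine ContinuousAt.comp (g := fun z : G => φ.symm x * z * (φ.symm x)⁻¹) ?_ hs
      exact (mdifferentiableAt_conj (E := E) _ _).continuousAt
    have : φ.source ∈ nhds (φ.symm x * φ.symm (φ 1) * (φ.symm x)⁻¹) := by
      refine (isOpen_extChartAt_source (1 : G)).mem_nhds ?_
      simp only [φ, idChart_symm_idChart_one, mul_one, mul_inv_cancel]
      exact one_mem_idChart_source
    filter_upwards [hc this] with y hy
    have hy' : φ.symm (chartConj (E := E) G (x, y)) = φ.symm x * φ.symm y * (φ.symm x)⁻¹ :=
      φ.left_inv hy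
    simp only [chartMul]
    rw [hy', inv_mul_cancel_right]
  have h4 := (h3.congr_of_eventuallyEq hev.symm).unique h1
  exact congrArg (fun L : E →L[ℝ] E => L Y) h4

/-- With A(x) = Ad(x)Y and D the second derivative of the multiplication m at (1, 1),
differentiating the identity for (x y x⁻¹) x = x y in x at 1 gives D(0,X)(Y,0) + A'X = D(X,0)(0,Y).
Symmetry of D turns A'X into D(X,0)(0,Y) - D(Y,0)(0,X), the bracket. -/
theorem hasFDerivAt_chart_adjointAction [CompleteSpace E] (Y : E) :
    ∃ A' : E →L[ℝ] E, HasFDerivAt (fun x => adjointAction ((idChart E G).symm x) Y) A'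
      (idChart E G 1) ∧ ∀ X, A' X = bracket G X Y := by
  set φ := idChart E G
  set m := chartMul (E := E) G
  set D := fderiv ℝ (fderiv ℝ m) (φ 1, φ 1)
  have hm : ContDiffAt ℝ ∞ m (φ 1, φ 1) := contDiffAt_chartMul_left idChart_one_mem_target
  have hD : HasFDerivAt (fderiv ℝ m) D (φ 1, φ 1) :=
    ((hm.fderiv_right (m := ∞) (by simp)).differentiableAt (by simp)).hasFDerivAt
  have hsymm : IsSymmSndFDerivAt ℝ m (φ 1, φ 1) := hm.isSymmSndFDerivAt (by
    rw [minSmoothness_of_isRCLikeNormedField]; exact ENat.LEInfty.out)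
  have hl (Z : E) : HasFDerivAt (fun x => chartField (E := E) G (x, Z))
      ((ContinuousLinearMap.apply ℝ E ((0 : E), Z)) ∘L (D ∘L .inl ℝ E E)) (φ 1) :=
    (ContinuousLinearMap.apply ℝ E ((0 : E), Z)).hasFDerivAt.comp (φ 1)
      (HasFDerivAt.comp (g := fderiv ℝ m) (φ 1) hD (hasFDerivAt_prodMk_left (φ 1) (φ 1)))
  have hbr (X : E) : bracket G X Y = D (X, 0) (0, Y) - D (Y, 0) (0, X) := by
    rw [bracket_eq_fderiv, (hl Y).fderiv, (hl X).fderiv]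
    rfl
  have hκ : ContDiffAt ℝ ∞ (fun x => fderiv ℝ (chartConj (E := E) G) (x, φ 1) (0, Y)) (φ 1) := by
    have h1 : ContDiffAt ℝ ∞ (fderiv ℝ (chartConj (E := E) G)) (φ 1, φ 1) :=
      (contDiffAt_chartConj idChart_one_mem_target).fderiv_right (m := ∞) (by simp)
    exact (ContDiffAt.comp (φ 1) (f := fun x => (x, φ 1)) h1
      (contDiffAt_id.prodMk contDiffAt_const)).clm_apply contDiffAt_const
  have hA (x : E) (hx : x ∈ φ.target) : fderiv ℝ (chartConj (E := E) G) (x, φ 1) (0, Y) =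
      adjointAction (φ.symm x) Y := by
    have h2 : HasFDerivAt (fun y => chartConj (E := E) G (x, y))
        (fderiv ℝ (chartConj (E := E) G) (x, φ 1) ∘L .inr ℝ E E) (φ 1) :=
      HasFDerivAt.comp (g := chartConj (E := E) G) (φ 1)
        ((contDiffAt_chartConj hx).differentiableAt (by simp)).hasFDerivAt
        (hasFDerivAt_prodMk_right x (φ 1))
    exact (congrArg (fun L : E →L[ℝ] E => L Y) h2.fderiv).symm.trans
      (adjointAction_eq_mfderiv (φ.symm x) Y).symm
  have htar : φ.target ∈ nhds (φ 1) :=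
    (isOpen_extChartAt_target (I := 𝓘(ℝ, E)) (1 : G)).mem_nhds idChart_one_mem_target
  set A := fun x => fderiv ℝ (chartConj (E := E) G) (x, φ 1) (0, Y) with hAdef
  have hA' := (hκ.differentiableAt (by simp)).hasFDerivAt
  set A' := fderiv ℝ A (φ 1)
  have hA1 : A (φ 1) = Y := by
    have := hA (φ 1) idChart_one_mem_target
    rw [idChart_symm_idChart_one] at this
    exact this.trans (Ad_one Y)
  refine ⟨A', hA'.congr_of_eventuallyEq (by filter_upwards [htar] with x hx; exact (hA x hx).symm),
    fun X => ?_⟩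
  have h5 : HasFDerivAt (fun x => fderiv ℝ m (φ 1, x) (A x, 0)) _ (φ 1) :=
    (HasFDerivAt.comp (g := fderiv ℝ m) (φ 1) hD (hasFDerivAt_prodMk_right (φ 1) (φ 1))).clm_apply
      (hA'.prodMk (hasFDerivAt_const (0 : E) (φ 1)))
  have h6 : (fun x => fderiv ℝ m (φ 1, x) (A x, 0)) =ᶠ[nhds (φ 1)]
      fun x => chartField (E := E) G (x, Y) := by
    filter_upwards [htar] with x hx
    exact fderiv_chartMul_adjointAction hx Y
  have h7 := (h5.congr_of_eventuallyEq h6.symm).unique (hl Y)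
  have h8 := congrArg (fun L : E →L[ℝ] E => L X) h7
  have h9 (Z : E) : fderiv ℝ m (φ 1, φ 1) (Z, 0) = Z := by
    have e1 : HasFDerivAt (fun x => m (x, φ 1)) (fderiv ℝ m (φ 1, φ 1) ∘L .inl ℝ E E) (φ 1) :=
      HasFDerivAt.comp (g := m) (φ 1) (hm.differentiableAt (by simp)).hasFDerivAt
        (hasFDerivAt_prodMk_left (φ 1) (φ 1))
    have e2 : (fun x => m (x, φ 1)) =ᶠ[nhds (φ 1)] id := by
      filter_upwards [htar] with x hx
      simp only [m, chartMul, φ, idChart_symm_idChart_one, mul_one, id]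
      exact φ.right_inv hx
    exact congrArg (fun L : E →L[ℝ] E => L Z)
      ((e1.congr_of_eventuallyEq e2.symm).unique (hasFDerivAt_id (φ 1)))
  simp only [add_apply, ContinuousLinearMap.comp_apply,
    ContinuousLinearMap.prod_apply, ContinuousLinearMap.flip_apply, ContinuousLinearMap.inr_apply,
    ContinuousLinearMap.inl_apply, zero_apply, Function.comp_apply,
    ContinuousLinearMap.apply_apply, hA1, h9] at h8
  have hs : D (Y, 0) (0, X) = D (0, X) (Y, 0) := hsymm (Y, 0) (0, X)
  rw [hbr, hs, ← h8, add_sub_cancel_right]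

theorem HasVelocity.hasDerivAt_idChart {a : ℝ → G} {X : E} {t : ℝ} (ha : HasVelocity a X t)
    (h1 : a t = 1) : HasDerivAt (fun s => idChart E G (a s)) X t := by
  have : IsManifold 𝓘(ℝ, E) 1 G := IsManifold.of_le (n := ∞) (by simp)
  have hd : MDifferentiableAt 𝓘(ℝ, E) 𝓘(ℝ, E) (idChart E G) (a t) := by
    rw [h1]; exact mdifferentiableAt_extChartAt (mem_chart_source E (1 : G))
  have hid (v : E) : (mfderiv 𝓘(ℝ, E) 𝓘(ℝ, E) (idChart E G) (1 : G) v : E) = v :=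
    congrArg (fun L : E →L[ℝ] E => L v) mfderiv_extChartAt_self
  obtain ⟨L, hL, h⟩ : ∃ L : ℝ →L[ℝ] E, L 1 = X ∧ HasFDerivAt (fun s => idChart E G (a s)) L t := by
    refine ⟨_, ?_, (HasMFDerivAt.comp t hd.hasMFDerivAt ha).hasFDerivAt⟩
    change (mfderiv 𝓘(ℝ, E) 𝓘(ℝ, E) (idChart E G) (a t) ((1 : ℝ) • invField X (a t) : E) : E) = X
    rw [h1, one_smul, hid, invField_one]
  exact h.hasDerivAt.congr_deriv hL

/-- Left translation by a(t)⁻¹ reduces to a curve through 1; multiplicativity of Ad restores the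
factor Ad(a(t)). -/
theorem HasVelocity.hasDerivAt_adjointAction [CompleteSpace E] {a : ℝ → G} {X : E} {t : ℝ}
    (ha : HasVelocity a X t) (Y : E) :
    HasDerivAt (fun s => adjointAction (a s) Y) (adjointAction (a t) (bracket G X Y)) t := by
  have hb := ha.const_mul (a t)⁻¹
  have hb1 : (a t)⁻¹ * a t = 1 := inv_mul_cancel _
  have hφ := hb.hasDerivAt_idChart hb1
  obtain ⟨A', hA', hX⟩ := hasFDerivAt_chart_adjointAction (G := G) Y
  have h1 : HasDerivAt (fun s => adjointAction ((idChart E G).symm (idChart E G ((a t)⁻¹ * a s))) Y)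
      (A' X) t := HasFDerivAt.comp_hasDerivAt t (f := fun s => idChart E G ((a t)⁻¹ * a s))
        (l := fun x => adjointAction ((idChart E G).symm x) Y) (by rw [hb1]; exact hA') hφ
  have h2 : (fun s => adjointAction ((idChart E G).symm (idChart E G ((a t)⁻¹ * a s))) Y)
      =ᶠ[nhds t] fun s => adjointAction ((a t)⁻¹ * a s) Y := by
    have : (idChart E G).source ∈ nhds ((a t)⁻¹ * a t) := by
      rw [hb1]
      exact (isOpen_extChartAt_source (1 : G)).mem_nhds one_mem_idChart_source
    filter_upwards [hb.continuousAt this] with s hs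
    exact congrArg (fun g => adjointAction g Y) ((idChart E G).left_inv hs)
  have h3 := (adjointAction (E := E) (a t)).hasFDerivAt.comp_hasDerivAt t
    (h1.congr_of_eventuallyEq h2.symm)
  rw [hX] at h3
  refine h3.congr_of_eventuallyEq (Filter.Eventually.of_forall fun s => ?_)
  simp only [Function.comp_apply]
  rw [← Ad_mul, mul_inv_cancel_left]

end Bracket


/-! ### Functions e^a and (1 - e^{-a})/a of a bounded operator. -/

section OperatorExponential

variable {V : Type*} [NormedAddCommGroup V] [NormedSpace ℝ V] [CompleteSpace V]
  {V' : Type*} [NormedAddCommGroup V'] [NormedSpace ℝ V'] [CompleteSpace V']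

/-- The exponential of a bounded operator. -/
def opExp (a : V →L[ℝ] V) : V →L[ℝ] V := NormedSpace.exp a

omit [CompleteSpace V] in
theorem opExp_zero : opExp (0 : V →L[ℝ] V) = 1 := NormedSpace.exp_zero

theorem continuous_opExp : Continuous (opExp : (V →L[ℝ] V) → (V →L[ℝ] V)) := by
  let _ : NormedAlgebra ℚ (V →L[ℝ] V) := NormedAlgebra.restrictScalars ℚ ℝ _
  exact NormedSpace.exp_continuous

theorem opExp_neg_mul_opExp (a : V →L[ℝ] V) : opExp (-a) * opExp a = 1 := by
  let _ : NormedAlgebra ℚ (V →L[ℝ] V) := NormedAlgebra.restrictScalars ℚ ℝ _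
  unfold opExp
  rw [← NormedSpace.exp_add_of_commute ((Commute.refl a).neg_left), neg_add_cancel,
    NormedSpace.exp_zero]

theorem hasDerivAt_opExp_smul (a : V →L[ℝ] V) (t : ℝ) :
    HasDerivAt (fun s : ℝ => opExp (s • a)) (opExp (t • a) * a) t :=
  hasDerivAt_exp_smul_const a t

theorem hasSum_opExp_apply (a : V →L[ℝ] V) (v : V) :
    HasSum (fun n : ℕ => ((n.factorial : ℝ)⁻¹) • (a ^ n) v) (opExp a v) :=
  (NormedSpace.exp_series_hasSum_exp' (𝕂 := ℝ) a).map (ContinuousLinearMap.apply ℝ V v)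
    (ContinuousLinearMap.apply ℝ V v).continuous

omit [CompleteSpace V] [CompleteSpace V'] in
theorem pow_intertwine {L : V →L[ℝ] V'} {a : V →L[ℝ] V} {a' : V' →L[ℝ] V'}
    (h : ∀ v, L (a v) = a' (L v)) (n : ℕ) (v : V) : L ((a ^ n) v) = (a' ^ n) (L v) := by
  induction n generalizing v with
  | zero => simp
  | succ n ih => rw [pow_succ, pow_succ, mul_apply_eq_comp, ih, h]; rfl

theorem opExp_intertwine {L : V →L[ℝ] V'} {a : V →L[ℝ] V} {a' : V' →L[ℝ] V'}
    (h : ∀ v, L (a v) = a' (L v)) (v : V) : L (opExp a v) = opExp a' (L v) := by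
  have h1 := (hasSum_opExp_apply a v).map L L.continuous
  have h2 := hasSum_opExp_apply a' (L v)
  refine h1.unique ?_
  convert h2 using 2 with n
  simp only [Function.comp_apply, map_smul, pow_intertwine h]

/-- The operator `(1 - e^{-a}) / a`. -/
def opPhi (a : V →L[ℝ] V) : V →L[ℝ] V := opExp (-a) * ∫ t in (0 : ℝ)..1, opExp (t • a)

theorem continuous_opExp_smul (a : V →L[ℝ] V) : Continuous fun t : ℝ => opExp (t • a) :=
  continuous_opExp.comp (continuous_id.smul continuous_const)

theorem continuous_opPhi : Continuous (opPhi : (V →L[ℝ] V) → (V →L[ℝ] V)) := by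
  refine (continuous_opExp.comp continuous_neg).mul ?_
  refine intervalIntegral.continuous_parametric_intervalIntegral_of_continuous' ?_ 0 1
  exact continuous_opExp.comp (continuous_snd.smul continuous_fst)

theorem opPhi_zero : opPhi (0 : V →L[ℝ] V) = 1 := by
  simp [opPhi, opExp_zero]

theorem eventually_isUnit_opPhi : ∀ᶠ a in nhds (0 : V →L[ℝ] V), IsUnit (opPhi a) := by
  refine continuous_opPhi.continuousAt.eventually_mem (Units.isOpen.mem_nhds ?_)
  rw [opPhi_zero]
  exact isUnit_one

theorem opPhi_apply (a : V →L[ℝ] V) (v : V) :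
    opPhi a v = opExp (-a) (∫ t in (0 : ℝ)..1, opExp (t • a) v) := by
  unfold opPhi
  rw [mul_apply_eq_comp]
  congr 1
  exact (ContinuousLinearMap.intervalIntegral_apply
    ((continuous_opExp_smul a).intervalIntegrable 0 1) v)

/-- The naturality used throughout: an intertwiner of a and a' intertwines all functions of them. It
is applied to the inclusion of 𝔤₋, the identification with the Lie algebra of N, and automorphisms.
-/
theorem opPhi_intertwine {L : V →L[ℝ] V'} {a : V →L[ℝ] V} {a' : V' →L[ℝ] V'}
    (h : ∀ v, L (a v) = a' (L v)) (v : V) : L (opPhi a v) = opPhi a' (L v) := by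
  rw [opPhi_apply, opPhi_apply, opExp_intertwine (a' := -a') (by simp [h])]
  congr 1
  rw [← ContinuousLinearMap.intervalIntegral_comp_comm]
  · congr 1
    ext t
    exact opExp_intertwine (by simp [h]) v
  · exact ((continuous_opExp_smul a).clm_apply continuous_const).intervalIntegrable 0 1

theorem eq_opExp_of_hasDerivAt {a : V →L[ℝ] V} {u : ℝ → V} (hu : ∀ t, HasDerivAt u (a (u t)) t)
    (t : ℝ) : u t = opExp (t • a) (u 0) := by
  have hd (s : ℝ) : HasDerivAt (fun s => opExp (s • -a) (u s)) 0 s := by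
    refine ((hasDerivAt_opExp_smul (-a) s).clm_apply (hu s)).congr_deriv ?_
    simp
  have hc :=
      is_const_of_deriv_eq_zero (fun s => (hd s).differentiableAt) (fun s => (hd s).deriv) t 0
  rw [zero_smul, opExp_zero, one_apply_eq_self] at hc
  rw [← hc, ← mul_apply_eq_comp, smul_neg]
  have := opExp_neg_mul_opExp (-(t • a))
  rw [neg_neg] at this
  rw [this, one_apply_eq_self]

/-- Variation of constants: e^{sa}c(s) has derivative e^{sa}Y. -/
theorem eq_opPhi_of_hasDerivAt {a : V →L[ℝ] V} {c : ℝ → V} {Y : V}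
    (hc : ∀ t, HasDerivAt c (Y - a (c t)) t) (h0 : c 0 = 0) : c 1 = opPhi a Y := by
  have hd (s : ℝ) : HasDerivAt (fun s => opExp (s • a) (c s)) (opExp (s • a) Y) s := by
    refine ((hasDerivAt_opExp_smul a s).clm_apply (hc s)).congr_deriv ?_
    simp
  have hi := intervalIntegral.integral_eq_sub_of_hasDerivAt (a := 0) (b := 1) (fun s _ => hd s)
    (((continuous_opExp_smul a).clm_apply continuous_const).intervalIntegrable 0 1)
  rw [opPhi_apply, hi, h0, map_zero, sub_zero, one_smul, ← mul_apply_eq_comp,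
    opExp_neg_mul_opExp, one_apply_eq_self]

end OperatorExponential

/-! ### The differential of the exponential map. -/

section ExponentialDerivative

variable {E : Type*} [NormedAddCommGroup E] [NormedSpace ℝ E] [FiniteDimensional ℝ E]
  [CompleteSpace E]
  {G : Type*} [TopologicalSpace G] [ChartedSpace E G] [Group G] [LieGroup 𝓘(ℝ, E) ∞ G]

/-- The adjoint representation of the Lie algebra of a Lie group, on the model space. -/
def adCLM (E : Type*) [NormedAddCommGroup E] [NormedSpace ℝ E] [FiniteDimensional ℝ E]
    [CompleteSpace E] (G : Type*) [TopologicalSpace G] [ChartedSpace E G] [Group G]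
    [LieGroup 𝓘(ℝ, E) ∞ G] : E →L[ℝ] E →L[ℝ] E :=
  LinearMap.toContinuousLinearMap ((LinearMap.toContinuousLinearMap :
    (E →ₗ[ℝ] E) ≃ₗ[ℝ] (E →L[ℝ] E)).toLinearMap.comp
    (LinearMap.mk₂ ℝ (bracket (E := E) G)
      (fun X X' Y => add_lie (L := GroupLieAlgebra 𝓘(ℝ, E) G)
        (M := GroupLieAlgebra 𝓘(ℝ, E) G) X X' (Y : GroupLieAlgebra 𝓘(ℝ, E) G))
      (fun c X Y => smul_lie (L := GroupLieAlgebra 𝓘(ℝ, E) G)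
        (M := GroupLieAlgebra 𝓘(ℝ, E) G) c X (Y : GroupLieAlgebra 𝓘(ℝ, E) G))
      (fun X Y Y' => lie_add (L := GroupLieAlgebra 𝓘(ℝ, E) G)
        (M := GroupLieAlgebra 𝓘(ℝ, E) G) X Y (Y' : GroupLieAlgebra 𝓘(ℝ, E) G))
      (fun c X Y => lie_smul (L := GroupLieAlgebra 𝓘(ℝ, E) G)
        (M := GroupLieAlgebra 𝓘(ℝ, E) G) c X
        (Y : GroupLieAlgebra 𝓘(ℝ, E) G))))

theorem adCLM_apply (X Y : E) : adCLM E G X Y = bracket G X Y := rfl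

variable [T2Space G]

/-- Both sides solve u' = (ad X)u with u(0) = Y. The derivative at t is obtained from the one at 0
through exp(sX) = exp((s-t)X) exp(tX). -/
theorem adjointAction_expMap (X Y : E) (t : ℝ) :
    adjointAction (expMap (t • X) : G) Y = opExp (t • adCLM E G X) Y := by
  have h0 : adjointAction (expMap ((0 : ℝ) • X) : G) Y = Y := by
    rw [zero_smul, expMap_zero, Ad_one]
  have hd (t : ℝ) : HasDerivAt (fun t : ℝ => adjointAction (expMap (t • X) : G) Y)
      (adCLM E G X (adjointAction (expMap (t • X) : G) Y)) t := by
    have h1 := (hasVelocity_expMap (G := G) X 0).hasDerivAt_adjointAction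
      (adjointAction (expMap (t • X) : G) Y)
    have h2 : HasDerivAt (fun s : ℝ => s - t) 1 t := (hasDerivAt_id t).sub_const t
    have h3 := HasDerivAt.scomp t (h := fun s : ℝ => s - t)
      (g₁ := fun s : ℝ => adjointAction (expMap (s • X) : G) (adjointAction (expMap (t • X) : G) Y))
      (by rw [sub_self]; exact h1) h2
    refine (h3.congr_of_eventuallyEq (Filter.Eventually.of_forall fun s => ?_)).congr_deriv ?_
    · simp only [Function.comp_apply]
      rw [← Ad_mul, ← expMap_add_smul, sub_add_cancel]
    · rw [one_smul, zero_smul, expMap_zero, Ad_one, adCLM_apply]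
  have := eq_opExp_of_hasDerivAt hd t
  simpa only [h0] using this

/-- The left trivialised derivative of the exponential map. -/
def dexp (G : Type*) [TopologicalSpace G] [ChartedSpace E G] [Group G] [LieGroup 𝓘(ℝ, E) ∞ G]
    (X : E) : E →L[ℝ] E :=
  fderiv ℝ (fun p : E × E => idChart E G ((expMap p.1)⁻¹ * expMap (p.1 + p.2))) (X, 0) ∘L .inr ℝ E E

/-- Joint smoothness in base point and increment makes `dexp` continuous in the base point. -/
theorem contDiffAt_dexp_aux (X : E) : ContDiffAt ℝ ∞
    (fun p : E × E => idChart E G ((expMap p.1)⁻¹ * expMap (p.1 + p.2))) (X, 0) := by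
  refine contDiffAt_idChart_comp (f := fun p : E × E => ((expMap p.1)⁻¹ * expMap (p.1 + p.2) : G))
      ?_ ?_
  · have h1 : ContMDiffAt 𝓘(ℝ, E × E) 𝓘(ℝ, E) ∞ (fun p : E × E => (expMap p.1 : G)) (X, 0) :=
      contMDiff_expMap.contMDiffAt.comp (X, (0 : E)) contDiff_fst.contMDiff.contMDiffAt
    have h2 :
        ContMDiffAt 𝓘(ℝ, E × E) 𝓘(ℝ, E) ∞ (fun p : E × E => (expMap (p.1 + p.2) : G)) (X, 0) :=
      contMDiff_expMap.contMDiffAt.comp (X, (0 : E))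
        (contDiff_fst.add contDiff_snd).contMDiff.contMDiffAt
    exact h1.inv.mul h2
  · simp only [add_zero, inv_mul_cancel]
    exact one_mem_idChart_source

theorem continuous_dexp : Continuous (dexp G : E → (E →L[ℝ] E)) := by
  rw [continuous_iff_continuousAt]
  intro X
  have h := ((contDiffAt_dexp_aux (G := G) X).fderiv_right (m := ∞) (by simp)).continuousAt
  have h2 : ContinuousAt (fun Y : E => (Y, (0 : E))) X := by fun_prop
  exact (ContinuousAt.comp (f := fun Y : E => (Y, (0 : E))) h h2).clm_comp continuousAt_const

theorem mfderiv_expMap (X V : E) : (mfderiv 𝓘(ℝ, E) 𝓘(ℝ, E) (expMap : E → G) X V : E) =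
    invField (dexp G X V) (expMap X : G) := by
  set h : E → G := fun v => (expMap X)⁻¹ * expMap (X + v) with hdef
  have hadd : HasFDerivAt (fun v : E => X + v) (ContinuousLinearMap.id ℝ E) 0 :=
    (hasFDerivAt_id _).const_add X
  have hexp (Z : E) : MDifferentiableAt 𝓘(ℝ, E) 𝓘(ℝ, E) (expMap : E → G) Z :=
    contMDiff_expMap.mdifferentiable (by simp) Z
  have hh : MDifferentiableAt 𝓘(ℝ, E) 𝓘(ℝ, E) h 0 := by
    refine MDifferentiableAt.comp (0 : E) (g := fun g : G => (expMap X)⁻¹ * g)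
      (mdifferentiableAt_mul_left _ _) (MDifferentiableAt.comp (0 : E) (hexp _) ?_)
    exact hadd.differentiableAt.mdifferentiableAt
  have h1 : h 0 = 1 := by simp [hdef]
  have e1 := mfderiv_eq_fderiv_idChart hh h1 V
  have e2 : fderiv ℝ (idChart E G ∘ h) 0 V = dexp G X V := by
    have :=
        HasFDerivAt.comp (g := fun p : E × E => idChart E G ((expMap p.1)⁻¹ * expMap (p.1 + p.2)))
      (0 : E) ((contDiffAt_dexp_aux (G := G) X).differentiableAt (by simp)).hasFDerivAt
      (hasFDerivAt_prodMk_right X (0 : E))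
    exact congrArg (fun L : E →L[ℝ] E => L V) this.fderiv
  have e3 := mfderiv_comp_eq_apply (mdifferentiableAt_mul_left (E := E) (expMap X : G) 1) hh h1 V
  have e4 : (fun x : G => expMap X * x) ∘ h = expMap ∘ fun v => X + v := by
    ext v; simp [hdef]
  have e5 := mfderiv_comp_eq_apply (f := fun v : E => X + v) (x := 0) (y := X) (hexp X)
    hadd.differentiableAt.mdifferentiableAt (add_zero X) V
  rw [mfderiv_eq_fderiv, hadd.fderiv] at e5
  rw [e4] at e3
  exact (e5.symm.trans e3).trans (congrArg (fun w : E => invField w (expMap X : G)) (e1.trans e2))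

theorem HasDerivAt.hasVelocity_expMap {Z : ℝ → E} {Z' : E} {t : ℝ} (hZ : HasDerivAt Z Z' t) :
    HasVelocity (fun s => (expMap (Z s) : G)) (dexp G (Z t) Z') t := by
  have h := HasMFDerivAt.comp t (g := (expMap : E → G))
    ((contMDiff_expMap.mdifferentiable (by simp) (Z t)).hasMFDerivAt) hZ.hasFDerivAt.hasMFDerivAt
  refine h.congr_mfderiv ?_
  ext
  change (mfderiv 𝓘(ℝ, E) 𝓘(ℝ, E) (expMap : E → G) (Z t) ((1 : ℝ) • Z' : E) : E) = (1 : ℝ) • (_ : E)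
  rw [one_smul, one_smul]
  exact mfderiv_expMap (Z t) Z'

theorem dexp_zero (Y : E) : dexp G 0 Y = Y := by
  have hd :
      HasDerivAt (fun s : ℝ => s • Y) Y 0 := by simpa using (hasDerivAt_id (0 : ℝ)).smul_const Y
  have h := HasDerivAt.hasVelocity_expMap (G := G) hd
  rw [zero_smul] at h
  exact h.unique (hasVelocity_expMap Y 0)

/-- The variation in s of exp((t+h)(X+sY)) = exp(t(X+sY)) exp(h(X+sY)), by the Leibniz rule for
velocities. -/
theorem dexp_cocycle (X Y : E) (t h : ℝ) : dexp G ((t + h) • X) ((t + h) • Y) =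
    opExp (h • -adCLM E G X) (dexp G (t • X) (t • Y)) + dexp G (h • X) (h • Y) := by
  have hd (r : ℝ) : HasDerivAt (fun s : ℝ => r • (X + s • Y)) (r • Y) 0 := by
    refine HasDerivAt.congr_deriv
        ((((hasDerivAt_id (0 : ℝ)).smul_const Y).const_add X).const_smul r) ?_
    rw [one_smul]
  have hv (r : ℝ) : HasVelocity (fun s : ℝ => (expMap (r • (X + s • Y)) : G))
      (dexp G (r • X) (r • Y)) 0 := by
    simpa using HasDerivAt.hasVelocity_expMap (G := G) (hd r)
  have h1 := (hv t).mul (hv h)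
  simp only [← expMap_add_smul] at h1
  rw [(hv (t + h)).unique h1, zero_smul, add_zero, ← expMap_neg, ← smul_neg, adjointAction_expMap,
    map_neg]

/-- Letting h → 0 in the cocycle, u(t) = dexp at tX of tY satisfies u' = Y - (ad X)u and u(0) = 0.
-/
theorem dexp_eq_opPhi (X Y : E) : dexp G X Y = opPhi (adCLM E G X) Y := by
  have h0 : dexp G ((0 : ℝ) • X) ((0 : ℝ) • Y) = 0 := by simp
  have hsmall : HasDerivAt (fun h : ℝ => dexp G (h • X) (h • Y)) Y 0 := by
    rw [hasDerivAt_iff_tendsto_slope_zero]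
    have hc : Continuous fun h : ℝ => dexp G (h • X) Y :=
      (continuous_dexp.comp (continuous_id.smul continuous_const)).clm_apply continuous_const
    have h1 := (hc.tendsto 0).mono_left (nhdsWithin_le_nhds (s := {0}ᶜ))
    simp only [zero_smul, dexp_zero] at h1
    refine h1.congr' ?_
    filter_upwards [self_mem_nhdsWithin] with h hh
    rw [zero_add, h0, sub_zero, map_smul, smul_smul, inv_mul_cancel₀ hh, one_smul]
  have hd (t : ℝ) : HasDerivAt (fun t : ℝ => dexp G (t • X) (t • Y))
      (Y - adCLM E G X (dexp G (t • X) (t • Y))) t := by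
    have h1 : HasDerivAt (fun h : ℝ => opExp (h • -adCLM E G X) (dexp G (t • X) (t • Y)) +
        dexp G (h • X) (h • Y)) (-adCLM E G X (dexp G (t • X) (t • Y)) + Y) 0 := by
      refine HasDerivAt.add ?_ hsmall
      have := (hasDerivAt_opExp_smul (-adCLM E G X) 0).clm_apply
        (hasDerivAt_const (0 : ℝ) (dexp G (t • X) (t • Y)))
      simpa [opExp_zero] using this
    simp only [← dexp_cocycle] at h1
    have h3 := HasDerivAt.scomp t (h := fun s : ℝ => s - t) (h' := 1)
      (g₁ := fun h : ℝ => dexp G ((t + h) • X) ((t + h) • Y)) (by rw [sub_self]; exact h1)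
      ((hasDerivAt_id t).sub_const t)
    refine (h3.congr_of_eventuallyEq (Filter.Eventually.of_forall fun s => ?_)).congr_deriv ?_
    · simp
    · rw [one_smul]; abel
  simpa using eq_opPhi_of_hasDerivAt hd h0

end ExponentialDerivative


/-! ### The inverse function theorem with values in a manifold. -/

section InverseFunction

variable {V : Type*} [NormedAddCommGroup V] [NormedSpace ℝ V] [CompleteSpace V]
  {F : Type*} [NormedAddCommGroup F] [NormedSpace ℝ F] [CompleteSpace F]
  {M : Type*} [TopologicalSpace M] [ChartedSpace F M] [IsManifold 𝓘(ℝ, F) ∞ M]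

/-- The inverse function theorem, for maps from a Banach space to a manifold. -/
theorem isLocalDiffeomorph_of_bijective_mfderiv {f : V → M} (hf : ContMDiff 𝓘(ℝ, V) 𝓘(ℝ, F) ∞ f)
    (hb : ∀ v, Function.Bijective fun w : V => (mfderiv 𝓘(ℝ, V) 𝓘(ℝ, F) f v w : F)) :
    IsLocalDiffeomorph 𝓘(ℝ, V) 𝓘(ℝ, F) ∞ f := by
  intro x
  set c := extChartAt 𝓘(ℝ, F) (f x) with hc
  have hS : IsOpen (f ⁻¹' c.source) := (isOpen_extChartAt_source (f x)).preimage hf.continuous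
  have hxS : x ∈ f ⁻¹' c.source := mem_extChartAt_source (f x)
  -- Invertibility is recorded on the whole preimage of the chart domain, since smoothness of the
  -- local inverse is checked at each point of its domain.
  have hg (v : V) (hv : v ∈ f ⁻¹' c.source) : ContDiffAt ℝ ∞ (c ∘ f) v ∧
      ∃ L : V ≃L[ℝ] F, HasFDerivAt (c ∘ f) (L : V →L[ℝ] F) v := by
    have hcv : ContMDiffAt 𝓘(ℝ, F) 𝓘(ℝ, F) ∞ c (f v) := contMDiffAt_extChartAt' (by
      simpa only [mem_preimage, hc, extChartAt_source] using hv)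
    have h1 : ContMDiffAt 𝓘(ℝ, V) 𝓘(ℝ, F) ∞ (c ∘ f) v := hcv.comp v hf.contMDiffAt
    refine ⟨h1.contDiffAt, ?_⟩
    have h2 := (h1.contDiffAt.differentiableAt (by simp)).hasFDerivAt
    have hi := isInvertible_mfderiv_extChartAt (I := 𝓘(ℝ, F)) hv
    obtain ⟨A, hA⟩ := hi
    have hbij : Function.Bijective (fderiv ℝ (c ∘ f) v) := by
      have h3 : ∀ w : V, fderiv ℝ (c ∘ f) v w = A (mfderiv 𝓘(ℝ, V) 𝓘(ℝ, F) f v w) := by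
        intro w
        have h4 := mfderiv_comp_eq_apply (hcv.mdifferentiableAt (by simp))
          (hf.mdifferentiable (by simp) v) rfl w
        rw [mfderiv_eq_fderiv] at h4
        refine h4.trans ?_
        exact congrArg (fun L : F →L[ℝ] F => L (mfderiv 𝓘(ℝ, V) 𝓘(ℝ, F) f v w : F)) hA.symm
      have h5 : (fderiv ℝ (c ∘ f) v : V → F) =
          (A : F → F) ∘ fun w : V => (mfderiv 𝓘(ℝ, V) 𝓘(ℝ, F) f v w : F) := funext h3
      rw [h5]
      exact A.bijective.comp (hb v)
    refine ⟨ContinuousLinearEquiv.ofBijective (fderiv ℝ (c ∘ f) v)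
      (LinearMap.ker_eq_bot.mpr hbij.1) (LinearMap.range_eq_top.mpr hbij.2), ?_⟩
    rw [ContinuousLinearEquiv.coe_ofBijective]
    exact h2
  obtain ⟨hgx, L, hL⟩ := hg x hxS
  set e := hgx.toOpenPartialHomeomorph (c ∘ f) hL (by simp) with he
  have hecoe : (e : V → F) = c ∘ f := hgx.toOpenPartialHomeomorph_coe hL (by simp)
  set e' := e.restrOpen _ hS with he'
  let e₂ := e'.trans (chartAt F (f x)).symm
  have hcc : ∀ y, c y = chartAt F (f x) y := fun y => by simp [hc]
  have hsrc : ∀ v ∈ e₂.source, v ∈ e.source ∧ v ∈ f ⁻¹' c.source := by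
    intro v hv
    have : v ∈ e'.source := hv.1
    rw [he', OpenPartialHomeomorph.restrOpen_source] at this
    exact this
  have heq : ∀ v ∈ e₂.source, f v = e₂ v := by
    intro v hv
    have h1 := (hsrc v hv).2
    have : e₂ v = (chartAt F (f x)).symm (e v) := rfl
    rw [this, hecoe, Function.comp_apply, hcc, OpenPartialHomeomorph.left_inv]
    simpa [hc] using h1
  refine ⟨{ toPartialEquiv := e₂.toPartialEquiv
            open_source := e₂.open_source
            open_target := e₂.open_target
            contMDiffOn_toFun := hf.contMDiffOn.congr fun v hv => (heq v hv).symm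
            contMDiffOn_invFun := ?_ }, ?_, heq⟩
  · intro y hy
    have hys : e₂.symm y ∈ e₂.source := e₂.map_target hy
    have hy1 : y ∈ (chartAt F (f x)).source := by
      have := hy
      simp only [e₂, OpenPartialHomeomorph.trans_target, OpenPartialHomeomorph.symm_target] at this
      exact this.1
    have hy2 : chartAt F (f x) y ∈ e.target := by
      have h1 := e.map_source (hsrc _ hys).1
      have h2 : e (e₂.symm y) = c (f (e₂.symm y)) := congrFun hecoe _
      rw [h2, heq _ hys, e₂.right_inv hy, hcc] at h1
      exact h1
    have h3 : e.symm (chartAt F (f x) y) = e₂.symm y := rfl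
    obtain ⟨hd, L', hL'⟩ := hg _ (hsrc _ hys).2
    have h4 : ContDiffAt ℝ ∞ e.symm (chartAt F (f x) y) := by
      refine e.contDiffAt_symm hy2 (f₀' := L') ?_ ?_
      · rw [hecoe, h3]; exact hL'
      · rw [hecoe, h3]; exact hd
    have h5 : ContMDiffAt 𝓘(ℝ, F) 𝓘(ℝ, F) ∞ (chartAt F (f x)) y := by
      have := contMDiffAt_extChartAt' (I := 𝓘(ℝ, F)) (n := ∞) hy1
      simpa using this
    exact (h4.contMDiffAt.comp y h5).contMDiffWithinAt
  · change x ∈ e₂.source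
    simp only [e₂, OpenPartialHomeomorph.trans_source, mem_inter_iff, mem_preimage,
      OpenPartialHomeomorph.symm_source]
    refine ⟨?_, ?_⟩
    · rw [he', OpenPartialHomeomorph.restrOpen_source]
      exact ⟨hgx.mem_toOpenPartialHomeomorph_source hL (by simp), hxS⟩
    · have : e' x = c (f x) := congrFun hecoe x
      rw [this, hcc]
      exact mem_chart_target F (f x)

end InverseFunction


/-! ### Lie algebras with contracting automorphisms. -/

section Contractions

variable {E : Type*} [NormedAddCommGroup E] [NormedSpace ℝ E] [FiniteDimensional ℝ E]
  [CompleteSpace E]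
  {G : Type*} [TopologicalSpace G] [ChartedSpace E G] [Group G] [LieGroup 𝓘(ℝ, E) ∞ G]

variable (E G) in
/-- The Lie algebra of `G` has arbitrarily strongly contracting automorphisms. -/
def HasContractions : Prop :=
  ∀ ε > (0 : ℝ), ∃ δ : E ≃L[ℝ] E,
    (∀ X Y : E, δ (bracket G X Y) = bracket G (δ X) (δ Y)) ∧ ∀ v, ‖δ v‖ ≤ ε * ‖v‖

/-- The value at `g` of a left invariant field, as a linear function of the generator. -/
def invFieldLinear {E : Type*} [NormedAddCommGroup E] [NormedSpace ℝ E] {G : Type*}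
    [TopologicalSpace G] [ChartedSpace E G] [Group G] (g : G) : E →ₗ[ℝ] E where
  toFun W := invField (E := E) W g
  map_add' W V := invField_add W V g
  map_smul' c W := invField_smul c W g

omit [CompleteSpace E] in
theorem invField_bijective (g : G) : Function.Bijective fun W : E => invField (E := E) W g := by
  have hi := invField_injective (E := E) g
  have hs : Function.Surjective (invFieldLinear (E := E) g) :=
    LinearMap.injective_iff_surjective.mp hi
  exact ⟨hi, hs⟩

/-- The trivialisation of the tangent spaces of a Lie group by left invariant fields. -/
def invFieldEquiv (g : G) : E ≃ₗ[ℝ] E := LinearEquiv.ofBijective (invFieldLinear g)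
  (invField_bijective g)

theorem exists_ball_isUnit_opPhi (V : Type*) [NormedAddCommGroup V] [NormedSpace ℝ V]
    [CompleteSpace V] : ∃ r > (0 : ℝ), ∀ a : V →L[ℝ] V, ‖a‖ < r → IsUnit (opPhi a) := by
  obtain ⟨r, hr, h⟩ := Metric.eventually_nhds_iff.mp (eventually_isUnit_opPhi (V := V))
  exact ⟨r, hr, fun a ha => h (by simpa using ha)⟩

omit [FiniteDimensional ℝ E] [CompleteSpace E] [LieGroup 𝓘(ℝ, E) ∞ G] in
theorem HasContractions.exists_norm_lt (hG : HasContractions E G) (X : E) {r : ℝ} (hr : 0 < r) :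
    ∃ δ : E ≃L[ℝ] E, (∀ X Y : E, δ (bracket G X Y) = bracket G (δ X) (δ Y)) ∧
      (∀ v, ‖δ v‖ ≤ ‖v‖) ∧ ‖δ X‖ < r := by
  have hX : 0 < ‖X‖ + 1 := by positivity
  obtain ⟨δ, h1, h2⟩ := hG (min 1 (r / (‖X‖ + 1))) (by positivity)
  refine ⟨δ, h1, fun v => ?_, ?_⟩
  · exact (h2 v).trans (mul_le_of_le_one_left (norm_nonneg v) (min_le_left _ _))
  · calc ‖δ X‖ ≤ min 1 (r / (‖X‖ + 1)) * ‖X‖ := h2 X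
      _ ≤ r / (‖X‖ + 1) * ‖X‖ := by gcongr; exact min_le_right _ _
      _ < r / (‖X‖ + 1) * (‖X‖ + 1) := by gcongr; linarith
      _ = r := by field_simp

/-- ψ(0) = 1, so ψ(ad X) is invertible for small X; an automorphism δ with δX small conjugates ψ(ad
X) to ψ(ad δX). -/
theorem HasContractions.bijective_opPhi (hG : HasContractions E G) (X : E) :
    Function.Bijective (opPhi (adCLM E G X)) := by
  obtain ⟨r, hr, h⟩ := exists_ball_isUnit_opPhi E
  have hA : 0 < ‖adCLM E G‖ + 1 := by positivity
  obtain ⟨δ, h1, -, h3⟩ := hG.exists_norm_lt X (div_pos hr hA)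
  have hu : IsUnit (opPhi (adCLM E G (δ X))) := by
    refine h _ ?_
    calc ‖adCLM E G (δ X)‖ ≤ ‖adCLM E G‖ * ‖δ X‖ := (adCLM E G).le_opNorm _
      _ ≤ (‖adCLM E G‖ + 1) * ‖δ X‖ := by gcongr; linarith
      _ < (‖adCLM E G‖ + 1) * (r / (‖adCLM E G‖ + 1)) := by gcongr
      _ = r := by field_simp
  have hb : Function.Bijective (opPhi (adCLM E G (δ X))) := by
    obtain ⟨u, hu⟩ := hu
    rw [← hu]
    exact (ContinuousLinearEquiv.unitsEquiv ℝ E u).bijective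
  have hc (v : E) : δ (opPhi (adCLM E G X) v) = opPhi (adCLM E G (δ X)) (δ v) :=
    opPhi_intertwine (L := (δ : E →L[ℝ] E)) (fun v => h1 X v) v
  have : (opPhi (adCLM E G X) : E → E) = δ.symm ∘ opPhi (adCLM E G (δ X)) ∘ δ := by
    ext v; simp [← hc]
  rw [this]
  exact δ.symm.bijective.comp (hb.comp δ.bijective)

variable [T2Space G]

theorem HasContractions.isLocalDiffeomorph_expMap (hG : HasContractions E G) :
    IsLocalDiffeomorph 𝓘(ℝ, E) 𝓘(ℝ, E) ∞ (expMap : E → G) := by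
  have : IsManifold 𝓘(ℝ, E) ∞ G := inferInstance
  refine isLocalDiffeomorph_of_bijective_mfderiv contMDiff_expMap fun X => ?_
  have h : (fun V : E => (mfderiv 𝓘(ℝ, E) 𝓘(ℝ, E) (expMap : E → G) X V : E)) =
      (fun W : E => invField (E := E) W (expMap X : G)) ∘ opPhi (adCLM E G X) := by
    ext V
    rw [mfderiv_expMap, dexp_eq_opPhi]
    rfl
  rw [h]
  exact (invField_bijective (E := E) _).comp (hG.bijective_opPhi X)

/-- Automorphisms of the Lie algebra respect the local multiplication in exponential
coordinates. -/
theorem HasContractions.exists_log (hG : HasContractions E G) :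
    ∃ (O : Set G) (l : G → E) (r : ℝ), 0 < r ∧ O ∈ nhds 1 ∧ ContinuousOn l O ∧
      (∀ g ∈ O, expMap (l g) = g) ∧
      (∀ X : E, ‖X‖ < r → l (expMap X) = X) ∧
      (∀ X Y : E, ‖X‖ < r → ‖Y‖ < r → (expMap X * expMap Y : G) ∈ interior O) ∧
      ∀ X Y : E, ‖X‖ < r → ‖Y‖ < r → ∀ δ : E →L[ℝ] E,
        (∀ X Y : E, δ (bracket G X Y) = bracket G (δ X) (δ Y)) →
        (expMap (δ (l (expMap X * expMap Y))) : G) = expMap (δ X) * expMap (δ Y) := by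
  obtain ⟨Φ, h0, hΦ⟩ := hG.isLocalDiffeomorph_expMap (G := G) 0
  have : IsTopologicalGroup G := topologicalGroup_of_lieGroup 𝓘(ℝ, E) ∞
  have hexp : Continuous (expMap : E → G) := contMDiff_expMap.continuous
  set l : G → E := Φ.invFun with hl
  have hlexp {X : E} (hX : X ∈ Φ.source) : l (expMap X) = X := by
    exact (congrArg l (hΦ hX)).trans (Φ.left_inv hX)
  have hexpl {g : G} (hg : g ∈ Φ.target) : expMap (l g) = g := by
    exact (hΦ (Φ.map_target hg)).trans (Φ.right_inv hg)
  have h1 : (1 : G) ∈ Φ.target := by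
    have := Φ.map_source h0
    rwa [show Φ.toPartialEquiv 0 = (1 : G) from (hΦ h0).symm.trans expMap_zero] at this
  have hnear : ∀ᶠ p : E × E in nhds (0, 0), p.1 ∈ Φ.source ∧
      (expMap p.1 * expMap p.2 : G) ∈ Φ.target := by
    refine Filter.Eventually.and ?_ ?_
    · exact continuousAt_fst.eventually_mem (Φ.open_source.mem_nhds h0)
    · have hc : Continuous fun p : E × E => (expMap p.1 * expMap p.2 : G) :=
        (hexp.comp continuous_fst).mul (hexp.comp continuous_snd)
      refine hc.continuousAt.eventually_mem (Φ.open_target.mem_nhds ?_)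
      simpa only [expMap_zero, mul_one] using h1
  obtain ⟨ρ, hρ, hball⟩ := Metric.eventually_nhds_iff.mp hnear
  replace hball (X Y : E) (hX : ‖X‖ < ρ) (hY : ‖Y‖ < ρ) := @hball (X, Y) (by
    simpa [Prod.dist_eq] using ⟨hX, hY⟩)
  -- Half the radius keeps tY in the good ball for |t| < 2, so that t = 1 is an interior time below.
  refine ⟨Φ.target, l, ρ / 2, by positivity, Φ.open_target.mem_nhds h1,
    Φ.contMDiffOn_invFun.continuousOn, fun g hg => hexpl hg, fun X hX => ?_, fun X Y hX hY => ?_,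
    fun X Y hX hY δ hδ => ?_⟩
  · exact hlexp (hball X X (by linarith) (by linarith)).1
  · rw [Φ.open_target.interior_eq]
    exact (hball X Y (by linarith) (by linarith)).2
  have hXs : X ∈ Φ.source := (hball X X (by linarith) (by linarith)).1
  have hmem (t : ℝ) (ht : t ∈ Ioo (-2 : ℝ) 2) : (expMap X * expMap (t • Y) : G) ∈ Φ.target := by
    refine (hball X (t • Y) (by linarith) ?_).2
    have : |t| ≤ 2 := abs_le.mpr ⟨ht.1.le, ht.2.le⟩
    rw [norm_smul, Real.norm_eq_abs]
    nlinarith [norm_nonneg Y]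
  set Z : ℝ → E := fun t => l (expMap X * expMap (t • Y)) with hZ
  have hvel (t : ℝ) : HasVelocity (fun t : ℝ => (expMap X * expMap (t • Y) : G)) Y t :=
    (hasVelocity_expMap Y t).const_mul _
  have hZd (t : ℝ) (ht : t ∈ Ioo (-2 : ℝ) 2) : HasDerivAt Z (deriv Z t) t := by
    have hla : MDifferentiableAt 𝓘(ℝ, E) 𝓘(ℝ, E) l (expMap X * expMap (t • Y)) :=
      ((Φ.contMDiffOn_invFun _ (hmem t ht)).contMDiffAt
        (Φ.open_target.mem_nhds (hmem t ht))).mdifferentiableAt (by simp)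
    have := MDifferentiableAt.comp t (f := fun t : ℝ => (expMap X * expMap (t • Y) : G)) hla
      (HasMFDerivAt.mdifferentiableAt (hvel t))
    exact this.differentiableAt.hasDerivAt
  -- Differentiating exp Z(t) = exp(X) exp(tY) gives the equation ψ(ad Z)Z' = Y, which involves only
  -- the Lie algebra and is thus preserved by δ.
  have hZ' (t : ℝ) (ht : t ∈ Ioo (-2 : ℝ) 2) : opPhi (adCLM E G (Z t)) (deriv Z t) = Y := by
    have h2 := HasDerivAt.hasVelocity_expMap (G := G) (hZd t ht)
    rw [dexp_eq_opPhi] at h2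
    refine HasVelocity.unique h2 ((hvel t).congr_of_eventuallyEq ?_)
    filter_upwards [isOpen_Ioo.mem_nhds ht] with s hs
    exact hexpl (hmem s hs)
  -- Hence exp(δZ(t)) and exp(δX) exp(tδY) have the same velocity δY and the same value at 0.
  have key := HasVelocity.eqOn_Ioo (t₀ := 0) (l := -2) (r := 2) (W := δ Y)
    (a := fun t => (expMap (δ (Z t)) : G)) (b := fun t : ℝ => expMap (δ X) * expMap (t • δ Y))
    (by norm_num) (fun t ht => ?_) (fun t _ => (hasVelocity_expMap (δ Y) t).const_mul _) ?_
  · have := key (x := 1) (by norm_num)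
    simpa only [hZ, one_smul] using this
  · have h3 := HasDerivAt.hasVelocity_expMap (G := G) (δ.hasFDerivAt.comp_hasDerivAt t (hZd t ht))
    rw [dexp_eq_opPhi] at h3
    have h4 := opPhi_intertwine (L := δ) (a := adCLM E G (Z t)) (a' := adCLM E G (δ (Z t)))
      (fun v => hδ _ v) (deriv Z t)
    rw [hZ' t ht] at h4
    rw [h4]
    exact h3
  · simp only [hZ, zero_smul, expMap_zero, mul_one, hlexp hXs]

/-- The neighbourhood O does not depend on X. An automorphism δ moves X into the domain of the local
logarithm, the product exp(δX) exp(δ l(g)) is formed and its logarithm taken there, and δ⁻¹ brings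
the result back. -/
theorem HasContractions.exists_section (hG : HasContractions E G) : ∃ O ∈ nhds (1 : G),
    ∀ X : E, ∃ s : G → E, ContinuousOn s O ∧ s 1 = X ∧ ∀ g ∈ O, expMap (s g) = expMap X * g := by
  obtain ⟨W, l, r, hr, hW, hl, hexpl, hlexp, hmem, hmul⟩ := hG.exists_log (G := G)
  have : IsTopologicalGroup G := topologicalGroup_of_lieGroup 𝓘(ℝ, E) ∞
  have hexp : Continuous (expMap : E → G) := contMDiff_expMap.continuous
  have hl1 : l 1 = 0 := by
    have := hlexp 0 (by simpa using hr)
    rwa [expMap_zero] at this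
  have hlc : ContinuousAt l 1 := hl.continuousAt hW
  refine ⟨W ∩ {g | ‖l g‖ < r}, Filter.inter_mem hW ?_, fun X => ?_⟩
  · refine hlc.norm.eventually_lt continuousAt_const ?_
    rw [hl1]; simpa using hr
  obtain ⟨δ, hδ, hδ1, hδX⟩ := hG.exists_norm_lt X hr
  have hδ' (X Y : E) : δ.symm (bracket G X Y) = bracket G (δ.symm X) (δ.symm Y) := by
    rw [ContinuousLinearEquiv.symm_apply_eq, hδ]; simp
  refine ⟨fun g => δ.symm (l (expMap (δ X) * expMap (δ (l g)))), ?_, ?_, ?_⟩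
  · refine δ.symm.continuous.comp_continuousOn (hl.comp ?_ ?_)
    · exact continuousOn_const.mul ((hexp.comp δ.continuous).comp_continuousOn
        (hl.mono inter_subset_left))
    · intro g hg
      exact interior_subset (hmem _ _ hδX ((hδ1 _).trans_lt hg.2))
  · simp only [hl1, map_zero, expMap_zero, mul_one]
    rw [hlexp _ hδX, δ.symm_apply_apply]
  · intro g hg
    have := hmul (δ X) (δ (l g)) hδX ((hδ1 _).trans_lt hg.2) (δ.symm : E →L[ℝ] E) hδ'
    simp only [ContinuousLinearEquiv.coe_coe, δ.symm_apply_apply] at this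
    rw [this, hexpl g hg.1]

end Contractions


/-! ### Path lifting and bijectivity of the exponential map. -/

section Covering

theorem exists_pos_forall_dist_lt {G : Type*} [TopologicalSpace G] [Group G]
    [IsTopologicalGroup G] {O : Set G} (hO : O ∈ nhds (1 : G)) (γ : C(unitInterval, G)) :
    ∃ d > 0, ∀ s t : unitInterval, dist s t < d → (γ s)⁻¹ * γ t ∈ O := by
  have hc : Continuous fun p : unitInterval × unitInterval => (γ p.1)⁻¹ * γ p.2 := by fun_prop
  have hU : {p : unitInterval × unitInterval | (γ p.1)⁻¹ * γ p.2 ∈ O} ∈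
      uniformity unitInterval := by
    rw [← nhdsSet_diagonal_eq_uniformity, mem_nhdsSet_iff_forall]
    rintro ⟨s, t⟩ hst
    obtain rfl : s = t := hst
    refine hc.continuousAt ?_
    simpa only [inv_mul_cancel] using hO
  obtain ⟨d, hd, h⟩ := Metric.mem_uniformity_dist.mp hU
  exact ⟨d, hd, fun s t hst => h hst⟩

variable {E : Type*} [NormedAddCommGroup E] [NormedSpace ℝ E] [FiniteDimensional ℝ E]
  [CompleteSpace E]
  {G : Type*} [TopologicalSpace G] [ChartedSpace E G] [Group G] [LieGroup 𝓘(ℝ, E) ∞ G]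
  [T2Space G]

/-- By compactness, points of γ at nearby times differ by an element of the fixed neighbourhood O,
so the sections over its translates extend a lift by a time step d/2 that never shrinks. -/
theorem HasContractions.exists_path_lift (hG : HasContractions E G) (γ : C(unitInterval, G)) (X : E)
    (hX : expMap X = γ 0) :
    ∃ Γ : C(unitInterval, E), Γ 0 = X ∧ ∀ t, expMap (Γ t) = γ t := by
  obtain ⟨O, hO, hsec⟩ := hG.exists_section (G := G)
  have : IsTopologicalGroup G := topologicalGroup_of_lieGroup 𝓘(ℝ, E) ∞
  obtain ⟨d, hd, hγ⟩ := exists_pos_forall_dist_lt hO γ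
  set g : ℝ → G := fun t => γ (projIcc 0 1 zero_le_one t) with hg
  have hgc : Continuous g := γ.continuous.comp continuous_projIcc
  have hgO (s t : ℝ) (hst : |s - t| < d) : (g s)⁻¹ * g t ∈ O := by
    refine hγ _ _ (lt_of_le_of_lt ?_ hst)
    rw [Subtype.dist_eq, Real.dist_eq]
    exact abs_projIcc_sub_projIcc zero_le_one
  have step (k : ℕ) : ∃ Γ : ℝ → E, Continuous Γ ∧ Γ 0 = X ∧
      ∀ t ∈ Icc (0 : ℝ) (k * (d / 2)), expMap (Γ t) = g t := by
    induction k with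
    | zero =>
      refine ⟨fun _ => X, continuous_const, rfl, fun t ht => ?_⟩
      have : t = 0 := by simpa using ht
      rw [hX, this, hg]
      simp
    | succ k ih =>
      obtain ⟨Γ, hΓ, hΓ0, hlift⟩ := ih
      set a : ℝ := k * (d / 2) with ha
      have ha0 : 0 ≤ a := by positivity
      obtain ⟨s, hs, hs1, hexp⟩ := hsec (Γ a)
      -- Clamping time to [a, a + d/2] keeps the argument of the section in O for all real t, so the
      -- glued map is continuous on ℝ.
      set τ : ℝ → ℝ := fun t => min (max t a) (a + d / 2) with hτ
      have hτc : Continuous τ := by fun_prop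
      have hτO (t : ℝ) : (g a)⁻¹ * g (τ t) ∈ O := by
        refine hgO _ _ ?_
        have h1 : a ≤ τ t := le_min (le_max_right _ _) (by linarith)
        have h2 : τ t ≤ a + d / 2 := min_le_right _ _
        rw [abs_sub_lt_iff]
        constructor <;> linarith
      have hτa : τ a = a := by simp only [hτ, max_self]; exact min_eq_left (by linarith)
      refine ⟨fun t => if t ≤ a then Γ t else s ((g a)⁻¹ * g (τ t)), ?_, ?_, fun t ht => ?_⟩
      · refine Continuous.if_le hΓ ?_ continuous_id continuous_const ?_
        · exact hs.comp_continuous (continuous_const.mul (hgc.comp hτc)) hτO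
        · rintro t rfl
          rw [hτa, inv_mul_cancel, hs1]
      · simp [ha0, hΓ0]
      · by_cases hta : t ≤ a
        · simp only [hta, if_true]
          exact hlift t ⟨ht.1, hta⟩
        · simp only [hta, if_false]
          have h1 : τ t = t := by
            have h2 : t ≤ a + d / 2 := by
              have := ht.2
              push_cast at this
              linarith
            rw [hτ]
            simp only [max_eq_left (not_le.mp hta).le, min_eq_left h2]
          rw [hexp _ (hτO t), hlift a ⟨ha0, le_rfl⟩, h1, mul_inv_cancel_left]
  obtain ⟨k, hk⟩ := exists_nat_ge (1 / (d / 2))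
  obtain ⟨Γ, hΓ, hΓ0, hlift⟩ := step k
  refine ⟨⟨fun t => Γ t, hΓ.comp continuous_subtype_val⟩, hΓ0, fun t => ?_⟩
  have h1 : (1 : ℝ) ≤ k * (d / 2) := by rwa [div_le_iff₀ (by positivity)] at hk
  have h2 := hlift t ⟨t.2.1, t.2.2.trans h1⟩
  rw [hg] at h2
  simpa using h2

theorem HasContractions.surjective_expMap [PathConnectedSpace G] (hG : HasContractions E G) :
    Function.Surjective (expMap : E → G) := by
  intro g
  obtain ⟨p⟩ := PathConnectedSpace.joined (1 : G) g
  obtain ⟨Γ, -, hΓ⟩ := hG.exists_path_lift (p : C(unitInterval, G)) 0 (by simp [expMap_zero])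
  exact ⟨Γ 1, (hΓ 1).trans p.target⟩

/-- If exp X = exp X', the images of the segments from 0 to X and X' are homotopic paths. Monodromy
gives their lifts a common endpoint, and by uniqueness the lifts are the segments. -/
theorem HasContractions.injective_expMap [SimplyConnectedSpace G] (hG : HasContractions E G) :
    Function.Injective (expMap : E → G) := by
  have hexp : Continuous (expMap : E → G) := contMDiff_expMap.continuous
  have hloc := (hG.isLocalDiffeomorph_expMap (G := G)).isLocalHomeomorph
  have hsep : IsSeparatedMap (expMap : E → G) := T2Space.isSeparatedMap _
  intro X X' h
  let c (X : E) : C(unitInterval, E) := ⟨fun t => (t : ℝ) • X, by fun_prop⟩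
  let p : Path (1 : G) (expMap X) :=
    { toFun := fun t => expMap ((t : ℝ) • X)
      continuous_toFun := hexp.comp (c X).continuous
      source' := by simp [expMap_zero]
      target' := by simp }
  let q : Path (1 : G) (expMap X) :=
    { toFun := fun t => expMap ((t : ℝ) • X')
      continuous_toFun := hexp.comp (c X').continuous
      source' := by simp [expMap_zero]
      target' := by simp [h] }
  obtain ⟨H⟩ := SimplyConnectedSpace.paths_homotopic p q
  have hH0 (t : unitInterval) : H (t, 0) = 1 := by simp
  choose Γ hΓ0 hΓ using fun t :
      unitInterval => hG.exists_path_lift (H.eval t : C(unitInterval, G)) 0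
    (by rw [expMap_zero]; simp)
  have hmono := hloc.monodromy_theorem hsep H Γ (fun t s => hΓ t s)
    (fun t => (hΓ0 t).trans (hΓ0 0).symm) 1
  have huniq (t : unitInterval) (Y : E) (hY : ∀ s : unitInterval, expMap ((s : ℝ) • Y) = H (t, s)) :
      Γ t 1 = Y := by
    have := hsep.eq_of_comp_eq hloc.isLocallyInjective (Γ t).continuous (c Y).continuous
      (funext fun s => (hΓ t s).trans (hY s).symm) 0 (by simp [hΓ0, c])
    simpa [c] using congrFun this 1
  rw [huniq 1 X' (fun s => by simp [q]), huniq 0 X (fun s => by simp [p])] at hmono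
  exact hmono.symm

end Covering


/-! ### Diagonal endomorphisms of a graded vector space. -/

section Grading

variable {V : Type*} [AddCommGroup V] [Module ℝ V] {gr : ℤ → Submodule ℝ V}

/-- The endomorphism of a graded vector space that is multiplication by `w i` in degree `i`. -/
def gradedMap (h : DirectSum.IsInternal gr) (w : ℤ → ℝ) : V →ₗ[ℝ] V :=
  (DirectSum.toModule ℝ ℤ V fun i => w i • (gr i).subtype) ∘ₗ
    (LinearEquiv.ofBijective (DirectSum.coeLinearMap gr) h).symm.toLinearMap

variable (h : DirectSum.IsInternal gr)

theorem gradedMap_of_mem (w : ℤ → ℝ) {i : ℤ} {v : V} (hv : v ∈ gr i) :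
    gradedMap h w v = w i • v := by
  have : (LinearEquiv.ofBijective (DirectSum.coeLinearMap gr) h).symm v =
      DirectSum.lof ℝ ℤ (fun i => gr i) i ⟨v, hv⟩ := by
    rw [LinearEquiv.symm_apply_eq]
    exact (DirectSum.coeLinearMap_lof gr i ⟨v, hv⟩).symm
  simp [gradedMap, this]

include h in
theorem induction_of_isInternal {p : V → Prop} (v : V) (mem : ∀ i, ∀ v ∈ gr i, p v) (zero : p 0)
    (add : ∀ v v', p v → p v' → p (v + v')) : p v := by
  have hv : v ∈ iSup gr := by rw [h.submodule_iSup_eq_top]; exact Submodule.mem_top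
  exact Submodule.iSup_induction gr (motive := p) hv mem zero add

theorem gradedMap_gradedMap (w w' : ℤ → ℝ) (v : V) :
    gradedMap h w (gradedMap h w' v) = gradedMap h (w * w') v := by
  induction v using induction_of_isInternal h with
  | mem i v hv => simp [gradedMap_of_mem h _ hv, smul_smul, mul_comm]
  | zero => simp
  | add v v' hv hv' => simp [hv, hv']

theorem gradedMap_one (v : V) : gradedMap h 1 v = v := by
  induction v using induction_of_isInternal h with
  | mem i v hv => simp [gradedMap_of_mem h _ hv]
  | zero => simp
  | add v v' hv hv' => simp [hv, hv']

theorem gradedMap_add (w w' : ℤ → ℝ) (v : V) :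
    gradedMap h (w + w') v = gradedMap h w v + gradedMap h w' v := by
  induction v using induction_of_isInternal h with
  | mem i v hv => simp [gradedMap_of_mem h _ hv, add_smul]
  | zero => simp
  | add v v' hv hv' => simp only [map_add, hv, hv']; abel

theorem gradedMap_indicator_mem (S : ℤ → Prop) [DecidablePred S] (v : V) :
    gradedMap h (fun i => if S i then 1 else 0) v ∈ ⨆ i : {i : ℤ // S i}, gr i := by
  induction v using induction_of_isInternal h with
  | mem i v hv =>
    rw [gradedMap_of_mem h _ hv]
    by_cases hi : S i
    · simpa [hi] using Submodule.mem_iSup_of_mem (p := fun i : {i : ℤ // S i} => gr i) ⟨i, hi⟩ hv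
    · simp [hi]
  | zero => simp
  | add v v' hv hv' => rw [map_add]; exact add_mem hv hv'

/-- A vector lies in the sum of the components with degree in `S` if and only if it is fixed by the
projection onto this sum. -/
theorem mem_iSup_iff_gradedMap (S : ℤ → Prop) [DecidablePred S] {v : V} :
    v ∈ (⨆ i : {i : ℤ // S i}, gr i) ↔ gradedMap h (fun i => if S i then 1 else 0) v = v := by
  refine ⟨fun hv => ?_, fun hv => hv ▸ gradedMap_indicator_mem h S v⟩
  induction hv using Submodule.iSup_induction' with
  | mem i v hv => simp [gradedMap_of_mem h _ hv, i.2]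
  | zero => simp
  | add v v' _ _ hv hv' => simp only [map_add, hv, hv']

theorem gradedMap_mem_iSup (S : ℤ → Prop) [DecidablePred S] (w : ℤ → ℝ) {v : V}
    (hv : v ∈ ⨆ i : {i : ℤ // S i}, gr i) : gradedMap h w v ∈ ⨆ i : {i : ℤ // S i}, gr i := by
  rw [mem_iSup_iff_gradedMap h] at hv ⊢
  rw [gradedMap_gradedMap, mul_comm, ← gradedMap_gradedMap, hv]

theorem gradedMap_congr_of_mem_iSup (S : ℤ → Prop) [DecidablePred S] {w w' : ℤ → ℝ}
    (hw : ∀ i, S i → w i = w' i) {v : V} (hv : v ∈ ⨆ i : {i : ℤ // S i}, gr i) :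
    gradedMap h w v = gradedMap h w' v := by
  rw [mem_iSup_iff_gradedMap h] at hv
  rw [← hv, gradedMap_gradedMap, gradedMap_gradedMap]
  congr 2
  ext i
  by_cases hi : S i
  · simp [hi, hw i hi]
  · simp [hi]

/-- Outside S the weights can be inverted: 1 = 1_S + (1_{Sᶜ} w⁻¹) w, and the last summand kills v
because w v has no components outside S. -/
theorem mem_iSup_of_gradedMap_mem (S : ℤ → Prop) [DecidablePred S] {w : ℤ → ℝ}
    (hw : ∀ i, ¬ S i → w i ≠ 0) {v : V} (hv : gradedMap h w v ∈ ⨆ i : {i : ℤ // S i}, gr i) :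
    v ∈ ⨆ i : {i : ℤ // S i}, gr i := by
  rw [mem_iSup_iff_gradedMap h] at hv ⊢
  have h1 := congrArg (gradedMap h fun i => if S i then 0 else (w i)⁻¹) hv
  have h2 := gradedMap_one h v
  have h3 : (1 : ℤ → ℝ) = (fun i => if S i then 1 else 0) +
      (fun i => if S i then 0 else (w i)⁻¹) * w := by
    ext i
    by_cases hi : S i
    · simp [hi]
    · simp [hi, hw i hi]
  rw [h3, gradedMap_add, ← gradedMap_gradedMap h _ w, ← h1, gradedMap_gradedMap] at h2
  have h4 : ((fun i => if S i then 0 else (w i)⁻¹) * fun i => if S i then 1 else 0 : ℤ → ℝ) =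
      0 := by
    ext i; by_cases hi : S i <;> simp [hi]
  rw [h4] at h2
  have h5 : gradedMap h 0 (gradedMap h w v) = 0 := by
    have := gradedMap_add h 0 0 (gradedMap h w v)
    simpa using this
  rwa [h5, add_zero] at h2

end Grading

/-! ### The grading element. -/

section GradedLieAlgebra

variable {L : Type*} [LieRing L] [LieAlgebra ℝ L] {gr : ℤ → Submodule ℝ L}
  (h : DirectSum.IsInternal gr)
  (hlie : ∀ (i j : ℤ) (X Y : L), X ∈ gr i → Y ∈ gr j → ⁅X, Y⁆ ∈ gr (i + j))

include hlie in
theorem gradedMap_lie_of_add {w : ℤ → ℝ} (hw : ∀ i j, w (i + j) = w i + w j) (X Y : L) :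
    gradedMap h w ⁅X, Y⁆ = ⁅gradedMap h w X, Y⁆ + ⁅X, gradedMap h w Y⁆ := by
  induction X using induction_of_isInternal h with
  | mem i X hX =>
    induction Y using induction_of_isInternal h with
    | mem j Y hY =>
      simp [gradedMap_of_mem h _ (hlie i j X Y hX hY), gradedMap_of_mem h _ hX,
        gradedMap_of_mem h _ hY, hw, add_smul]
    | zero => simp
    | add Y Y' h1 h2 => simp only [lie_add, map_add, h1, h2]; abel
  | zero => simp
  | add X X' h1 h2 => simp only [add_lie, map_add, h1, h2]; abel

include hlie in
theorem gradedMap_lie_of_mul {w : ℤ → ℝ} (hw : ∀ i j, w (i + j) = w i * w j) (X Y : L) :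
    gradedMap h w ⁅X, Y⁆ = ⁅gradedMap h w X, gradedMap h w Y⁆ := by
  induction X using induction_of_isInternal h with
  | mem i X hX =>
    induction Y using induction_of_isInternal h with
    | mem j Y hY =>
      simp [gradedMap_of_mem h _ (hlie i j X Y hX hY), gradedMap_of_mem h _ hX,
        gradedMap_of_mem h _ hY, hw, smul_smul, mul_comm]
    | zero => simp
    | add Y Y' h1 h2 => simp only [lie_add, map_add, h1, h2]
  | zero => simp
  | add X X' h1 h2 => simp only [add_lie, map_add, h1, h2]

include hlie in
/-- The grading of a semisimple Lie algebra is given by the adjoint action of a grading element. -/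
theorem exists_gradingElement [FiniteDimensional ℝ L] [LieAlgebra.IsSemisimple ℝ L] :
    ∃ E₀ ∈ ⨆ i : {i : ℤ // i = 0}, gr i, ∀ X, ⁅E₀, X⁆ = gradedMap h (fun i => (i : ℝ)) X := by
  -- Multiplication by the degree is a derivation, hence inner. Its generator has degree 0 because
  -- [E₀, E₀] = 0 and every other degree is a nonzero weight.
  let D : LieDerivation ℝ L L :=
    { toLinearMap := gradedMap h (fun i => (i : ℝ))
      leibniz' := fun X Y => by
        rw [gradedMap_lie_of_add h hlie (by simp), ← lie_skew (gradedMap h _ X) Y]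
        abel }
  obtain ⟨E₀, hE₀⟩ := LieDerivation.IsKilling.exists_eq_ad D
  have hD (X : L) : ⁅E₀, X⁆ = gradedMap h (fun i => (i : ℝ)) X :=
    (LieDerivation.ad_apply_apply ℝ L E₀ X).symm.trans
      (congrArg (fun D : LieDerivation ℝ L L => D X) hE₀)
  refine ⟨E₀, ?_, hD⟩
  refine mem_iSup_of_gradedMap_mem h _ (w := fun i => (i : ℝ)) (by simp) ?_
  rw [← hD, lie_self]
  exact zero_mem _

/-- The nonnegative part of a graded semisimple Lie algebra is its own normaliser. -/
theorem mem_nonneg_of_lie_mem {E₀ : L} (hE₀ : E₀ ∈ ⨆ i : {i : ℤ // i = 0}, gr i)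
    (hD : ∀ X, ⁅E₀, X⁆ = gradedMap h (fun i => (i : ℝ)) X) {X : L}
    (hX : ∀ Y ∈ ⨆ i : {i : ℤ // 0 ≤ i}, gr i, ⁅X, Y⁆ ∈ ⨆ i : {i : ℤ // 0 ≤ i}, gr i) :
    X ∈ ⨆ i : {i : ℤ // 0 ≤ i}, gr i := by
  refine mem_iSup_of_gradedMap_mem h _ (w := fun i => (i : ℝ)) ?_ ?_
  · intro i hi
    have : i ≠ 0 := by omega
    exact_mod_cast this
  -- It suffices to normalise E₀ alone: [E₀, X] in 𝔭 determines the negative components of X.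
  · rw [← hD, ← lie_skew]
    refine neg_mem (hX E₀ ?_)
    have : (⨆ i : {i : ℤ // i = 0}, gr i) ≤ ⨆ i : {i : ℤ // 0 ≤ i}, gr i :=
      iSup_le fun i => le_iSup (fun i : {i : ℤ // 0 ≤ i} => gr i) ⟨i, i.2.ge⟩
    exact this hE₀

/-- The bracket of sums of components lies in a sum of components, according to the degrees. -/
theorem lie_mem_iSup {S S' S'' : ℤ → Prop}
    (hlie : ∀ (i j : ℤ) (X Y : L), X ∈ gr i → Y ∈ gr j → ⁅X, Y⁆ ∈ gr (i + j))
    (hS : ∀ i j, S i → S' j → S'' (i + j)) {X Y : L}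
    (hX : X ∈ ⨆ i : {i : ℤ // S i}, gr i) (hY : Y ∈ ⨆ i : {i : ℤ // S' i}, gr i) :
    ⁅X, Y⁆ ∈ ⨆ i : {i : ℤ // S'' i}, gr i := by
  induction hX using Submodule.iSup_induction' with
  | mem i X hX =>
    induction hY using Submodule.iSup_induction' with
    | mem j Y hY =>
      exact Submodule.mem_iSup_of_mem (p := fun i : {i : ℤ // S'' i} => gr i)
        ⟨_, hS _ _ i.2 j.2⟩ (hlie _ _ _ _ hX hY)
    | zero => simp
    | add Y Y' _ _ h1 h2 => rw [lie_add]; exact add_mem h1 h2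
  | zero => simp
  | add X X' _ _ h1 h2 => rw [add_lie]; exact add_mem h1 h2

end GradedLieAlgebra

/-! ### Dilations. -/

section Dilations

variable {V : Type*} [AddCommGroup V] [Module ℝ V] {gr : ℤ → Submodule ℝ V}

/-- The dilation of a graded vector space, of weight `s⁻ⁱ` in degree `i`. -/
def dilation (h : DirectSum.IsInternal gr) (s : ℝ) : V →ₗ[ℝ] V := gradedMap h fun i => s ^ (-i)

variable (h : DirectSum.IsInternal gr)

theorem dilation_dilation_inv {s : ℝ} (hs : s ≠ 0) (v : V) : dilation h s (dilation h s⁻¹ v) =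
    v := by
  unfold dilation
  rw [gradedMap_gradedMap]
  convert gradedMap_one h v using 3
  ext i
  simp [inv_mul_cancel₀ (zpow_ne_zero i hs)]

theorem dilation_eq_self {s : ℝ} {v : V} (hv : v ∈ ⨆ i : {i : ℤ // i = 0}, gr i) :
    dilation h s v = v := by
  refine (gradedMap_congr_of_mem_iSup h (fun i => i = 0) (w' := 1) ?_ hv).trans (gradedMap_one h v)
  simp

theorem dilation_lie {L : Type*} [LieRing L] [LieAlgebra ℝ L] {gr : ℤ → Submodule ℝ L}
    (h : DirectSum.IsInternal gr)
    (hlie : ∀ (i j : ℤ) (X Y : L), X ∈ gr i → Y ∈ gr j → ⁅X, Y⁆ ∈ gr (i + j)) {s : ℝ}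
    (hs : s ≠ 0) (X Y : L) : dilation h s ⁅X, Y⁆ = ⁅dilation h s X, dilation h s Y⁆ :=
  gradedMap_lie_of_mul h hlie (fun i j => by rw [neg_add, zpow_add₀ hs]) X Y

/-- Dilations contract the negative part. -/
theorem exists_dilation_norm_le {V : Type*} [NormedAddCommGroup V] [NormedSpace ℝ V]
    [FiniteDimensional ℝ V] {gr : ℤ → Submodule ℝ V} (h : DirectSum.IsInternal gr) {k : ℕ}
    (hk : ∀ i : ℤ, (k : ℤ) < |i| → gr i = ⊥) : ∃ C > 0, ∀ s ∈ Ioc (0 : ℝ) 1,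
      ∀ v ∈ ⨆ i : {i : ℤ // i < 0}, gr i, ‖dilation h s v‖ ≤ C * s * ‖v‖ := by
  set π : ℤ → V →L[ℝ] V := fun i => LinearMap.toContinuousLinearMap (gradedMap h (Pi.single i 1))
  have hsum (w : ℤ → ℝ) (v : V) (hv : v ∈ ⨆ i : {i : ℤ // i < 0}, gr i) :
      gradedMap h w v = ∑ i ∈ Finset.Ico (-(k : ℤ)) 0, w i • π i v := by
    induction hv using Submodule.iSup_induction' with
    | mem i v hv =>
      by_cases hi : -(k : ℤ) ≤ i
      · rw [gradedMap_of_mem h _ hv, Finset.sum_eq_single (i : ℤ)]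
        · simp [π, gradedMap_of_mem h _ hv]
        · intro j _ hj
          simp [π, gradedMap_of_mem h _ hv, Pi.single_eq_of_ne (Ne.symm hj)]
        · intro hi'
          exact absurd (Finset.mem_Ico.mpr ⟨hi, i.2⟩) hi'
      · have hi2 := i.2
        have : v = 0 := by
          rw [hk i (by rw [abs_of_neg hi2]; omega)] at hv
          simpa using hv
        simp [this]
    | zero => simp
    | add v v' _ _ hv hv' => simp [hv, hv', Finset.sum_add_distrib]
  refine ⟨∑ i ∈ Finset.Ico (-(k : ℤ)) 0, ‖π i‖ + 1,
    add_pos_of_nonneg_of_pos (Finset.sum_nonneg fun _ _ => norm_nonneg _) one_pos,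
    fun s hs v hv => ?_⟩
  unfold dilation
  rw [hsum _ v hv]
  calc ‖∑ i ∈ Finset.Ico (-(k : ℤ)) 0, s ^ (-i) • π i v‖
      ≤ ∑ i ∈ Finset.Ico (-(k : ℤ)) 0, ‖π i‖ * (s * ‖v‖) := by
        refine norm_sum_le_of_le _ fun i hi => ?_
        -- In negative degree the exponent -i is at least 1, and 0 < s ≤ 1.
        have h1 : s ^ (-i) ≤ s := by
          have hi' := (Finset.mem_Ico.mp hi).2
          obtain ⟨n, hn⟩ := Int.eq_ofNat_of_zero_le (show 0 ≤ -i - 1 by omega)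
          have h2 : -i = ((n + 1 : ℕ) : ℤ) := by push_cast; omega
          rw [h2, zpow_natCast, pow_succ]
          exact mul_le_of_le_one_left hs.1.le (pow_le_one₀ hs.1.le hs.2)
        rw [norm_smul, Real.norm_of_nonneg (zpow_nonneg hs.1.le _)]
        calc s ^ (-i) * ‖π i v‖ ≤ s * (‖π i‖ * ‖v‖) := by
              gcongr
              · exact hs.1.le
              · exact (π i).le_opNorm v
          _ = _ := by ring
    _ = (∑ i ∈ Finset.Ico (-(k : ℤ)) 0, ‖π i‖) * s * ‖v‖ := by
        rw [← Finset.sum_mul]; ring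
    _ ≤ _ := by
        have := hs.1.le
        gcongr
        linarith

end Dilations


/-! ### The algebra 𝔤₋ and its identification with the Lie algebra of N. -/

namespace ParabolicType

variable {E : Type*} [NormedAddCommGroup E] [NormedSpace ℝ E] [FiniteDimensional ℝ E]
  [CompleteSpace E]
  {G : Type*} [TopologicalSpace G] [ChartedSpace E G] [Group G] [LieGroup 𝓘(ℝ, E) ∞ G]
  (T : ParabolicType E G)

instance : FiniteDimensional ℝ T.gNeg := inferInstanceAs (FiniteDimensional ℝ T.gNegModel)

instance : CompleteSpace T.gNeg := FiniteDimensional.complete ℝ T.gNeg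

/-- The grading components, as subspaces of the model space. -/
abbrev grModel : ℤ → Submodule ℝ E := T.gr

/-- The subalgebra `𝔭`, as a subspace of the model space. -/
abbrev pModel : Submodule ℝ E := T.p

omit [FiniteDimensional ℝ E] in
theorem isInternal_grModel : DirectSum.IsInternal T.grModel := T.isInternal

omit [FiniteDimensional ℝ E] in
theorem pModel_eq : T.pModel = ⨆ i : {i : ℤ // 0 ≤ i}, T.grModel i := rfl

/-- The inclusion of `𝔤₋`. -/
def incl : T.gNeg →L[ℝ] E := T.gNegModel.subtypeL

omit [FiniteDimensional ℝ E] in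
theorem incl_mem (X : T.gNeg) : T.incl X ∈ T.gNegModel := X.2

omit [FiniteDimensional ℝ E] in
theorem incl_injective : Function.Injective T.incl := Subtype.val_injective

omit [FiniteDimensional ℝ E] in
theorem exists_incl_eq {X : E} (hX : X ∈ T.gNegModel) : ∃ Y, T.incl Y = X := ⟨⟨X, hX⟩, rfl⟩

/-- The adjoint representation of `𝔤₋`. -/
def adNeg (X : T.gNeg) : T.gNeg →L[ℝ] T.gNeg :=
  ((adCLM E G (T.incl X)) ∘L T.incl).codRestrict T.gNegModel fun Y => (⁅X, Y⁆ : T.gNeg).2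

theorem incl_adNeg (X Y : T.gNeg) : T.incl (T.adNeg X Y) = adCLM E G (T.incl X) (T.incl Y) := rfl

theorem incl_opPhi (X Y : T.gNeg) :
    T.incl (opPhi (T.adNeg X) Y) = opPhi (adCLM E G (T.incl X)) (T.incl Y) :=
  opPhi_intertwine (T.incl_adNeg X) Y

/-- The dilations of `𝔤₋`. -/
def dil (s : ℝ) : T.gNeg →L[ℝ] T.gNeg :=
  ((LinearMap.toContinuousLinearMap (dilation T.isInternal_grModel s)) ∘L T.incl).codRestrict
    T.gNegModel fun X => gradedMap_mem_iSup T.isInternal_grModel (fun i => i < 0) _ X.2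

theorem dil_dil_inv {s : ℝ} (hs : s ≠ 0) (X : T.gNeg) : T.dil s (T.dil s⁻¹ X) = X :=
  T.incl_injective (dilation_dilation_inv T.isInternal_grModel hs (T.incl X))

omit [FiniteDimensional ℝ E] in
theorem dilation_bracket {s : ℝ} (hs : s ≠ 0) (X Y : E) :
    dilation T.isInternal_grModel s (bracket G X Y) =
      bracket G (dilation T.isInternal_grModel s X) (dilation T.isInternal_grModel s Y) :=
  dilation_lie T.isInternal T.lie_mem hs X Y

theorem dil_lie {s : ℝ} (hs : s ≠ 0) (X Y : T.gNeg) : T.dil s ⁅X, Y⁆ = ⁅T.dil s X, T.dil s Y⁆ :=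
  T.incl_injective (T.dilation_bracket hs (T.incl X) (T.incl Y))

theorem exists_dil_norm_le :
    ∃ C > 0, ∀ s ∈ Ioc (0 : ℝ) 1, ∀ X : T.gNeg, ‖T.dil s X‖ ≤ C * s * ‖X‖ := by
  obtain ⟨C, hC, h⟩ := exists_dilation_norm_le T.isInternal_grModel T.gr_eq_bot
  exact ⟨C, hC, fun s hs X => h s hs (T.incl X) (T.incl_mem X)⟩

section Model

variable {T}
variable {E' : Type*} [NormedAddCommGroup E'] [NormedSpace ℝ E'] [FiniteDimensional ℝ E']
  [CompleteSpace E']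
  {N : Type*} [TopologicalSpace N] [ChartedSpace E' N] [Group N] [LieGroup 𝓘(ℝ, E') ∞ N]
  (θ : T.gNeg ≃ₗ⁅ℝ⁆ GroupLieAlgebra 𝓘(ℝ, E') N)

/-- The identification of `𝔤₋` with the Lie algebra of a group, as a map to the model space. -/
def modelEquiv : T.gNeg ≃L[ℝ] E' :=
  LinearEquiv.toContinuousLinearEquiv (E := T.gNeg) (F := E')
    { toFun := fun X => θ X
      invFun := fun Y => θ.symm Y
      map_add' := fun X Y => map_add θ X Y
      map_smul' := fun c X => map_smul θ c X
      left_inv := fun X => θ.symm_apply_apply X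
      right_inv := fun Y => θ.apply_symm_apply Y }

omit [FiniteDimensional ℝ E'] in
theorem modelEquiv_lie (X Y : T.gNeg) :
    modelEquiv θ ⁅X, Y⁆ = bracket N (modelEquiv θ X) (modelEquiv θ Y) :=
  LieHom.map_lie θ.toLieHom X Y

omit [FiniteDimensional ℝ E'] in
theorem modelEquiv_symm_bracket (X Y : E') :
    (modelEquiv θ).symm (bracket N X Y) = ⁅(modelEquiv θ).symm X, (modelEquiv θ).symm Y⁆ := by
  rw [ContinuousLinearEquiv.symm_apply_eq, modelEquiv_lie]
  simp

theorem modelEquiv_opPhi (X Y : T.gNeg) :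
    modelEquiv θ (opPhi (T.adNeg X) Y) = opPhi (adCLM E' N (modelEquiv θ X)) (modelEquiv θ Y) :=
  opPhi_intertwine (L := (modelEquiv θ : T.gNeg →L[ℝ] E')) (fun Y => modelEquiv_lie θ X Y) Y

-- Dilations of 𝔤₋ transported by θ; A absorbs the distortion of norms by the identification and the
-- constant C.
omit [FiniteDimensional ℝ E'] in
include θ in
theorem hasContractions : HasContractions E' N := by
  intro ε hε
  obtain ⟨C, hC, hdil⟩ := T.exists_dil_norm_le
  set e := modelEquiv θ with he
  set A : ℝ := ‖(e : T.gNeg →L[ℝ] E')‖ * C * ‖(e.symm : E' →L[ℝ] T.gNeg)‖ + 1 with hA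
  have hA0 : 0 < A := by positivity
  set s : ℝ := min 1 (ε / A) with hs
  have hs0 : 0 < s := by positivity
  have hsA : A * s ≤ ε := by
    calc A * s ≤ A * (ε / A) := by gcongr; exact min_le_right _ _
      _ = ε := by field_simp
  have hinv : T.dil s⁻¹ ∘L T.dil s = .id ℝ T.gNeg := by
    ext1 X
    have := T.dil_dil_inv (inv_ne_zero hs0.ne') X
    rwa [inv_inv] at this
  let δ : T.gNeg ≃L[ℝ] T.gNeg := ContinuousLinearEquiv.equivOfInverse (T.dil s) (T.dil s⁻¹)
    (fun X => congrArg (fun L : T.gNeg →L[ℝ] T.gNeg => L X) hinv) (T.dil_dil_inv hs0.ne')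
  refine ⟨(e.symm.trans δ).trans e, fun X Y => ?_, fun v => ?_⟩
  · simp only [ContinuousLinearEquiv.trans_apply]
    rw [he, modelEquiv_symm_bracket, ← modelEquiv_lie]
    congr 1
    exact T.dil_lie hs0.ne' _ _
  · calc ‖e (T.dil s (e.symm v))‖ ≤ ‖(e : T.gNeg →L[ℝ] E')‖ * ‖T.dil s (e.symm v)‖ :=
          (e : T.gNeg →L[ℝ] E').le_opNorm _
      _ ≤ ‖(e : T.gNeg →L[ℝ] E')‖ * (C * s * (‖(e.symm : E' →L[ℝ] T.gNeg)‖ * ‖v‖)) := by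
          gcongr
          refine (hdil s ⟨hs0, min_le_left _ _⟩ _).trans ?_
          gcongr
          exact (e.symm : E' →L[ℝ] T.gNeg).le_opNorm v
      _ = (A - 1) * s * ‖v‖ := by rw [hA]; ring
      _ ≤ ε * ‖v‖ := by
          gcongr
          linarith

-- The contraction argument is carried out on the Lie algebra of N and transported back, since 𝔤
-- itself is not contracted by dilations.
include θ in
theorem bijective_opPhi_adNeg (X : T.gNeg) : Function.Bijective (opPhi (T.adNeg X)) := by
  set e := modelEquiv θ
  have : (opPhi (T.adNeg X) : T.gNeg → T.gNeg) = e.symm ∘ opPhi (adCLM E' N (e X)) ∘ e := by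
    ext Y : 1
    simp only [Function.comp_apply]
    rw [← modelEquiv_opPhi, ContinuousLinearEquiv.symm_apply_apply]
  rw [this]
  exact e.symm.bijective.comp (((hasContractions θ).bijective_opPhi (e X)).comp e.bijective)

end Model

end ParabolicType


/-! ### Operator exponentials applied to a vector: invariant subspaces and local injectivity. -/

section OperatorExponential

variable {V : Type*} [NormedAddCommGroup V] [NormedSpace ℝ V] [CompleteSpace V]

omit [CompleteSpace V] in
theorem pow_apply_mem {W : Submodule ℝ V} {a : V →L[ℝ] V} (ha : ∀ v ∈ W, a v ∈ W) (n : ℕ) {v : V}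
    (hv : v ∈ W) : (a ^ n) v ∈ W := by
  induction n with
  | zero => simpa using hv
  | succ n ih => rw [pow_succ', mul_apply_eq_comp]; exact ha _ ih

/-- Every term of the series beyond the zeroth lies in W. The vector v itself need not: the lemma
serves E₀ and W = 𝔤₋. -/
theorem opExp_apply_sub_mem {W : Submodule ℝ V} (hW : IsClosed (W : Set V)) {a : V →L[ℝ] V}
    (ha : ∀ v ∈ W, a v ∈ W) {v : V} (hv : a v ∈ W) : opExp a v - v ∈ W := by
  have h := (hasSum_nat_add_iff' 1).mpr (hasSum_opExp_apply a v)
  have h0 : ∑ i ∈ Finset.range 1, ((i.factorial : ℝ)⁻¹) • (a ^ i) v = v := by simp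
  rw [h0] at h
  refine hW.mem_of_tendsto h (Filter.Eventually.of_forall fun s => sum_mem fun n _ => ?_)
  refine W.smul_mem _ ?_
  rw [pow_succ, mul_apply_eq_comp]
  exact pow_apply_mem ha n hv

theorem opExp_apply_mem {W : Submodule ℝ V} (hW : IsClosed (W : Set V)) {a : V →L[ℝ] V}
    (ha : ∀ v ∈ W, a v ∈ W) {v : V} (hv : v ∈ W) : opExp a v ∈ W := by
  have := add_mem (opExp_apply_sub_mem hW ha (ha v hv)) hv
  rwa [sub_add_cancel] at this

/-- The differential of X ↦ P(e^{A X}v) at 0 is X ↦ P(A X v), an injective endomorphism of a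
finite-dimensional space. -/
theorem exists_nhds_injOn_opExp {W : Type*} [NormedAddCommGroup W] [NormedSpace ℝ W]
    [FiniteDimensional ℝ W] [CompleteSpace W] (A : W →L[ℝ] V →L[ℝ] V) (P : V →L[ℝ] W) (v : V)
    (hinj : ∀ X, P (A X v) = 0 → X = 0) :
    ∃ U ∈ nhds (0 : W), InjOn (fun X => opExp (A X) v) U := by
  let R : (V →L[ℝ] V) →L[ℝ] W := P ∘L ContinuousLinearMap.apply ℝ V v
  have hexp : HasStrictFDerivAt (opExp : (V →L[ℝ] V) → (V →L[ℝ] V)) (.id ℝ _) (A 0) := by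
    rw [map_zero]
    exact hasStrictFDerivAt_exp_zero (𝕂 := ℝ) (𝔸 := V →L[ℝ] V)
  have h2 : HasStrictFDerivAt (fun X => opExp (A X)) (ContinuousLinearMap.id ℝ _ ∘L A) 0 :=
    hexp.comp (0 : W) A.hasStrictFDerivAt
  have h3 : HasStrictFDerivAt (fun X => R (opExp (A X))) (R ∘L ContinuousLinearMap.id ℝ _ ∘L A) 0 :=
    R.hasStrictFDerivAt.comp (0 : W) h2
  let e : W ≃L[ℝ] W := (LinearEquiv.ofInjectiveEndo (R ∘L ContinuousLinearMap.id ℝ _ ∘L A :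
    W →L[ℝ] W).toLinearMap ((injective_iff_map_eq_zero _).mpr hinj)).toContinuousLinearEquiv
  have he : HasStrictFDerivAt (fun X => R (opExp (A X))) (e : W →L[ℝ] W) 0 := h3
  refine ⟨(he.toOpenPartialHomeomorph _).source, (he.toOpenPartialHomeomorph _).open_source.mem_nhds
    he.mem_toOpenPartialHomeomorph_source, fun X hX Y hY hXY => ?_⟩
  exact (he.toOpenPartialHomeomorph _).injOn hX hY (congrArg P hXY)

end OperatorExponential

/-! ### Injectivity of φ. -/

namespace ParabolicType

variable {E : Type*} [NormedAddCommGroup E] [NormedSpace ℝ E] [FiniteDimensional ℝ E]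
  [CompleteSpace E]
  {G : Type*} [TopologicalSpace G] [ChartedSpace E G] [Group G] [LieGroup 𝓘(ℝ, E) ∞ G]
  (T : ParabolicType E G)

/-- The projection onto `𝔤₋` along `𝔭`. -/
def prNeg : E →L[ℝ] T.gNeg :=
  (LinearMap.toContinuousLinearMap
    (gradedMap T.isInternal_grModel fun i => if i < 0 then 1 else 0)).codRestrict
    T.gNegModel fun X => gradedMap_indicator_mem T.isInternal_grModel (fun i => i < 0) X

theorem incl_prNeg (X : E) : T.incl (T.prNeg X) =
    gradedMap T.isInternal_grModel (fun i => if i < 0 then 1 else 0) X := rfl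

theorem prNeg_incl (X : T.gNeg) : T.prNeg (T.incl X) = X :=
  T.incl_injective ((mem_iSup_iff_gradedMap T.isInternal_grModel (fun i => i < 0)).mp X.2)

theorem prNeg_eq_zero_iff {X : E} : T.prNeg X = 0 ↔ X ∈ T.pModel := by
  rw [← T.incl_injective.eq_iff, incl_prNeg, map_zero]
  have h1 := gradedMap_one T.isInternal_grModel X
  have h2 : (1 : ℤ → ℝ) = (fun i => if i < 0 then 1 else 0) + fun i => if 0 ≤ i then 1 else 0 := by
    ext i
    by_cases hi : 0 ≤ i
    · simp [hi]
    · simp [hi, not_le.mp hi]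
  rw [h2, gradedMap_add] at h1
  rw [pModel_eq, mem_iSup_iff_gradedMap T.isInternal_grModel (fun i => 0 ≤ i)]
  constructor
  · intro h; rwa [h, zero_add] at h1
  · intro h; rwa [h, add_eq_right] at h1

theorem incl_prNeg_sub_mem (X : E) : T.incl (T.prNeg X) - X ∈ T.pModel := by
  rw [← prNeg_eq_zero_iff, map_sub, prNeg_incl, sub_self]

theorem isClosed_pModel : IsClosed (T.pModel : Set E) := T.pModel.closed_of_finiteDimensional

theorem isClosed_gNegModel : IsClosed (T.gNegModel : Set E) :=
  T.gNegModel.closed_of_finiteDimensional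

omit [FiniteDimensional ℝ E] in
theorem bracket_mem_pModel {X Y : E} (hX : X ∈ T.pModel) (hY : Y ∈ T.pModel) :
    bracket G X Y ∈ T.pModel :=
  lie_mem_iSup T.lie_mem (S := fun i => 0 ≤ i) (S' := fun i => 0 ≤ i) (S'' := fun i => 0 ≤ i)
    (fun _ _ => add_nonneg) hX hY

omit [FiniteDimensional ℝ E] in
theorem bracket_mem_gNegModel {X Y : E} (hX : X ∈ T.gNegModel) (hY : Y ∈ T.gNegModel) :
    bracket G X Y ∈ T.gNegModel := T.gNeg.lie_mem hX hY

omit [FiniteDimensional ℝ E] in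
theorem bracket_swap (X Y : E) : bracket G X Y = -bracket G Y X :=
  (lie_skew (L := GroupLieAlgebra 𝓘(ℝ, E) G) X Y).symm

/-- A grading element, whose adjoint action is multiplication by `i` in degree `i`. -/
theorem exists_gradingElement : ∃ E₀ ∈ ⨆ i : {i : ℤ // i = 0}, T.grModel i,
    ∀ X : E, bracket G E₀ X = gradedMap T.isInternal_grModel (fun i => (i : ℝ)) X := by
  have := T.semisimple
  have : FiniteDimensional ℝ (GroupLieAlgebra 𝓘(ℝ, E) G) := inferInstanceAs (FiniteDimensional ℝ E)
  exact ParabolicGeometry.exists_gradingElement T.isInternal T.lie_mem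

/-- The subalgebra `𝔭` is its own normaliser. -/
theorem mem_pModel_of_bracket_mem {X : E} (hX : ∀ Y ∈ T.pModel, bracket G X Y ∈ T.pModel) :
    X ∈ T.pModel := by
  obtain ⟨E₀, hE₀, hD⟩ := T.exists_gradingElement
  exact mem_nonneg_of_lie_mem T.isInternal hE₀ hD hX

/-- The linearisation X ↦ [X, E₀] multiplies degree i by -i, which has no kernel on 𝔤₋. -/
theorem exists_nhds_injOn {E₀ : E}
    (hD : ∀ X : E, bracket G E₀ X = gradedMap T.isInternal_grModel (fun i => (i : ℝ)) X) :
    ∃ U ∈ nhds (0 : T.gNeg), InjOn (fun X => opExp (adCLM E G (T.incl X)) E₀) U := by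
  refine exists_nhds_injOn_opExp ((adCLM E G) ∘L T.incl) T.prNeg E₀ fun X hX => ?_
  have h1 : bracket G (T.incl X) E₀ ∈ T.pModel := T.prNeg_eq_zero_iff.mp hX
  rw [bracket_swap, hD, neg_mem_iff, pModel_eq] at h1
  have h2 : T.incl X ∈ T.pModel := by
    refine mem_iSup_of_gradedMap_mem T.isInternal_grModel (fun i => 0 ≤ i) ?_ h1
    intro i hi
    have : i ≠ 0 := by omega
    exact_mod_cast this
  rw [← T.prNeg_incl X]
  exact T.prNeg_eq_zero_iff.mpr h2

/-- Dilations fix E₀ and carry e^{ad X}E₀ to e^{ad δX}E₀, so an equality for X and Y moves into the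
neighbourhood of 0 where injectivity is known. -/
theorem opExp_ad_injective {E₀ : E} (hE₀ : E₀ ∈ ⨆ i : {i : ℤ // i = 0}, T.grModel i)
    (hD : ∀ X : E, bracket G E₀ X = gradedMap T.isInternal_grModel (fun i => (i : ℝ)) X) :
    Function.Injective fun X => opExp (adCLM E G (T.incl X)) E₀ := by
  intro X Y hXY
  obtain ⟨U, hU, hinj⟩ := T.exists_nhds_injOn hD
  obtain ⟨r, hr, hball⟩ := Metric.mem_nhds_iff.mp hU
  obtain ⟨C, hC, hdil⟩ := T.exists_dil_norm_le
  set A : ℝ := C * (‖X‖ + ‖Y‖) + 1 with hA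
  have hA0 : 0 < A := by positivity
  set s : ℝ := min 1 (r / (2 * A)) with hs
  have hs0 : 0 < s := by positivity
  have hsA : A * s < r := by
    calc A * s ≤ A * (r / (2 * A)) := by gcongr; exact min_le_right _ _
      _ = r / 2 := by field_simp
      _ < r := by linarith
  have hmem (Z : T.gNeg) (hZ : ‖Z‖ ≤ ‖X‖ + ‖Y‖) : T.dil s Z ∈ U := by
    refine hball ?_
    rw [mem_ball_zero_iff]
    calc ‖T.dil s Z‖ ≤ C * s * ‖Z‖ := hdil s ⟨hs0, min_le_left _ _⟩ Z
      _ ≤ C * s * (‖X‖ + ‖Y‖) := by gcongr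
      _ = (A - 1) * s := by rw [hA]; ring
      _ < r := by linarith
  have hδ (Z : T.gNeg) : dilation T.isInternal_grModel s (opExp (adCLM E G (T.incl Z)) E₀) =
      opExp (adCLM E G (T.incl (T.dil s Z))) E₀ := by
    have := opExp_intertwine
      (L := LinearMap.toContinuousLinearMap (dilation T.isInternal_grModel s))
      (a := adCLM E G (T.incl Z)) (a' := adCLM E G (T.incl (T.dil s Z)))
      (fun v => T.dilation_bracket hs0.ne' (T.incl Z) v) E₀
    refine this.trans ?_
    congr 1
    exact dilation_eq_self T.isInternal_grModel hE₀
  have h1 : T.dil s X = T.dil s Y := by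
    refine hinj (hmem X (by simp)) (hmem Y (by simp)) ?_
    change opExp _ _ = opExp _ _
    rw [← hδ, ← hδ]
    exact congrArg (dilation T.isInternal_grModel s) hXY
  have h2 (Z : T.gNeg) : T.dil s⁻¹ (T.dil s Z) = Z := by
    have := T.dil_dil_inv (inv_ne_zero hs0.ne') Z
    rwa [inv_inv] at this
  rw [← h2 X, ← h2 Y, h1]

variable [T2Space G]

theorem adjointAction_expMap_one (X Y : E) :
    adjointAction (expMap X : G) Y = opExp (adCLM E G X) Y := by
  have := adjointAction_expMap (G := G) X Y 1
  simpa only [one_smul] using this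

omit [T2Space G] [FiniteDimensional ℝ E] in
theorem adjointAction_mem_of_mem_P {g : G} (hg : g ∈ T.P) {Y : E} (hY : Y ∈ T.pModel) :
    adjointAction g Y ∈ T.pModel := by
  have h : T.p.map (Ad (E := E) g).toLinearMap = T.p := T.P_subset hg
  have h1 : (Ad (E := E) g).toLinearMap Y ∈ T.p := h ▸ Submodule.mem_map_of_mem hY
  exact h1

/-- The exponential coordinates of `𝔤₋` separate the cosets of `P`. -/
theorem injective_normalMap : Function.Injective T.normalMap := by
  intro X X' h
  obtain ⟨E₀, hE₀, hD⟩ := T.exists_gradingElement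
  refine T.opExp_ad_injective hE₀ hD ?_
  have hP : (expMap (T.incl X') : G)⁻¹ * expMap (T.incl X) ∈ T.P := QuotientGroup.eq.mp h.symm
  have hE₀p : E₀ ∈ T.pModel := by
    have : (⨆ i : {i : ℤ // i = 0}, T.grModel i) ≤ ⨆ i : {i : ℤ // 0 ≤ i}, T.grModel i :=
      iSup_le fun i => le_iSup (fun i : {i : ℤ // 0 ≤ i} => T.grModel i) ⟨i, i.2.ge⟩
    exact this hE₀
  -- [Z, E₀] lies in 𝔤₋ for Z in 𝔤₋, so Ad(exp Z) moves E₀ only by elements of 𝔤₋.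
  have hneg (Z : E) (hZ : Z ∈ T.gNegModel) : adjointAction (expMap Z : G) E₀ - E₀ ∈
      T.gNegModel := by
    rw [adjointAction_expMap_one]
    refine opExp_apply_sub_mem T.isClosed_gNegModel (fun v hv => T.bracket_mem_gNegModel hZ hv) ?_
    rw [adCLM_apply, bracket_swap, hD]
    exact neg_mem (gradedMap_mem_iSup T.isInternal_grModel (fun i => i < 0) _ hZ)
  have h1 := T.adjointAction_mem_of_mem_P hP hE₀p
  rw [Ad_mul, ← expMap_neg] at h1
  have h2 :
      adjointAction (expMap (-T.incl X') : G) (adjointAction (expMap (T.incl X) : G) E₀) - E₀ ∈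
      T.gNegModel := by
    have e1 : adjointAction (expMap (-T.incl X') : G)
        (adjointAction (expMap (T.incl X) : G) E₀ - E₀) ∈ T.gNegModel := by
      rw [adjointAction_expMap_one]
      exact opExp_apply_mem T.isClosed_gNegModel
        (fun v hv => T.bracket_mem_gNegModel (neg_mem (T.incl_mem X')) hv)
        (hneg _ (T.incl_mem X))
    have e2 := add_mem e1 (hneg _ (neg_mem (T.incl_mem X')))
    rw [map_sub] at e2
    convert e2 using 1
    abel
  obtain ⟨Y, hY⟩ := T.exists_incl_eq h2
  -- The displacement of E₀ lies in 𝔤₋ by the above and in 𝔭 because P normalises 𝔭, and 𝔤₋ ∩ 𝔭 = 0.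
  have h3 : Y = 0 := by
    rw [← T.prNeg_incl Y, prNeg_eq_zero_iff, hY]
    exact sub_mem h1 hE₀p
  rw [h3, map_zero, eq_comm, sub_eq_zero] at hY
  have h4 := congrArg (adjointAction (expMap (T.incl X') : G)) hY
  rw [← Ad_mul, expMap_neg, mul_inv_cancel, Ad_one, adjointAction_expMap_one,
    adjointAction_expMap_one] at h4
  exact h4

end ParabolicType


/-! ### Kernels of differentials of submersions. -/

section Submersions

variable {E : Type*} [NormedAddCommGroup E] [NormedSpace ℝ E]
  {F : Type*} [NormedAddCommGroup F] [NormedSpace ℝ F]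
  {M : Type*} [TopologicalSpace M] [ChartedSpace E M]
  {M' : Type*} [TopologicalSpace M'] [ChartedSpace F M']

theorem mdifferentiable_of_mem_maximalAtlas {e : OpenPartialHomeomorph M E}
    (he : e ∈ IsManifold.maximalAtlas 𝓘(ℝ, E) ∞ M) :
    e.MDifferentiable 𝓘(ℝ, E) 𝓘(ℝ, E) :=
  ⟨(contMDiffOn_of_mem_maximalAtlas he).mdifferentiableOn (by simp),
    (contMDiffOn_symm_of_mem_maximalAtlas he).mdifferentiableOn (by simp)⟩

/-- The differential of a submersion is surjective, and its kernel consists of velocities of curves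
in the fibre. -/
theorem surjective_mfderiv_and_exists_curve {f : M → M'} {x : M}
    (hf : Manifold.IsSubmersionAt 𝓘(ℝ, E) 𝓘(ℝ, F) ∞ f x) :
    (∀ w : F, ∃ v : E, mfderiv 𝓘(ℝ, E) 𝓘(ℝ, F) f x v = w) ∧
    ∀ v : E, (mfderiv 𝓘(ℝ, E) 𝓘(ℝ, F) f x v : F) = 0 → ∃ c : ℝ → M, c 0 = x ∧
      HasMFDerivAt 𝓘(ℝ, ℝ) 𝓘(ℝ, E) c 0 (ContinuousLinearMap.smulRight (1 : ℝ →L[ℝ] ℝ) (v : E)) ∧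
      ∀ᶠ t in nhds 0, f (c t) = f x := by
  set φ := hf.domChart
  set ψ := hf.codChart
  have hφ : φ.MDifferentiable 𝓘(ℝ, E) 𝓘(ℝ, E) :=
      mdifferentiable_of_mem_maximalAtlas hf.domChart_mem_maximalAtlas
  have hψ : ψ.MDifferentiable 𝓘(ℝ, F) 𝓘(ℝ, F) :=
      mdifferentiable_of_mem_maximalAtlas hf.codChart_mem_maximalAtlas
  have hx : x ∈ φ.source := hf.mem_domChart_source
  have hfx : f x ∈ ψ.source := hf.mem_codChart_source
  -- In submersion charts f is the linear projection L, so a kernel vector is the velocity of a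
  -- straight line in the chart along which f is constant.
  let L : E →L[ℝ] F := .fst ℝ F hf.complement ∘L (hf.equiv : E →L[ℝ] F × hf.complement)
  have hw (y : E) (hy : y ∈ φ.target) : ψ (f (φ.symm y)) = L y := by
    have := hf.writtenInCharts (show y ∈ (hf.domChart.extend 𝓘(ℝ, E)).target by simpa using hy)
    simp only [Function.comp_apply, OpenPartialHomeomorph.extend_coe,
      OpenPartialHomeomorph.extend_coe_symm, modelWithCornersSelf_coe,
      modelWithCornersSelf_coe_symm, id_eq] at this
    exact this
  have hfmd : MDifferentiableAt 𝓘(ℝ, E) 𝓘(ℝ, F) f x := hf.contMDiffAt.mdifferentiableAt (by simp)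
  have key (v : E) : (mfderiv 𝓘(ℝ, F) 𝓘(ℝ, F) ψ (f x) (mfderiv 𝓘(ℝ, E) 𝓘(ℝ, F) f x v : F) : F) =
      L (mfderiv 𝓘(ℝ, E) 𝓘(ℝ, E) φ x v) := by
    have h1 := mfderiv_comp_eq_apply (hψ.mdifferentiableAt hfx) hfmd rfl v
    have h2 := mfderiv_comp_eq_apply (L.differentiableAt.mdifferentiableAt)
      (hφ.mdifferentiableAt hx) rfl v
    have h3 : ψ ∘ f =ᶠ[nhds x] L ∘ φ := by
      filter_upwards [φ.open_source.mem_nhds hx] with y hy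
      simp only [Function.comp_apply]
      rw [← hw _ (φ.map_source hy), φ.left_inv hy]
    rw [h3.mfderiv_eq] at h1
    have h4 : (mfderiv 𝓘(ℝ, E) 𝓘(ℝ, F) L (φ x) : E →L[ℝ] F) = L := by
      rw [mfderiv_eq_fderiv]; exact L.fderiv
    exact h1.symm.trans (h2.trans (congrArg (fun L : E →L[ℝ] F => L _) h4))
  have hφ1 (v : E) : (mfderiv 𝓘(ℝ, E) 𝓘(ℝ, E) φ.symm (φ x)
      (mfderiv 𝓘(ℝ, E) 𝓘(ℝ, E) φ x v : E) : E) = v :=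
    congrArg (fun A : E →L[ℝ] E => A v) (hφ.symm_comp_deriv hx)
  have hφ2 (v : E) : (mfderiv 𝓘(ℝ, E) 𝓘(ℝ, E) φ x
      (mfderiv 𝓘(ℝ, E) 𝓘(ℝ, E) φ.symm (φ x) v : E) : E) = v := by
    have := hφ.comp_symm_deriv (φ.map_source hx)
    rw [φ.left_inv hx] at this
    exact congrArg (fun A : E →L[ℝ] E => A v) this
  have hψ1 (v : F) : (mfderiv 𝓘(ℝ, F) 𝓘(ℝ, F) ψ.symm (ψ (f x))
      (mfderiv 𝓘(ℝ, F) 𝓘(ℝ, F) ψ (f x) v : F) : F) = v :=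
    congrArg (fun A : F →L[ℝ] F => A v) (hψ.symm_comp_deriv hfx)
  constructor
  · intro w
    refine ⟨mfderiv 𝓘(ℝ, E) 𝓘(ℝ, E) φ.symm (φ x)
      (hf.equiv.symm (mfderiv 𝓘(ℝ, F) 𝓘(ℝ, F) ψ (f x) w, 0) : E), ?_⟩
    refine (hψ1 _).symm.trans (Eq.trans ?_ (hψ1 w))
    refine congrArg (fun v : F => mfderiv 𝓘(ℝ, F) 𝓘(ℝ, F) ψ.symm (ψ (f x)) v) ?_
    refine (key _).trans ((congrArg L (hφ2 _)).trans ?_)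
    exact congrArg Prod.fst (hf.equiv.apply_symm_apply (_, 0))
  · intro v hv
    have hLv : L (mfderiv 𝓘(ℝ, E) 𝓘(ℝ, E) φ x v) = 0 := by
      refine (key v).symm.trans ?_
      refine (congrArg (fun v : F => mfderiv 𝓘(ℝ, F) 𝓘(ℝ, F) ψ (f x) v) hv).trans ?_
      exact map_zero _
    set A : E := mfderiv 𝓘(ℝ, E) 𝓘(ℝ, E) φ x v with hA
    have hline : HasDerivAt (fun t : ℝ => φ x + t • A) A 0 := by
      have := (((hasDerivAt_id (0 : ℝ)).smul_const A).const_add (φ x))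
      rwa [one_smul] at this
    have hmem : ∀ᶠ t : ℝ in nhds 0, φ x + t • A ∈ φ.target := by
      refine hline.continuousAt.eventually_mem (φ.open_target.mem_nhds ?_)
      rw [zero_smul, add_zero]
      exact φ.map_source hx
    refine ⟨fun t => φ.symm (φ x + t • A), ?_, ?_, ?_⟩
    · simp only [zero_smul, add_zero, φ.left_inv hx]
    · have h1 : MDifferentiableAt 𝓘(ℝ, E) 𝓘(ℝ, E) φ.symm (φ x + (0 : ℝ) • A) := by
        rw [zero_smul, add_zero]
        exact hφ.mdifferentiableAt_symm (φ.map_source hx)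
      have h2 := HasMFDerivAt.comp (0 : ℝ) (f := fun t : ℝ => φ x + t • A) h1.hasMFDerivAt
        hline.hasFDerivAt.hasMFDerivAt
      refine h2.congr_mfderiv ?_
      ext
      change (mfderiv 𝓘(ℝ, E) 𝓘(ℝ, E) φ.symm (φ x + (0 : ℝ) • A) ((1 : ℝ) • A : E) : E) =
        (1 : ℝ) • v
      rw [zero_smul, add_zero, one_smul, one_smul]
      exact hφ1 v
    · filter_upwards [hmem] with t ht
      refine ψ.injOn (hf.source_subset_preimage_source (φ.map_target ht)) hfx ?_
      rw [hw _ ht, map_add, map_smul, hLv, smul_zero, add_zero, ← hw _ (φ.map_source hx),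
        φ.left_inv hx]

end Submersions

/-! ### The differentials of the projection to G/P and of φ. -/

namespace ParabolicType

variable {E : Type*} [NormedAddCommGroup E] [NormedSpace ℝ E] [FiniteDimensional ℝ E]
  [CompleteSpace E]
  {G : Type*} [TopologicalSpace G] [ChartedSpace E G] [Group G] [LieGroup 𝓘(ℝ, E) ∞ G]
  [T2Space G] (T : ParabolicType E G)

theorem expMap_mem_adNormalizer {W : E} (hW : W ∈ T.pModel) :
    (expMap W : G) ∈ adNormalizer (E := E) (T.p) := by
  have h (V : E) (hV : V ∈ T.pModel) : ∀ Y ∈ T.pModel, adjointAction (expMap V : G) Y ∈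
      T.pModel := by
    intro Y hY
    rw [adjointAction_expMap_one]
    exact opExp_apply_mem T.isClosed_pModel (fun v hv => T.bracket_mem_pModel hV hv) hY
  refine le_antisymm ?_ ?_
  · rintro _ ⟨Y, hY, rfl⟩
    exact h W hW Y hY
  · intro Y hY
    refine ⟨adjointAction (E := E) (expMap (-W) : G) Y, h (-W) (neg_mem hW) Y hY, ?_⟩
    refine (Ad_mul (E := E) (expMap W : G) (expMap (-W)) Y).symm.trans ?_
    rw [expMap_neg, mul_inv_cancel]
    exact Ad_one (E := E) Y

/-- The one-parameter subgroup is a connected subset of the normaliser through 1, hence lies in its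
identity component. -/
theorem expMap_mem_P {W : E} (hW : W ∈ T.pModel) : (expMap W : G) ∈ T.P := by
  have hc : Continuous fun t : ℝ => (expMap (t • W) : G) :=
    contMDiff_expMap.continuous.comp (continuous_id.smul continuous_const)
  have hsub : range (fun t : ℝ => (expMap (t • W) : G)) ⊆
      connectedComponentIn (adNormalizer (E := E) T.p) (1 : G) := by
    refine (isPreconnected_range hc).subset_connectedComponentIn ⟨0, ?_⟩ ?_
    · simp only [zero_smul, expMap_zero]
    · rintro _ ⟨t, rfl⟩
      exact T.expMap_mem_adNormalizer (T.pModel.smul_mem t hW)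
  exact T.subset_P (hsub ⟨1, by simp only [one_smul]⟩)

variable {F : Type*} [NormedAddCommGroup F] [NormedSpace ℝ F] [ChartedSpace F (G ⧸ T.P)]

/-- The differential of the projection to `G/P` on the left invariant field generated by `W`. -/
def projDeriv (F : Type*) [NormedAddCommGroup F] [NormedSpace ℝ F] [ChartedSpace F (G ⧸ T.P)]
    (u : G) (W : E) : F :=
  mfderiv 𝓘(ℝ, E) 𝓘(ℝ, F) (fun g : G => (g : G ⧸ T.P)) u (invField (E := E) W u)

omit [FiniteDimensional ℝ E] [T2Space G] in
theorem projDeriv_sub (u : G) (W V : E) :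
    T.projDeriv F u (W - V) = T.projDeriv F u W - T.projDeriv F u V := by
  have h : invField (W - V) u = invField W u - (invField V u : E) := by
    have := invField_add (W - V) V u
    rw [sub_add_cancel] at this
    rw [this, add_sub_cancel_right]
  unfold projDeriv
  rw [h]
  exact map_sub (mfderiv 𝓘(ℝ, E) 𝓘(ℝ, F) (fun g : G => (g : G ⧸ T.P)) u : E →L[ℝ] F) _ _

variable (hsub : Manifold.IsSubmersion 𝓘(ℝ, E) 𝓘(ℝ, F) ∞ (fun g : G => (g : G ⧸ T.P)))

include hsub

omit [FiniteDimensional ℝ E] [T2Space G] in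
theorem mdifferentiableAt_proj (u : G) :
    MDifferentiableAt 𝓘(ℝ, E) 𝓘(ℝ, F) (fun g : G => (g : G ⧸ T.P)) u :=
  (hsub.isSubmersionAt u).contMDiffAt.mdifferentiableAt (by simp)

omit [FiniteDimensional ℝ E] [T2Space G] in
/-- The derivative of a projected curve. -/
theorem HasVelocity.hasMFDerivAt_proj {c : ℝ → G} {W : E} {t : ℝ} (hc : HasVelocity c W t) :
    HasMFDerivAt 𝓘(ℝ, ℝ) 𝓘(ℝ, F) (fun s => (c s : G ⧸ T.P)) t
      (ContinuousLinearMap.smulRight (1 : ℝ →L[ℝ] ℝ) (T.projDeriv F (c t) W)) := by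
  have h := HasMFDerivAt.comp t (T.mdifferentiableAt_proj hsub (c t)).hasMFDerivAt hc
  refine h.congr_mfderiv ?_
  ext
  change (mfderiv 𝓘(ℝ, E) 𝓘(ℝ, F) (fun g : G => (g : G ⧸ T.P)) (c t)
    ((1 : ℝ) • invField W (c t) : E) : F) = (1 : ℝ) • (_ : F)
  rw [one_smul, one_smul]
  rfl

/-- The kernel of the projection to `G/P` is spanned by the left invariant fields generated by
`𝔭`. -/
theorem projDeriv_eq_zero_iff {u : G} {W : E} : T.projDeriv F u W = 0 ↔ W ∈ T.pModel := by
  constructor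
  · intro h
    -- No Lie subgroup structure on P is needed: u⁻¹c(t) stays in P and so preserves 𝔭 under Ad.
    -- Differentiating gives [W, 𝔭] ⊂ 𝔭, and 𝔭 is its own normaliser.
    obtain ⟨c, hc0, hc, hcu⟩ := (surjective_mfderiv_and_exists_curve (hsub.isSubmersionAt u)).2 _ h
    have hcW : HasVelocity c W 0 := by
      unfold HasVelocity
      rw [hc0]
      exact hc
    have ha := hcW.const_mul u⁻¹
    refine T.mem_pModel_of_bracket_mem fun Y hY => ?_
    have h1 := ha.hasDerivAt_adjointAction Y
    rw [hc0, inv_mul_cancel, Ad_one] at h1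
    have h2 := T.prNeg.hasFDerivAt.comp_hasDerivAt (0 : ℝ) h1
    have h3 : HasDerivAt (T.prNeg ∘ fun s => adjointAction (u⁻¹ * c s) Y) 0 0 := by
      refine (hasDerivAt_const (0 : ℝ) (0 : T.gNeg)).congr_of_eventuallyEq ?_
      filter_upwards [hcu] with t ht
      refine T.prNeg_eq_zero_iff.mpr (T.adjointAction_mem_of_mem_P ?_ hY)
      exact QuotientGroup.eq.mp ht.symm
    exact T.prNeg_eq_zero_iff.mp (h2.unique h3)
  · intro hW
    have h1 := HasVelocity.hasMFDerivAt_proj T hsub ((hasVelocity_expMap (G := G) W 0).const_mul u)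
    have h2 : (fun s : ℝ => ((u * expMap (s • W) : G) : G ⧸ T.P)) = fun _ => (u : G ⧸ T.P) := by
      ext s
      exact (QuotientGroup.mk_mul_of_mem u (T.expMap_mem_P (T.pModel.smul_mem s hW)))
    rw [h2] at h1
    have h3 := hasMFDerivAt_unique h1 (hasMFDerivAt_const (u : G ⧸ T.P) (0 : ℝ))
    have h4 : (1 : ℝ) • T.projDeriv F (u * expMap ((0 : ℝ) • W)) W = 0 :=
      congrArg (fun L : ℝ →L[ℝ] F => L 1) h3
    rwa [one_smul, zero_smul, expMap_zero, mul_one] at h4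

theorem projDeriv_surjective (u : G) (w : F) : ∃ Y : T.gNeg, T.projDeriv F u (T.incl Y) = w := by
  obtain ⟨v, hv⟩ := (surjective_mfderiv_and_exists_curve (hsub.isSubmersionAt u)).1 w
  obtain ⟨W, rfl⟩ := (invField_bijective (E := E) u).2 v
  refine ⟨T.prNeg W, ?_⟩
  have h := (T.projDeriv_eq_zero_iff hsub (u := u)).mpr (T.incl_prNeg_sub_mem W)
  rw [projDeriv_sub, sub_eq_zero] at h
  exact h.trans hv

theorem contMDiff_normalMap : ContMDiff 𝓘(ℝ, T.gNeg) 𝓘(ℝ, F) ∞ T.normalMap := by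
  have h1 : ContMDiff 𝓘(ℝ, E) 𝓘(ℝ, F) ∞ (fun g : G => (g : G ⧸ T.P)) := fun u =>
    (hsub.isSubmersionAt u).contMDiffAt
  exact h1.comp (contMDiff_expMap.comp T.incl.contDiff.contMDiff)

/-- The chain rule and the formula for the differential of exp; ψ(ad X) may be taken on 𝔤₋ because
the inclusion intertwines the two adjoint operators. -/
theorem mfderiv_normalMap (X V : T.gNeg) :
    (mfderiv 𝓘(ℝ, T.gNeg) 𝓘(ℝ, F) T.normalMap X V : F) =
      T.projDeriv F (T.flowMap X) (T.incl (opPhi (T.adNeg X) V)) := by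
  have hexp : MDifferentiableAt 𝓘(ℝ, E) 𝓘(ℝ, E) (expMap : E → G) (T.incl X) :=
    contMDiff_expMap.mdifferentiable (by simp) _
  have hincl : MDifferentiableAt 𝓘(ℝ, T.gNeg) 𝓘(ℝ, E) T.incl X :=
    T.incl.differentiableAt.mdifferentiableAt
  have h1 := mfderiv_comp_eq_apply (f := (expMap : E → G) ∘ T.incl)
    (T.mdifferentiableAt_proj hsub (T.flowMap X)) (hexp.comp X hincl) rfl V
  have h2 := mfderiv_comp_eq_apply hexp hincl rfl V
  have h3 : (mfderiv 𝓘(ℝ, T.gNeg) 𝓘(ℝ, E) T.incl X : T.gNeg →L[ℝ] E) = T.incl := by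
    rw [mfderiv_eq_fderiv]; exact T.incl.fderiv
  have h4 := mfderiv_expMap (G := G) (T.incl X) (T.incl V)
  rw [dexp_eq_opPhi, ← incl_opPhi] at h4
  have h5 := h2.trans ((congrArg (fun L : T.gNeg →L[ℝ] E =>
    (mfderiv 𝓘(ℝ, E) 𝓘(ℝ, E) (expMap : E → G) (T.incl X) (L V : E) : E)) h3).trans h4)
  exact h1.trans (congrArg (fun v : E =>
    (mfderiv 𝓘(ℝ, E) 𝓘(ℝ, F) (fun g : G => (g : G ⧸ T.P)) (T.flowMap X) v : F)) h5)

theorem bijective_projDeriv (u : G) :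
    Function.Bijective fun Y : T.gNeg => T.projDeriv F u (T.incl Y) := by
  refine ⟨fun Y Y' h => ?_, T.projDeriv_surjective hsub u⟩
  have h1 := sub_eq_zero.mpr h
  simp only at h1
  rw [← projDeriv_sub, projDeriv_eq_zero_iff T hsub, ← map_sub, ← prNeg_eq_zero_iff, prNeg_incl,
    sub_eq_zero] at h1
  exact h1

end ParabolicType


/-- The pullback is formed with `ContinuousLinearMap.inverse`, which is 0 for a non-invertible map;
bijectivity excludes this default value. -/
theorem eq_mpullback_iff {V F : Type*} [NormedAddCommGroup V] [NormedSpace ℝ V] [CompleteSpace V]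
    [NormedAddCommGroup F] [NormedSpace ℝ F] [CompleteSpace F] {M : Type*} [TopologicalSpace M]
    [ChartedSpace F M] {f : V → M} {x : V}
    (hb : Function.Bijective fun w : V => (mfderiv 𝓘(ℝ, V) 𝓘(ℝ, F) f x w : F))
    (s : Π y : M, TangentSpace 𝓘(ℝ, F) y) (v : V) :
    v = VectorField.mpullback 𝓘(ℝ, V) 𝓘(ℝ, F) f s x ↔
      (mfderiv 𝓘(ℝ, V) 𝓘(ℝ, F) f x v : F) = s (f x) := by
  let A : V →L[ℝ] F := mfderiv 𝓘(ℝ, V) 𝓘(ℝ, F) f x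
  let e : V ≃L[ℝ] F := ContinuousLinearEquiv.ofBijective A
    (LinearMap.ker_eq_bot.mpr hb.1) (LinearMap.range_eq_top.mpr hb.2)
  have he : A = (e : V →L[ℝ] F) := (ContinuousLinearEquiv.coe_ofBijective A _ _).symm
  have h1 : (VectorField.mpullback 𝓘(ℝ, V) 𝓘(ℝ, F) f s x : V) = e.symm (s (f x) : F) := by
    change A.inverse (s (f x) : F) = _
    rw [he, ContinuousLinearMap.inverse_equiv]
    rfl
  have h2 : (mfderiv 𝓘(ℝ, V) 𝓘(ℝ, F) f x v : F) = e v :=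
    congrArg (fun L : V →L[ℝ] F => L v) he
  rw [h1]
  constructor
  · intro h
    have h3 : v = e.symm (s (f x) : F) := h
    rw [h2, h3]
    exact e.apply_symm_apply (s (f x) : F)
  · intro h
    have h3 : e v = (s (f x) : F) := h2.symm.trans h
    exact (e.symm_apply_apply v).symm.trans (congrArg e.symm h3)

/-! ### The Carnot group: exponential map and left invariant frames. -/

namespace ParabolicType

variable {E : Type*} [NormedAddCommGroup E] [NormedSpace ℝ E] [FiniteDimensional ℝ E]
  [CompleteSpace E]
  {G : Type*} [TopologicalSpace G] [ChartedSpace E G] [Group G] [LieGroup 𝓘(ℝ, E) ∞ G]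
  [T2Space G] {T : ParabolicType E G}

section Carnot

variable {E' : Type*} [NormedAddCommGroup E'] [NormedSpace ℝ E'] [FiniteDimensional ℝ E']
  [CompleteSpace E']
  {N : Type*} [TopologicalSpace N] [ChartedSpace E' N] [Group N] [LieGroup 𝓘(ℝ, E') ∞ N]
  [T2Space N] (θ : T.gNeg ≃ₗ⁅ℝ⁆ GroupLieAlgebra 𝓘(ℝ, E') N)

omit [T2Space G] [T2Space N] [FiniteDimensional ℝ E'] in
theorem carnotExp_eq : T.carnotExp θ = (expMap : E' → N) ∘ modelEquiv θ := rfl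

-- The counterpart of `mfderiv_normalMap`, with the same operator ψ(ad X) on 𝔤₋.
omit [T2Space G] in
theorem mfderiv_carnotExp (X V : T.gNeg) :
    (mfderiv 𝓘(ℝ, T.gNeg) 𝓘(ℝ, E') (T.carnotExp θ) X V : E') =
      invField (modelEquiv θ (opPhi (T.adNeg X) V)) (T.carnotExp θ X) := by
  have h2 := mfderiv_comp_eq_apply (g := (expMap : E' → N))
    (contMDiff_expMap.mdifferentiable (by simp) _)
    (modelEquiv θ).differentiableAt.mdifferentiableAt (Eq.refl (modelEquiv θ X)) V
  have h3 : (mfderiv 𝓘(ℝ, T.gNeg) 𝓘(ℝ, E') (modelEquiv θ) X : T.gNeg →L[ℝ] E') =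
      (modelEquiv θ : T.gNeg →L[ℝ] E') := by
    rw [mfderiv_eq_fderiv]; exact (modelEquiv θ).fderiv
  have h4 := mfderiv_expMap (G := N) (modelEquiv θ X) (modelEquiv θ V)
  rw [dexp_eq_opPhi, ← modelEquiv_opPhi] at h4
  exact h2.trans ((congrArg (fun L : T.gNeg →L[ℝ] E' =>
    (mfderiv 𝓘(ℝ, E') 𝓘(ℝ, E') (expMap : E' → N) (modelEquiv θ X) (L V : E') : E')) h3).trans h4)

omit [T2Space G] in
theorem bijective_mfderiv_carnotExp (X : T.gNeg) : Function.Bijective fun V : T.gNeg =>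
    (mfderiv 𝓘(ℝ, T.gNeg) 𝓘(ℝ, E') (T.carnotExp θ) X V : E') := by
  have h : (fun V : T.gNeg => (mfderiv 𝓘(ℝ, T.gNeg) 𝓘(ℝ, E') (T.carnotExp θ) X V : E')) =
      (fun W : E' => invField (E := E') W (T.carnotExp θ X)) ∘ modelEquiv θ ∘ opPhi (T.adNeg X) :=
    funext fun V => mfderiv_carnotExp θ X V
  rw [h]
  exact (invField_bijective (E := E') _).comp
    ((modelEquiv θ).bijective.comp (bijective_opPhi_adNeg θ X))

omit [T2Space G] in
theorem isLocalDiffeomorph_carnotExp :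
    IsLocalDiffeomorph 𝓘(ℝ, T.gNeg) 𝓘(ℝ, E') ∞ (T.carnotExp θ) :=
  isLocalDiffeomorph_of_bijective_mfderiv
    (contMDiff_expMap.comp (modelEquiv θ).contDiff.contMDiff) (bijective_mfderiv_carnotExp θ)

omit [T2Space G] in
theorem bijective_carnotExp [SimplyConnectedSpace N] : Function.Bijective (T.carnotExp θ) := by
  rw [carnotExp_eq]
  exact Function.Bijective.comp ⟨(hasContractions θ).injective_expMap,
    (hasContractions θ).surjective_expMap⟩ (modelEquiv θ).bijective

variable {ι : Type*}

omit [T2Space G] in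
/-- The pullbacks of the left invariant frames along the exponential map. -/
theorem exists_leftInvariantFrame_iff (ξ : ι → Π X : T.gNeg, TangentSpace 𝓘(ℝ, T.gNeg) X) :
    (∃ η : ι → Π x : N, TangentSpace 𝓘(ℝ, E') x, IsLeftInvariantFrame η ∧
      ∀ i, ξ i = VectorField.mpullback 𝓘(ℝ, T.gNeg) 𝓘(ℝ, E') (T.carnotExp θ) (η i)) ↔
    ∃ b : Basis ι ℝ T.gNeg, ∀ i X, opPhi (T.adNeg X) (ξ i X : T.gNeg) = b i := by
  -- The pullback of the left invariant field generated by Y is the field ζ with ψ(ad X)ζ(X) = Y.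
  have key (η : Π x : N, TangentSpace 𝓘(ℝ, E') x) (ζ : Π X : T.gNeg, TangentSpace 𝓘(ℝ, T.gNeg) X)
      (Y : T.gNeg) (hη : ∀ g, (η g : E') = invField (modelEquiv θ Y) g) :
      ζ = VectorField.mpullback 𝓘(ℝ, T.gNeg) 𝓘(ℝ, E') (T.carnotExp θ) η ↔
        ∀ X, opPhi (T.adNeg X) (ζ X : T.gNeg) = Y := by
    rw [funext_iff]
    refine forall_congr' fun X => ?_
    refine (eq_mpullback_iff (bijective_mfderiv_carnotExp θ X) η (ζ X)).trans ?_
    have e1 := mfderiv_carnotExp θ X (ζ X : T.gNeg)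
    refine ⟨fun h => (modelEquiv θ).injective (invField_injective (E := E') (T.carnotExp θ X)
      (e1.symm.trans (h.trans (hη _)))), fun h => e1.trans (Eq.trans ?_ (hη _).symm)⟩
    exact congrArg (fun Z => invField (modelEquiv θ Z) (T.carnotExp θ X)) h
  constructor
  · rintro ⟨η, hη, hξ⟩
    -- A left invariant frame is determined by its values at 1, which give the basis.
    have hinv (i : ι) (g : N) : (η i g : E') = invField (E := E') (η i 1 : E') g := by
      have := hη.leftInvariant i g 1
      rw [mul_one] at this
      exact this.symm
    have hli : LinearIndependent ℝ (M := E') fun i => (η i 1 : E') :=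
      hη.isLocalFrameOn.linearIndependent (mem_univ 1)
    have hsp : (⊤ : Submodule ℝ E') ≤ Submodule.span ℝ (range fun i => (η i 1 : E')) :=
      hη.isLocalFrameOn.generating (mem_univ 1)
    let b' : Basis ι ℝ E' := Basis.mk hli hsp
    have hb' (i : ι) : b' i = η i 1 := Basis.mk_apply hli hsp i
    refine ⟨b'.map (modelEquiv θ).symm.toLinearEquiv, fun i => ?_⟩
    refine (key (η i) (ξ i) _ fun g => ?_).mp (hξ i)
    rw [hinv i g, Basis.map_apply]
    congr 1
    rw [hb']
    exact ((modelEquiv θ).apply_symm_apply (η i 1 : E')).symm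
  · rintro ⟨b, hb⟩
    let b' (g : N) : Basis ι ℝ E' := (b.map (modelEquiv θ).toLinearEquiv).map (invFieldEquiv g)
    refine ⟨fun i g => invField (E := E') (modelEquiv θ (b i)) g,
        ⟨⟨fun {g} _ => (b' g).linearIndependent,
      fun {g} _ => (b' g).span_eq.ge,
      fun i => (contMDiff_invField (modelEquiv θ (b i))).contMDiffOn⟩, fun i g h =>
      mfderiv_mul_left_invField g h _⟩,
      fun i => (key _ (ξ i) (b i) fun g => rfl).mpr (hb i)⟩

end Carnot

end ParabolicType


/-! ### The associated bundle and normal frames. -/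

namespace ParabolicType

variable {E : Type*} [NormedAddCommGroup E] [NormedSpace ℝ E] [FiniteDimensional ℝ E]
  [CompleteSpace E]
  {G : Type*} [TopologicalSpace G] [ChartedSpace E G] [Group G] [LieGroup 𝓘(ℝ, E) ∞ G]
  (T : ParabolicType E G)

/-- The projection to `𝔤₋` along `𝔭`, as a linear map on the Lie algebra. -/
def prNegLie : GroupLieAlgebra 𝓘(ℝ, E) G →ₗ[ℝ] T.gNeg where
  toFun X := T.prNeg X
  map_add' X Y := map_add T.prNeg X Y
  map_smul' c X := map_smul T.prNeg c X

theorem ker_prNegLie : LinearMap.ker T.prNegLie = T.p :=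
  Submodule.ext fun _ => T.prNeg_eq_zero_iff

/-- The identification of `𝔤/𝔭` with `𝔤₋`. -/
def quotEquiv : (GroupLieAlgebra 𝓘(ℝ, E) G ⧸ T.p) ≃ₗ[ℝ] T.gNeg :=
  LinearEquiv.ofBijective (T.p.liftQ T.prNegLie T.ker_prNegLie.ge) <| by
    constructor
    · rw [← LinearMap.ker_eq_bot]
      exact Submodule.ker_liftQ_eq_bot _ _ _ T.ker_prNegLie.le
    · intro Y
      exact ⟨Submodule.Quotient.mk (T.incl Y : GroupLieAlgebra 𝓘(ℝ, E) G), T.prNeg_incl Y⟩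

/-- The class of a vector in `𝔤/𝔭`. -/
def quotMk (X : GroupLieAlgebra 𝓘(ℝ, E) G) : GroupLieAlgebra 𝓘(ℝ, E) G ⧸ T.p :=
  Submodule.Quotient.mk X

theorem quotEquiv_symm_apply (Y : T.gNeg) : T.quotEquiv.symm Y = T.quotMk (T.incl Y) := by
  refine T.quotEquiv.injective ?_
  rw [LinearEquiv.apply_symm_apply]
  exact (T.prNeg_incl Y).symm

variable [T2Space G] {F : Type*} [NormedAddCommGroup F] [NormedSpace ℝ F]
  [ChartedSpace F (G ⧸ T.P)]
  (hsub : Manifold.IsSubmersion 𝓘(ℝ, E) 𝓘(ℝ, F) ∞ (fun g : G => (g : G ⧸ T.P)))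

include hsub

theorem projDeriv_incl_prNeg (u : G) (Y : E) :
    T.projDeriv F u (T.incl (T.prNeg Y)) = T.projDeriv F u Y := by
  have h := (T.projDeriv_eq_zero_iff hsub (u := u)).mpr (T.incl_prNeg_sub_mem Y)
  rwa [projDeriv_sub, sub_eq_zero] at h

-- Differentiate π(g b) = π(g); this is compatibility with the P-action on G × 𝔤/𝔭.
omit [FiniteDimensional ℝ E] [T2Space G] in
theorem projDeriv_mul (u : G) (b : T.P) (Y : E) :
    T.projDeriv F (u * b) (adjointAction (b : G)⁻¹ Y) = T.projDeriv F u Y := by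
  have h1 := mfderiv_mul_right_invField u (b : G) Y
  have h2 := mfderiv_comp_eq_apply (T.mdifferentiableAt_proj hsub (u * b))
    (mdifferentiableAt_mul_right (b : G) u) rfl (invField Y u)
  have h3 : (fun g : G => (g : G ⧸ T.P)) ∘ (fun g : G => g * b) = fun g : G => (g : G ⧸ T.P) := by
    ext g
    exact QuotientGroup.mk_mul_of_mem g b.2
  rw [h3] at h2
  exact (h2.trans (congrArg (fun v : E =>
    (mfderiv 𝓘(ℝ, E) 𝓘(ℝ, F) (fun g : G => (g : G ⧸ T.P)) (u * b) v : F)) h1)).symm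

/-- The identification of `G ×_P (𝔤/𝔭)` with the tangent bundle of `G/P`, with the fibre component
taken in the model space. -/
def assocEval : T.AssocBundle → (G ⧸ T.P) × F :=
  Quot.lift (fun a => ((a.1 : G ⧸ T.P), T.projDeriv F a.1 (T.incl (T.quotEquiv a.2)))) <| by
    rintro ⟨u, w⟩ _ ⟨b, rfl⟩
    obtain ⟨Y, rfl⟩ := Submodule.Quotient.mk_surjective _ w
    refine Prod.ext (QuotientGroup.mk_mul_of_mem u b.2).symm ?_
    refine (T.projDeriv_incl_prNeg hsub u Y).trans ((T.projDeriv_mul hsub u b Y).symm.trans ?_)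
    exact (T.projDeriv_incl_prNeg hsub (u * b) (adjointAction (b : G)⁻¹ Y)).symm

/-- `Corresponds` is only a relation, and its witness may be another representative of the class;
the well-defined map `assocEval` shows that the class determines the tangent vector. -/
theorem eq_projDeriv_of_corresponds {u : G} {w : GroupLieAlgebra 𝓘(ℝ, E) G ⧸ T.p}
    {x : G ⧸ T.P} {v : TangentSpace 𝓘(ℝ, F) x} (h : T.Corresponds (T.assocMk u w) ⟨x, v⟩) :
    v = T.projDeriv F u (T.incl (T.quotEquiv w)) := by
  obtain ⟨u', Y, h1, h2⟩ := h
  have h3 := congrArg (T.assocEval hsub) h1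
  have h4 : T.assocEval hsub (T.assocMk u w) = (x, (v : F)) := by
    have h5 : ((x, (v : F)) : (G ⧸ T.P) × F) = ((u' : G ⧸ T.P), T.projDeriv F u' Y) :=
      congrArg (fun z : TangentBundle 𝓘(ℝ, F) (G ⧸ T.P) => ((z.1, z.2) : (G ⧸ T.P) × F)) h2
    have h6 : T.assocEval hsub (T.assocMk u' (Submodule.Quotient.mk Y)) =
        ((u' : G ⧸ T.P), T.projDeriv F u' Y) := Prod.ext rfl (T.projDeriv_incl_prNeg hsub u' Y)
    exact h3.trans (h6.trans h5.symm)
  exact (congrArg Prod.snd h4).symm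

omit hsub [FiniteDimensional ℝ E] [T2Space G] in
theorem corresponds_mk (u : G) (Y : E) :
    T.Corresponds (F := F)
      (T.assocMk u (T.quotMk Y))
      ⟨(u : G ⧸ T.P), T.projDeriv F u Y⟩ := ⟨u, Y, rfl, rfl⟩

section Frames

variable {E' : Type*} [NormedAddCommGroup E'] [NormedSpace ℝ E']
  [CompleteSpace E']
  {N : Type*} [TopologicalSpace N] [ChartedSpace E' N] [Group N] [LieGroup 𝓘(ℝ, E') ∞ N]
  (θ : T.gNeg ≃ₗ⁅ℝ⁆ GroupLieAlgebra 𝓘(ℝ, E') N)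

include θ in
theorem bijective_mfderiv_normalMap [FiniteDimensional ℝ E'] (X : T.gNeg) :
    Function.Bijective fun V : T.gNeg =>
      (mfderiv 𝓘(ℝ, T.gNeg) 𝓘(ℝ, F) T.normalMap X V : F) := by
  have h : (fun V : T.gNeg => (mfderiv 𝓘(ℝ, T.gNeg) 𝓘(ℝ, F) T.normalMap X V : F)) =
      (fun Y : T.gNeg => T.projDeriv F (T.flowMap X) (T.incl Y)) ∘ opPhi (T.adNeg X) :=
    funext fun V => T.mfderiv_normalMap hsub X V
  rw [h]
  exact (T.bijective_projDeriv hsub _).comp (bijective_opPhi_adNeg θ X)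

variable [CompleteSpace F]

include θ in
theorem isLocalDiffeomorph_normalMap [FiniteDimensional ℝ E'] [IsManifold 𝓘(ℝ, F) ∞ (G ⧸ T.P)] :
    IsLocalDiffeomorph 𝓘(ℝ, T.gNeg) 𝓘(ℝ, F) ∞ T.normalMap :=
  isLocalDiffeomorph_of_bijective_mfderiv (T.contMDiff_normalMap hsub)
    (T.bijective_mfderiv_normalMap hsub θ)

include θ in
/-- The pullbacks of the normal frames to the normal chart. -/
theorem exists_normalFrame_iff [FiniteDimensional ℝ E'] {ι : Type*}
    (ξ : ι → Π X : T.gNeg, TangentSpace 𝓘(ℝ, T.gNeg) X) :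
    (∃ s : ι → Π x : G ⧸ T.P, TangentSpace 𝓘(ℝ, F) x, T.IsNormalFrame s ∧
      ∀ i, ξ i = VectorField.mpullback 𝓘(ℝ, T.gNeg) 𝓘(ℝ, F) T.normalMap (s i)) ↔
    ∃ b : Basis ι ℝ T.gNeg, ∀ i X, opPhi (T.adNeg X) (ξ i X : T.gNeg) = b i := by
  have key (s : Π x : G ⧸ T.P, TangentSpace 𝓘(ℝ, F) x)
      (ζ : Π X : T.gNeg, TangentSpace 𝓘(ℝ, T.gNeg) X)
      (Y : T.gNeg) (hs : ∀ X, (s (T.normalMap X) : F) = T.projDeriv F (T.flowMap X) (T.incl Y)) :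
      ζ = VectorField.mpullback 𝓘(ℝ, T.gNeg) 𝓘(ℝ, F) T.normalMap s ↔
        ∀ X, opPhi (T.adNeg X) (ζ X : T.gNeg) = Y := by
    rw [funext_iff]
    refine forall_congr' fun X => ?_
    refine (eq_mpullback_iff (T.bijective_mfderiv_normalMap hsub θ X) s (ζ X)).trans ?_
    have e1 := T.mfderiv_normalMap hsub X (ζ X : T.gNeg)
    refine ⟨fun h => (T.bijective_projDeriv hsub (T.flowMap X)).1
      (e1.symm.trans (h.trans (hs X))), fun h => e1.trans (Eq.trans ?_ (hs X).symm)⟩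
    exact congrArg (fun Z => T.projDeriv F (T.flowMap X) (T.incl Z)) h
  constructor
  · rintro ⟨s, ⟨σ, w, hσ, hs⟩, hξ⟩
    refine ⟨w.map T.quotEquiv, fun i => ?_⟩
    refine (key (s i) (ξ i) _ fun X => ?_).mp (hξ i)
    have := T.eq_projDeriv_of_corresponds hsub (hs i _ ⟨X, rfl⟩)
    rw [hσ X] at this
    rw [Basis.map_apply]
    exact this
  · rintro ⟨b, hb⟩
    -- Injectivity of φ makes this a section over U; outside U the default value of
    -- `Function.invFun` is harmless.
    let σ : G ⧸ T.P → G := fun x => T.flowMap (Function.invFun T.normalMap x)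
    have hσ : T.IsNormalSection σ := fun X =>
      congrArg T.flowMap (Function.leftInverse_invFun T.injective_normalMap X)
    refine ⟨fun i x => T.projDeriv F (σ x) (T.incl (b i)), ⟨σ, b.map T.quotEquiv.symm, hσ, ?_⟩,
      fun i => (key _ (ξ i) (b i) fun X => ?_).mpr (hb i)⟩
    · rintro i _ ⟨X, rfl⟩
      change T.Corresponds _ ⟨T.normalMap X, T.projDeriv F (σ (T.normalMap X)) (T.incl (b i))⟩
      rw [Basis.map_apply, quotEquiv_symm_apply, hσ X]
      exact T.corresponds_mk (T.flowMap X) (T.incl (b i))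
    · exact congrArg (fun u => T.projDeriv F u (T.incl (b i))) (hσ X)

end Frames

omit hsub [T2Space G] [FiniteDimensional ℝ E] in
theorem coordField_apply {ι : Type*} (b : Basis ι ℝ T.gNeg) (i : ι) (X : T.gNeg) :
    (coordField b i X : T.gNeg) = b i := by
  have h := ((hasDerivAt_id (0 : ℝ)).smul_const (b i)).const_add X
  rw [one_smul] at h
  exact h.deriv

omit hsub [T2Space G] in
theorem opPhi_adNeg_of_isLieAbelian (h : IsLieAbelian T.gNeg) (X Y : T.gNeg) :
    opPhi (T.adNeg X) Y = Y := by
  have h0 : T.adNeg X = 0 := by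
    ext1 Y
    exact h.trivial X Y
  rw [h0, opPhi_zero]
  rfl

end ParabolicType

end ParabolicGeometry

end

theorem mainTheorem3
    {E : Type*} [NormedAddCommGroup E] [NormedSpace ℝ E] [FiniteDimensional ℝ E] [CompleteSpace E]
    {G : Type*} [TopologicalSpace G] [ChartedSpace E G] [Group G] [LieGroup 𝓘(ℝ, E) ∞ G]
    [T2Space G]
    (T : ParabolicGeometry.ParabolicType E G)
    {F : Type*} [NormedAddCommGroup F] [NormedSpace ℝ F] [FiniteDimensional ℝ F]
    [ChartedSpace F (G ⧸ T.P)] [IsManifold 𝓘(ℝ, F) ∞ (G ⧸ T.P)]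
    (hsub : Manifold.IsSubmersion 𝓘(ℝ, E) 𝓘(ℝ, F) ∞ (fun g : G => (g : G ⧸ T.P)))
    {E' : Type*} [NormedAddCommGroup E'] [NormedSpace ℝ E'] [FiniteDimensional ℝ E']
    [CompleteSpace E']
    {N : Type*} [TopologicalSpace N] [ChartedSpace E' N] [Group N] [LieGroup 𝓘(ℝ, E') ∞ N]
    [T2Space N] [SimplyConnectedSpace N]
    (θ : T.gNeg ≃ₗ⁅ℝ⁆ GroupLieAlgebra 𝓘(ℝ, E') N)
    {ι : Type*} :
    (IsLocalDiffeomorph 𝓘(ℝ, T.gNeg) 𝓘(ℝ, F) ∞ T.normalMap ∧ Function.Injective T.normalMap) ∧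
    (IsLocalDiffeomorph 𝓘(ℝ, T.gNeg) 𝓘(ℝ, E') ∞ (T.carnotExp θ) ∧
      Function.Bijective (T.carnotExp θ)) ∧
    (∀ ξ : ι → Π X : T.gNeg, TangentSpace 𝓘(ℝ, T.gNeg) X,
      (∃ s : ι → Π x : G ⧸ T.P, TangentSpace 𝓘(ℝ, F) x, T.IsNormalFrame s ∧
        ∀ i, ξ i = VectorField.mpullback 𝓘(ℝ, T.gNeg) 𝓘(ℝ, F) T.normalMap (s i)) ↔
      (∃ η : ι → Π x : N, TangentSpace 𝓘(ℝ, E') x, ParabolicGeometry.IsLeftInvariantFrame η ∧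
        ∀ i, ξ i = VectorField.mpullback 𝓘(ℝ, T.gNeg) 𝓘(ℝ, E') (T.carnotExp θ) (η i))) ∧
    (IsLieAbelian T.gNeg →
      ∀ ξ : ι → Π X : T.gNeg, TangentSpace 𝓘(ℝ, T.gNeg) X,
        (∃ s : ι → Π x : G ⧸ T.P, TangentSpace 𝓘(ℝ, F) x, T.IsNormalFrame s ∧
          ∀ i, ξ i = VectorField.mpullback 𝓘(ℝ, T.gNeg) 𝓘(ℝ, F) T.normalMap (s i)) ↔
        (∃ b : Module.Basis ι ℝ T.gNeg, ∀ i, ξ i = ParabolicGeometry.ParabolicType.coordField b i)) := by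
  have : CompleteSpace F := FiniteDimensional.complete ℝ F
  refine ⟨⟨T.isLocalDiffeomorph_normalMap hsub θ, T.injective_normalMap⟩,
    ⟨ParabolicGeometry.ParabolicType.isLocalDiffeomorph_carnotExp θ,
      ParabolicGeometry.ParabolicType.bijective_carnotExp θ⟩,
    fun ξ => (T.exists_normalFrame_iff hsub θ ξ).trans
      (ParabolicGeometry.ParabolicType.exists_leftInvariantFrame_iff θ ξ).symm,
    fun hab ξ => (T.exists_normalFrame_iff hsub θ ξ).trans (exists_congr fun b =>
      forall_congr' fun i => ?_)⟩
  rw [funext_iff]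
  refine forall_congr' fun X => ?_
  -- In the abelian case the common criterion ψ(ad X)ξ_i(X) = b_i reduces to ξ_i(X) = b_i.
  have h1 := T.opPhi_adNeg_of_isLieAbelian hab X (ξ i X)
  have h2 := T.coordField_apply b i X
  exact ⟨fun h => h1.symm.trans (h.trans h2.symm), fun h => h1.trans (h.trans h2)⟩
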